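/- Let $(E,\rho)$ be a nonempty compact metric space with $\rho\le 1$, let $d\in\mathbb{N}$, and let $\Omega=E^{\mathbb{Z}^d}$ carry the product topology and the shifts $(\theta_x\eta)(y)=\eta(y-x)$. The environment $(\eta_t)_{t\ge0}$ is a Feller process on $\Omega$ with semigroup $S^E_t$, generator $L^E$ and (càdlàg) path measures $\mathbb{P}^E_\eta$, and it is translation invariant: for every $x\in\mathbb{Z}^d$, the law of $(\theta_x\eta_t)_{t\ge 0}$ under $\mathbb{P}^E_\eta$ is $\mathbb{P}^E_{\theta_x\eta}$. For $f:\Omega\to\mathbb{R}$ put $|||f|||=\sum_{x\in\mathbb{Z}^d}\delta_f(x)$, where $\delta_f(x)$ is the supremum of $\frac{f(\eta)-f(\xi)}{\rho(\eta(x),\xi(x))}$ over all $\eta,\xi$ that differ exactly at $x$. The walker has jump rates $\alpha:\Omega\times\mathbb{Z}^d\to[0,\infty)$, with $\alpha(\cdot,z)$ continuous for each $z$, such that $$\sum_{z}\|z\|\sup_{\eta}\alpha(\eta,z)<\infty,\qquad \sum_{z}|||\alpha(\cdot,z)|||<\infty .$$ Suppose there is a coupling $(\widehat{\mathbb{P}}^E_{\eta,\xi})_{\eta,\xi\in\Omega}$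 of the environment, that is, each $\widehat{\mathbb{P}}^E_{\eta,\xi}$ is a probability measure on the càdlàg paths $(\eta^1_t,\eta^2_t)_{t\ge0}$ in $\Omega\times\Omega$ whose marginals are $\mathbb{P}^E_\eta$ and $\mathbb{P}^E_\xi$. Assume that it is translation invariant (the law of $(\theta_x\eta^1_t,\theta_x\eta^2_t)_{t\ge0}$ under $\widehat{\mathbb{P}}^E_{\eta,\xi}$ is $\widehat{\mathbb{P}}^E_{\theta_x\eta,\theta_x\xi}$) and has the strong marginal Markov property: for every continuous $f:\Omega\to\mathbb{R}$, every stopping time $\tau$ of the canonical filtration $(\mathcal{F}_t)$ of the pair, every $t\ge0$ and $i=1,2$, $$\widehat{\mathbb{E}}^E_{\eta,\xi}\big[1_{t\ge\tau}f(\eta^i_t)\,\big|\,\mathcal{F}_\tau\big]=1_{t\ge\tau}\,S^E_{t-\tau}f(\eta^i_\tau)\quad\text{a.s.}$$ Assume finally that $$\int_0^\infty t^d\sup_{\eta,\xi\in\Omega}\widehat{\mathbb{E}}^E_{\eta,\xi}\,\rho\big(\eta^1_t(0),\eta^2_t(0)\big)\,dt<\infty .$$ Then there is exactly one Feller semigroup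 $S^{EP}_t$ on $C(\Omega)$ with generator $$L^{EP}f(\eta)=L^Ef(\eta)+\sum_{z\in\mathbb{Z}^d}\alpha(\eta,z)\,[f(\theta_{-z}\eta)-f(\eta)]$$ on the domain of $L^E$ (the semigroup of the environment process $\theta_{-X_t}\eta_t$, the environment seen from the walker $X_t$), and it has exactly one invariant probability measure $\mu^{EP}$. This measure is ergodic: if $A\subseteq\Omega$ is Borel and $S^{EP}_t1_A=1_A$ $\mu^{EP}$-a.e. for all $t\ge0$ (with $S^{EP}_t$ extended to bounded Borel functions through its transition kernels), then $\mu^{EP}(A)\in\{0,1\}$. -/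

import Mathlib

open MeasureTheory ProbabilityTheory Filter Topology
open scoped NNReal ENNReal

noncomputable section

namespace RWDRE

/-! ### Càdlàg path space -/

/-- Right-continuous paths `[0,∞) → X` with left limits. -/
structure CadlagPath (X : Type*) [TopologicalSpace X] where
  toFun : ℝ≥0 → X
  right_continuous : ∀ t, ContinuousWithinAt toFun (Set.Ioi t) t
  left_limit : ∀ t, ∃ l, Tendsto toFun (𝓝[<] t) (𝓝 l)

instance CadlagPath.instCoeFun {X : Type*} [TopologicalSpace X] :
    CoeFun (CadlagPath X) (fun _ => ℝ≥0 → X) := ⟨CadlagPath.toFun⟩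

/-- The σ-algebra on path space generated by the evaluations. -/
instance CadlagPath.instMeasurableSpace {X : Type*} [TopologicalSpace X] [MeasurableSpace X] :
    MeasurableSpace (CadlagPath X) :=
  ⨆ s : ℝ≥0, MeasurableSpace.comap (fun ω : CadlagPath X => ω s) inferInstance

/-- The canonical filtration: `F_t` is generated by the evaluations at times `s ≤ t`. -/
def canonicalFiltration (X : Type*) [TopologicalSpace X] [MeasurableSpace X] :
    Filtration ℝ≥0 (CadlagPath.instMeasurableSpace (X := X)) where
  seq t := ⨆ s : Set.Iic t, MeasurableSpace.comap (fun ω : CadlagPath X => ω s) inferInstance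
  mono' := fun _ t' h => iSup_le fun s =>
    le_iSup (fun u : Set.Iic t' =>
      MeasurableSpace.comap (fun ω : CadlagPath X => ω u) inferInstance)
      ⟨s.1, le_trans s.2 h⟩
  le' := fun _ => iSup_le fun s =>
    le_iSup (fun u : ℝ≥0 =>
      MeasurableSpace.comap (fun ω : CadlagPath X => ω u) inferInstance) s.1

/-- The image of a path under a continuous map, applied at every time. -/
def CadlagPath.map {X Y : Type*} [TopologicalSpace X] [TopologicalSpace Y] (g : C(X, Y))
    (ω : CadlagPath X) : CadlagPath Y where
  toFun t := g (ω t)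
  right_continuous t := g.continuous.continuousAt.comp_continuousWithinAt (ω.right_continuous t)
  left_limit t := by
    obtain ⟨l, hl⟩ := ω.left_limit t
    exact ⟨g l, (g.continuous.tendsto l).comp hl⟩

/-! ### Feller semigroups and Feller processes on a compact space -/

/-- A conservative Feller semigroup on a compact space, given by its transition kernels. -/
@[ext]
structure FellerSemigroup (X : Type*) [TopologicalSpace X] [CompactSpace X]
    [MeasurableSpace X] where
  kernel : ℝ≥0 → Kernel X X
  markov : ∀ t, IsMarkovKernel (kernel t)
  kernel_zero : kernel 0 = Kernel.id
  kernel_add : ∀ s t, kernel (s + t) = kernel t ∘ₖ kernel s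
  feller : ∀ t (f : C(X, ℝ)), Continuous fun x => ∫ y, f y ∂(kernel t x)
  strongly_continuous : ∀ f : C(X, ℝ),
    TendstoUniformly (fun (t : ℝ≥0) x => ∫ y, f y ∂(kernel t x)) f (𝓝 0)

namespace FellerSemigroup

variable {X : Type*} [TopologicalSpace X] [CompactSpace X] [MeasurableSpace X]

/-- The action `S_t` on `C(X)`. -/
def op (S : FellerSemigroup X) (t : ℝ≥0) (f : C(X, ℝ)) : C(X, ℝ) :=
  ⟨fun x => ∫ y, f y ∂(S.kernel t x), S.feller t f⟩

/-- The graph of the generator: `f` is in the domain and is mapped to `g`, where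
`(S_t f - f) / t → g` uniformly as `t ↓ 0`. -/
def GeneratorGraph (S : FellerSemigroup X) (f g : C(X, ℝ)) : Prop :=
  Tendsto (fun t : ℝ≥0 => (t : ℝ)⁻¹ • (S.op t f - f)) (𝓝[>] 0) (𝓝 g)

/-- `μ` is invariant: `μ S_t = μ` for all `t`. -/
def IsInvariant (S : FellerSemigroup X) (μ : Measure X) : Prop :=
  ∀ t, Kernel.Invariant (S.kernel t) μ

/-- `μ` is ergodic: it is invariant and every measurable set `A` that is invariant modulo `μ`
under the dynamics (`S_t 1_A = 1_A` `μ`-a.e. for every `t`) is trivial. -/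
def IsErgodic (S : FellerSemigroup X) (μ : Measure X) : Prop :=
  S.IsInvariant μ ∧
    ∀ A : Set X, MeasurableSet A →
      (∀ t, ∀ᵐ x ∂μ, S.kernel t x A = A.indicator (fun _ => (1 : ℝ≥0∞)) x) →
      μ A = 0 ∨ μ Aᶜ = 0

end FellerSemigroup

/-- A Feller process: a Feller semigroup together with the path space measures `ℙ_x`, under which
the canonical process starts in `x` and is Markov with this semigroup. -/
structure FellerProcess (X : Type*) [TopologicalSpace X] [CompactSpace X]
    [MeasurableSpace X] extends FellerSemigroup X where
  law : X → Measure (CadlagPath X)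
  isProbabilityMeasure_law : ∀ x, IsProbabilityMeasure (law x)
  start : ∀ x, ∀ᵐ ω ∂(law x), ω 0 = x
  markov_property : ∀ x (f : C(X, ℝ)) (s t : ℝ≥0), s ≤ t →
    (law x)[fun ω => f (ω t) | canonicalFiltration X s]
      =ᵐ[law x] fun ω => toFellerSemigroup.op (t - s) f (ω s)

/-! ### Configurations and Lipschitz seminorms -/

/-- Configurations `Ω = E^{ℤ^d}`, with the product topology and product σ-algebra. -/
abbrev Config (d : ℕ) (E : Type*) := (Fin d → ℤ) → E

/-- The shift `(θ_x η)(y) = η (y - x)`. -/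
def shift {d : ℕ} {E : Type*} [TopologicalSpace E] (x : Fin d → ℤ) :
    C(Config d E, Config d E) :=
  ⟨fun η y => η (y - x), continuous_pi fun y => continuous_apply (y - x)⟩

/-- `δ_f(x)`, the Lipschitz constant of `f` with respect to the coordinate at `x`. -/
def lipAt {d : ℕ} {E : Type*} [MetricSpace E] (f : Config d E → ℝ) (x : Fin d → ℤ) : ℝ≥0∞ :=
  ⨆ (η : Config d E) (ξ : Config d E) (_ : η x ≠ ξ x ∧ ∀ y, y ≠ x → η y = ξ y),
    ENNReal.ofReal ((f η - f ξ) / dist (η x) (ξ x))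

/-- `|||f||| = ∑_x δ_f(x)`. -/
def tripleNorm {d : ℕ} {E : Type*} [MetricSpace E] (f : Config d E → ℝ) : ℝ≥0∞ :=
  ∑' x, lipAt f x

/-! ### Jump rates and the environment process -/

/-- Jump rates of the walker: `rate η z` is the rate to jump by `z` when the environment seen from
the walker is `η`. -/
structure JumpRates (d : ℕ) (E : Type*) [MetricSpace E] where
  rate : Config d E → (Fin d → ℤ) → ℝ≥0
  continuous_rate : ∀ z, Continuous fun η => rate η z
  /-- `∑_z ‖z‖ sup_η α(η, z) < ∞` -/
  first_moment : ∑' z : Fin d → ℤ, ‖z‖ₑ * ⨆ η, (rate η z : ℝ≥0∞) < ∞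
  /-- `∑_z |||α(·, z)||| < ∞` -/
  tripleNorm_lt_top : ∑' z : Fin d → ℤ, tripleNorm (fun η => (rate η z : ℝ)) < ∞

variable {d : ℕ} {E : Type*} [MetricSpace E] [CompactSpace E] [MeasurableSpace E]

/-- `T` is the semigroup of the environment process `θ_{-X_t} η_t`: its generator is
`L^{EP} f (η) = L^E f (η) + ∑_z α(η, z) [f (θ_{-z} η) - f η]`, with the domain of `L^E`. -/
def IsEnvironmentProcess (S : FellerSemigroup (Config d E)) (α : JumpRates d E)
    (T : FellerSemigroup (Config d E)) : Prop :=
  ∀ f g : C(Config d E, ℝ), T.GeneratorGraph f g ↔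
    ∃ h : C(Config d E, ℝ), S.GeneratorGraph f h ∧
      ∀ η, g η = h η + ∑' z : Fin d → ℤ, (α.rate η z : ℝ) * (f (shift (-z) η) - f η)

/-- The law of the environment commutes with translations: the law of `(θ_x η_t)_t` under `ℙ_η`
is `ℙ_{θ_x η}`. -/
def TranslationInvariant (P : FellerProcess (Config d E)) : Prop :=
  ∀ x η, (P.law η).map (CadlagPath.map (shift x)) = P.law (shift x η)

/-! ### Couplings of the environment -/

/-- The strong marginal Markov property of a law `Q` of a pair process, for the marginal selected by
`π`: `𝔼[1_{t ≥ τ} f(η^i_t) | F_τ] = 1_{t ≥ τ} S_{t-τ} f(η^i_τ)` for all stopping times `τ` of the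
canonical filtration of the pair. -/
def StrongMarginalMarkov (S : FellerSemigroup (Config d E))
    (π : C(Config d E × Config d E, Config d E))
    (Q : Measure (CadlagPath (Config d E × Config d E))) : Prop :=
  ∀ (f : C(Config d E, ℝ)) (τ : CadlagPath (Config d E × Config d E) → WithTop ℝ≥0)
    (hτ : IsStoppingTime (canonicalFiltration (Config d E × Config d E)) τ) (t : ℝ≥0),
    Q[{ω | τ ω ≤ t}.indicator (fun ω => f (π (ω t))) | hτ.measurableSpace]
      =ᵐ[Q] {ω | τ ω ≤ t}.indicator
        (fun ω => S.op (t - (τ ω).untopA) f (π (ω (τ ω).untopA)))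

/-- A translation invariant coupling of the environment with the strong marginal Markov
property. -/
structure EnvironmentCoupling (P : FellerProcess (Config d E)) where
  law : Config d E → Config d E → Measure (CadlagPath (Config d E × Config d E))
  isProbabilityMeasure_law : ∀ η ξ, IsProbabilityMeasure (law η ξ)
  marginal_fst : ∀ η ξ, (law η ξ).map (CadlagPath.map ContinuousMap.fst) = P.law η
  marginal_snd : ∀ η ξ, (law η ξ).map (CadlagPath.map ContinuousMap.snd) = P.law ξ
  translation_invariant : ∀ x η ξ,
    (law η ξ).map (CadlagPath.map ((shift x).prodMap (shift x))) = law (shift x η) (shift x ξ)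
  strongMarkov_fst : ∀ η ξ,
    StrongMarginalMarkov P.toFellerSemigroup ContinuousMap.fst (law η ξ)
  strongMarkov_snd : ∀ η ξ,
    StrongMarginalMarkov P.toFellerSemigroup ContinuousMap.snd (law η ξ)

/-- `∫_0^∞ t^d sup_{η,ξ} 𝔼_{η,ξ} ρ(η^1_t(0), η^2_t(0)) dt < ∞`. -/
def EnvironmentCoupling.IntegrableDecay {P : FellerProcess (Config d E)}
    (Q : EnvironmentCoupling P) : Prop :=
  ∫⁻ t in Set.Ioi (0 : ℝ), ENNReal.ofReal t ^ d *
    ⨆ (η : Config d E) (ξ : Config d E),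
      ∫⁻ ω, edist ((ω t.toNNReal).1 0) ((ω t.toNNReal).2 0) ∂(Q.law η ξ) < ∞

end RWDRE

end

noncomputable section

set_option linter.unusedSectionVars false

namespace RWDRE

/-! ### Basic properties of Feller semigroups -/

/-! The jump part `J` of the generator is a bounded operator on C(Ω). If `c` bounds the total jump
rate, then `J + c` is positive and maps the constant 1 to `c`. Hence L + J is a bounded perturbation
of L with the same domain, and the Duhamel equation for its semigroup is solved by Banach's fixed
point theorem (`exists_perturbation`). A Feller semigroup is determined by its generator
(`eq_of_generatorGraph`), and compactness gives an invariant measure (`exists_isInvariant`). A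
unique invariant measure is ergodic, since conditioning it on an invariant set of positive mass
gives an invariant measure again (`IsInvariant.isErgodic`). What remains is uniqueness of the
invariant measure.

For invariant μ the integral of f equals that of a R_a f, where R_a is the resolvent of the
environment process. It is therefore enough that the oscillation of u = R_a f stays bounded as a →
0, for f in a dense set (`IsInvariant.eq_of_resolvent_bounded`); the dense set consists of the f
with summable coordinatewise Lipschitz weights.

To bound this oscillation O, run two walkers from one site in the two coupled environments. They
jump together at the minimum of their rates and are given up once they split or leave a ball growing
at linear speed γ. While they are together, the difference of u is paid for by differences of f, at
a cost of at most a constant times the expected discrepancy per site of the ball; when they are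
lost, it is at most O. A walk with a finite first moment stays in such balls forever with
probability at least 1/2 (`exists_survival`). The splitting rate is again controlled by
discrepancies in the ball, whose cardinality grows like t^d. By the integrability hypothesis all
these costs are small if the walkers start at a late time r, so the loss probability is at most 3/4
(`le_mass`, `exists_sum_card_box_le`). This gives osc(S_r u) ≤ (3/4) O + const, with S the
environment semigroup (`op_sub_op_le`). Requiring that no jump occurs before time r, an event of
positive probability, bounds O by osc(S_r u) (`sub_le_exp_mul_op_sub`). The two bounds together
bound O uniformly in a ≤ 1 (`exists_resolvent_sub_le`).

The walkers are never constructed. In discrete time with step h, the sub-probability that they are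
together at a site is an explicit functional `couple` of the environment path, so the marginal
Markov property at deterministic times suffices. The discretization error `stepError` vanishes as h
→ 0 for fixed a. -/

theorem integrable_continuousMap {X : Type*} [TopologicalSpace X] [CompactSpace X]
    [MeasurableSpace X] [OpensMeasurableSpace X] (μ : Measure X) [IsFiniteMeasure μ]
    (f : C(X, ℝ)) : Integrable f μ :=
  f.continuous.integrable_of_hasCompactSupport (HasCompactSupport.of_compactSpace f)

namespace FellerSemigroup

variable {X : Type*} [TopologicalSpace X] [CompactSpace X] [MeasurableSpace X] [BorelSpace X]
variable (S : FellerSemigroup X)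

instance (t : ℝ≥0) : IsMarkovKernel (S.kernel t) := S.markov t

theorem op_apply (t : ℝ≥0) (f : C(X, ℝ)) (x : X) : S.op t f x = ∫ y, f y ∂(S.kernel t x) := rfl

theorem op_add (t : ℝ≥0) (f g : C(X, ℝ)) : S.op t (f + g) = S.op t f + S.op t g := by
  ext x
  simpa [op_apply] using integral_add (integrable_continuousMap _ f) (integrable_continuousMap _ g)

theorem op_smul (t : ℝ≥0) (c : ℝ) (f : C(X, ℝ)) : S.op t (c • f) = c • S.op t f := by
  ext x
  simpa [op_apply] using integral_const_mul c f

theorem op_mono (t : ℝ≥0) {f g : C(X, ℝ)} (h : ∀ x, f x ≤ g x) (x : X) :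
    S.op t f x ≤ S.op t g x :=
  integral_mono (integrable_continuousMap _ f) (integrable_continuousMap _ g) h

theorem op_const (t : ℝ≥0) (c : ℝ) : S.op t (ContinuousMap.const X c) = ContinuousMap.const X c := by
  ext x
  simp [op_apply]

theorem op_le (t : ℝ≥0) {f : C(X, ℝ)} {c : ℝ} (h : ∀ x, f x ≤ c) (x : X) : S.op t f x ≤ c := by
  simpa [op_const] using S.op_mono t (g := ContinuousMap.const X c) h x

theorem le_op (t : ℝ≥0) {f : C(X, ℝ)} {c : ℝ} (h : ∀ x, c ≤ f x) (x : X) : c ≤ S.op t f x := by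
  simpa [op_const] using S.op_mono t (f := ContinuousMap.const X c) h x

theorem norm_op_le (t : ℝ≥0) (f : C(X, ℝ)) : ‖S.op t f‖ ≤ ‖f‖ := by
  rw [ContinuousMap.norm_le _ (norm_nonneg f)]
  intro x
  rw [Real.norm_eq_abs, abs_le]
  have h : ∀ y, |f y| ≤ ‖f‖ := fun y => by simpa using f.norm_coe_le_norm y
  exact ⟨S.le_op t (fun y => (abs_le.1 (h y)).1) x, S.op_le t (fun y => (abs_le.1 (h y)).2) x⟩

/-- `S_t` as a bounded operator on `C(X)`. -/
def opL (t : ℝ≥0) : C(X, ℝ) →L[ℝ] C(X, ℝ) :=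
  LinearMap.mkContinuous ⟨⟨S.op t, S.op_add t⟩, S.op_smul t⟩ 1
    (fun f => by simpa using S.norm_op_le t f)

@[simp] theorem opL_apply (t : ℝ≥0) (f : C(X, ℝ)) : S.opL t f = S.op t f := rfl

theorem op_sub (t : ℝ≥0) (f g : C(X, ℝ)) : S.op t (f - g) = S.op t f - S.op t g :=
  map_sub (S.opL t) f g

theorem op_zero (f : C(X, ℝ)) : S.op 0 f = f := by
  ext x
  rw [op_apply, S.kernel_zero, Kernel.id_apply, integral_dirac' _ _ f.continuous.stronglyMeasurable]

theorem op_op (s t : ℝ≥0) (f : C(X, ℝ)) : S.op s (S.op t f) = S.op (s + t) f := by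
  ext x
  rw [op_apply, op_apply, S.kernel_add, Kernel.integral_comp]
  · rfl
  · exact integrable_continuousMap _ f

theorem tendsto_op_zero (f : C(X, ℝ)) : Tendsto (fun t => S.op t f) (𝓝 0) (𝓝 f) := by
  rw [ContinuousMap.tendsto_iff_tendstoUniformly]
  exact S.strongly_continuous f

theorem norm_op_sub_op_le (s t : ℝ≥0) (h : s ≤ t) (f : C(X, ℝ)) :
    ‖S.op t f - S.op s f‖ ≤ ‖S.op (t - s) f - f‖ := by
  conv_lhs => rw [← add_tsub_cancel_of_le h, ← op_op, ← op_sub]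
  exact S.norm_op_le _ _

/-- The time lag enters as a distance, so that continuity in time follows from both sides by one
limit at zero. -/
theorem norm_op_sub_op_le' (s t : ℝ≥0) (f : C(X, ℝ)) :
    ‖S.op t f - S.op s f‖ ≤ ‖S.op (nndist t s) f - f‖ := by
  rcases le_total s t with h | h
  · have : nndist t s = t - s := by
      ext; rw [coe_nndist, NNReal.dist_eq, NNReal.coe_sub h, abs_of_nonneg]; simpa using h
    rw [this]; exact S.norm_op_sub_op_le s t h f
  · have : nndist t s = t - s ∨ nndist t s = s - t := Or.inr (by
      ext; rw [coe_nndist, dist_comm, NNReal.dist_eq, NNReal.coe_sub h, abs_of_nonneg]; simpa using h)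
    rcases this with h' | h'
    · rw [h', tsub_eq_zero_of_le h, op_zero, sub_self, norm_zero, norm_sub_rev]
      have := S.norm_op_sub_op_le t s h f
      have h2 : s = t := le_antisymm (by
        have h3 : nndist t s = 0 := by rw [h', tsub_eq_zero_of_le h]
        rw [nndist_eq_zero.1 h3]) h
      rw [h2, sub_self, norm_zero]
    · rw [h', norm_sub_rev]; exact S.norm_op_sub_op_le t s h f

/-- Joint continuity of `(t, f) ↦ S_t f`. -/
theorem continuous_op : Continuous fun p : ℝ≥0 × C(X, ℝ) => S.op p.1 p.2 := by
  rw [continuous_iff_continuousAt]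
  rintro ⟨t, f⟩
  rw [ContinuousAt, tendsto_iff_norm_sub_tendsto_zero]
  have h1 : Tendsto (fun p : ℝ≥0 × C(X, ℝ) => ‖p.2 - f‖ + ‖S.op (nndist p.1 t) f - f‖)
      (𝓝 (t, f)) (𝓝 (‖f - f‖ + ‖f - f‖)) := by
    refine Tendsto.add (Continuous.tendsto (f := fun p : ℝ≥0 × C(X, ℝ) => ‖p.2 - f‖)
      (by fun_prop) (t, f)) ?_
    refine (((S.tendsto_op_zero f).comp ?_).sub_const f).norm
    have : Continuous fun p : ℝ≥0 × C(X, ℝ) => nndist p.1 t := by fun_prop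
    simpa using this.tendsto (t, f)
  rw [sub_self, norm_zero, add_zero] at h1
  refine squeeze_zero (fun _ => norm_nonneg _) (fun p => ?_) h1
  calc ‖S.op p.1 p.2 - S.op t f‖ = ‖S.op p.1 (p.2 - f) + (S.op p.1 f - S.op t f)‖ := by
        rw [op_sub]; congr 1; abel
    _ ≤ _ := (norm_add_le _ _).trans (add_le_add (S.norm_op_le _ _) (S.norm_op_sub_op_le' _ _ _))

theorem continuous_op_left (f : C(X, ℝ)) : Continuous fun t => S.op t f :=
  S.continuous_op.comp (by fun_prop : Continuous fun t : ℝ≥0 => (t, f))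

theorem continuous_op_toNNReal (f : C(X, ℝ)) : Continuous fun t : ℝ => S.op t.toNNReal f :=
  (S.continuous_op_left f).comp continuous_real_toNNReal

/-! ### The generator -/

variable {S}

theorem GeneratorGraph.tendsto {f g : C(X, ℝ)} (h : S.GeneratorGraph f g) :
    Tendsto (fun t : ℝ => t⁻¹ • (S.op t.toNNReal f - f)) (𝓝[>] 0) (𝓝 g) := by
  have h1 : Tendsto Real.toNNReal (𝓝[>] (0 : ℝ)) (𝓝[>] 0) := by
    refine tendsto_nhdsWithin_of_tendsto_nhds_of_eventually_within _ ?_ ?_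
    · exact tendsto_nhdsWithin_of_tendsto_nhds (by simpa using continuous_real_toNNReal.tendsto 0)
    · filter_upwards [self_mem_nhdsWithin] with t ht using by simpa using ht
  refine (Tendsto.comp (f := Real.toNNReal) h h1).congr' ?_
  filter_upwards [self_mem_nhdsWithin] with t ht
  simp [Real.coe_toNNReal t (le_of_lt ht)]

theorem generatorGraph_of_tendsto {f g : C(X, ℝ)}
    (h : Tendsto (fun t : ℝ => t⁻¹ • (S.op t.toNNReal f - f)) (𝓝[>] 0) (𝓝 g)) :
    S.GeneratorGraph f g := by
  have h1 : Tendsto NNReal.toReal (𝓝[>] (0 : ℝ≥0)) (𝓝[>] 0) := by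
    refine tendsto_nhdsWithin_of_tendsto_nhds_of_eventually_within _ ?_ ?_
    · exact tendsto_nhdsWithin_of_tendsto_nhds (by simpa using NNReal.continuous_coe.tendsto 0)
    · filter_upwards [self_mem_nhdsWithin] with t ht using by simpa using ht
  simpa [Function.comp_def] using! h.comp h1

theorem generatorGraph_iff {f g : C(X, ℝ)} : S.GeneratorGraph f g ↔
    Tendsto (fun t : ℝ => t⁻¹ • (S.op t.toNNReal f - f)) (𝓝[>] 0) (𝓝 g) :=
  ⟨GeneratorGraph.tendsto, generatorGraph_of_tendsto⟩

theorem GeneratorGraph.op {f g : C(X, ℝ)} (h : S.GeneratorGraph f g) (s : ℝ≥0) :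
    S.GeneratorGraph (S.op s f) (S.op s g) := by
  refine (((S.opL s).continuous.tendsto g).comp h).congr fun t => ?_
  simp only [Function.comp, map_smul, map_sub, opL_apply, op_op, add_comm s t]

theorem GeneratorGraph.smul {f g : C(X, ℝ)} (h : S.GeneratorGraph f g) (c : ℝ) :
    S.GeneratorGraph (c • f) (c • g) := by
  refine (h.const_smul c).congr fun t => ?_
  rw [op_smul, ← smul_sub, smul_comm]

/-- The right derivative of `t ↦ S_t f` is `S_t g` if `(f, g)` is in the generator. -/
theorem GeneratorGraph.hasDerivWithinAt {f g : C(X, ℝ)} (h : S.GeneratorGraph f g) {s : ℝ}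
    (hs : 0 ≤ s) :
    HasDerivWithinAt (fun t : ℝ => S.op t.toNNReal f) (S.op s.toNNReal g) (Set.Ici s) s := by
  rw [← hasDerivWithinAt_Ioi_iff_Ici, hasDerivWithinAt_iff_tendsto_slope' (by simp)]
  have h1 : Tendsto (fun t : ℝ => t - s) (𝓝[>] s) (𝓝[>] 0) := by
    refine tendsto_nhdsWithin_of_tendsto_nhds_of_eventually_within _ ?_ ?_
    · exact tendsto_nhdsWithin_of_tendsto_nhds
        (by simpa using (continuous_id.sub continuous_const).tendsto s (f := fun t : ℝ => t - s))
    · filter_upwards [self_mem_nhdsWithin] with t ht using by simpa using ht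
  refine ((h.op s.toNNReal).tendsto.comp h1).congr' ?_
  filter_upwards [self_mem_nhdsWithin] with t ht
  rw [Function.comp, slope_def_module, op_op]
  congr 3
  rw [← Real.toNNReal_add (sub_nonneg.2 (le_of_lt ht)) hs, sub_add_cancel]

/-- A Feller semigroup is determined by its generator as soon as the domain is dense. -/
theorem op_eq_of_generatorGraph {T : FellerSemigroup X}
    (h : ∀ f g, S.GeneratorGraph f g → T.GeneratorGraph f g) {f g : C(X, ℝ)}
    (hf : S.GeneratorGraph f g) (t : ℝ≥0) : S.op t f = T.op t f := by
  -- The derivative of s ↦ T_{t-s} S_s f is T_{t-s} applied to the difference of the two generators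
  -- at S_s f, hence zero. Right derivatives suffice.
  have key := constant_of_has_deriv_right_zero (a := 0) (b := t)
    (f := fun s : ℝ => T.op (t - s.toNNReal) (S.op s.toNNReal f)) ?_ ?_ t ⟨t.2, le_rfl⟩
  · simpa [op_zero] using key
  · refine (T.continuous_op.comp (f := fun s : ℝ => (t - s.toNNReal, S.op s.toNNReal f)) ?_).continuousOn
    exact (by fun_prop : Continuous fun s : ℝ => t - s.toNNReal).prodMk (S.continuous_op_toNNReal f)
  · rintro s ⟨hs0, hst⟩
    rw [← hasDerivWithinAt_Ioi_iff_Ici, hasDerivWithinAt_iff_tendsto_slope' (by simp)]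
    set w := S.op s.toNNReal f with hw
    have h1 : Tendsto (fun r : ℝ => r - s) (𝓝[>] s) (𝓝[>] 0) := by
      refine tendsto_nhdsWithin_of_tendsto_nhds_of_eventually_within _ ?_ ?_
      · exact tendsto_nhdsWithin_of_tendsto_nhds
          (by simpa using (continuous_id.sub continuous_const).tendsto s (f := fun t : ℝ => t - s))
      · filter_upwards [self_mem_nhdsWithin] with t ht using by simpa using ht
    have hS := (hf.op s.toNNReal)
    have h2 := ((hS.tendsto.sub (h _ _ hS).tendsto).comp h1).norm
    rw [sub_self, norm_zero] at h2
    rw [tendsto_zero_iff_norm_tendsto_zero]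
    refine squeeze_zero' (Eventually.of_forall fun _ => norm_nonneg _) ?_ h2
    have h3 : ∀ᶠ r in 𝓝[>] s, r ∈ Set.Ioc s t := Ioc_mem_nhdsGT hst
    filter_upwards [h3] with r hr
    have e1 : r.toNNReal = (r - s).toNNReal + s.toNNReal := by
      rw [← Real.toNNReal_add (sub_nonneg.2 hr.1.le) hs0, sub_add_cancel]
    have hrt : r.toNNReal ≤ t := by rw [Real.toNNReal_le_iff_le_coe]; exact hr.2
    -- With this splitting both values are images under the contraction T_{t-r}, so the slope is
    -- controlled by the difference quotients of S and T at `w` alone.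
    have e2 : t - s.toNNReal = (t - r.toNNReal) + (r - s).toNNReal := by
      rw [e1] at hrt ⊢
      rw [tsub_add_eq_tsub_tsub_swap, tsub_add_cancel_of_le]
      exact le_tsub_of_add_le_right hrt
    rw [slope_def_module, e2, ← op_op, e1, ← op_op, ← hw, ← op_sub, ← op_smul]
    refine (T.norm_op_le _ _).trans (le_of_eq ?_)
    simp only [Function.comp]
    rw [← smul_sub]
    congr 2
    abel

/-! ### The resolvent -/

variable (S)

/-- The resolvent `R_a f = ∫_0^∞ e^{-a t} S_t f dt`. -/
def resolvent (a : ℝ) (f : C(X, ℝ)) : C(X, ℝ) :=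
  ∫ t in Set.Ioi (0 : ℝ), Real.exp (-(a * t)) • S.op t.toNNReal f

theorem integrableOn_exp_smul_op {a : ℝ} (ha : 0 < a) (f : C(X, ℝ)) (b : ℝ) :
    IntegrableOn (fun t : ℝ => Real.exp (-(a * t)) • S.op t.toNNReal f) (Set.Ioi b) := by
  have h1 : IntegrableOn (fun t : ℝ => Real.exp (-(a * t)) * ‖f‖) (Set.Ioi b) := by
    simpa [IntegrableOn] using (exp_neg_integrableOn_Ioi b ha).mul_const ‖f‖
  refine Integrable.mono' h1 ?_ (Eventually.of_forall fun t => ?_)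
  · refine Continuous.aestronglyMeasurable ?_
    exact (by fun_prop : Continuous fun t : ℝ => Real.exp (-(a * t))).smul
      (S.continuous_op_toNNReal f)
  · rw [norm_smul, Real.norm_eq_abs, Real.abs_exp]
    exact mul_le_mul_of_nonneg_left (S.norm_op_le _ _) (Real.exp_pos _).le

theorem resolvent_apply {a : ℝ} (ha : 0 < a) (f : C(X, ℝ)) (x : X) : S.resolvent a f x =
    ∫ t in Set.Ioi (0 : ℝ), Real.exp (-(a * t)) * S.op t.toNNReal f x := by
  rw [resolvent, ContinuousMap.integral_apply (S.integrableOn_exp_smul_op ha f 0)]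
  rfl

theorem resolvent_add {a : ℝ} (ha : 0 < a) (f g : C(X, ℝ)) :
    S.resolvent a (f + g) = S.resolvent a f + S.resolvent a g := by
  simp only [resolvent, op_add, smul_add]
  exact integral_add (S.integrableOn_exp_smul_op ha f 0) (S.integrableOn_exp_smul_op ha g 0)

theorem resolvent_smul (a c : ℝ) (f : C(X, ℝ)) :
    S.resolvent a (c • f) = c • S.resolvent a f := by
  simp only [resolvent, op_smul, smul_comm _ c]
  exact integral_smul _ _

theorem resolvent_nonneg {a : ℝ} (ha : 0 < a) {f : C(X, ℝ)} (hf : ∀ x, 0 ≤ f x) (x : X) :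
    0 ≤ S.resolvent a f x := by
  rw [S.resolvent_apply ha]
  exact integral_nonneg fun t => mul_nonneg (Real.exp_pos _).le (S.le_op _ hf x)

theorem integral_exp_neg_mul_Ioi {a : ℝ} (ha : 0 < a) :
    ∫ t in Set.Ioi (0 : ℝ), Real.exp (-(a * t)) = a⁻¹ := by
  have := integral_exp_mul_Ioi (neg_lt_zero.2 ha) 0
  simpa [neg_mul, neg_div_neg_eq, one_div] using this

theorem resolvent_const {a : ℝ} (ha : 0 < a) (c : ℝ) (x : X) :
    a * S.resolvent a (ContinuousMap.const X c) x = c := by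
  rw [S.resolvent_apply ha]
  simp only [op_const, ContinuousMap.const_apply]
  rw [integral_mul_const, integral_exp_neg_mul_Ioi ha, ← mul_assoc, mul_inv_cancel₀ ha.ne', one_mul]

theorem abs_smul_resolvent_le {a : ℝ} (ha : 0 < a) (f : C(X, ℝ)) (x : X) :
    |a * S.resolvent a f x| ≤ ‖f‖ := by
  rw [S.resolvent_apply ha, abs_mul, abs_of_pos ha]
  have h1 : IntegrableOn (fun t : ℝ => Real.exp (-(a * t)) * ‖f‖) (Set.Ioi 0) := by
    simpa [IntegrableOn] using (exp_neg_integrableOn_Ioi 0 ha).mul_const ‖f‖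
  have h2 : ‖∫ t in Set.Ioi (0 : ℝ), Real.exp (-(a * t)) * S.op t.toNNReal f x‖ ≤
      ∫ t in Set.Ioi (0 : ℝ), Real.exp (-(a * t)) * ‖f‖ := by
    refine norm_integral_le_of_norm_le h1 (Eventually.of_forall fun t => ?_)
    rw [norm_mul, Real.norm_eq_abs, Real.abs_exp]
    exact mul_le_mul_of_nonneg_left (((S.op _ f).norm_coe_le_norm x).trans (S.norm_op_le _ _))
      (Real.exp_pos _).le
  rw [integral_mul_const, integral_exp_neg_mul_Ioi ha] at h2
  calc _ ≤ a * (a⁻¹ * ‖f‖) := mul_le_mul_of_nonneg_left h2 ha.le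
    _ = ‖f‖ := by rw [← mul_assoc, mul_inv_cancel₀ ha.ne', one_mul]

/-- S_s moves the integration window from (0,∞) to (s,∞) at the price of a factor e^{as}.
Differentiating at s = 0 then identifies the generator on the range of the resolvent. -/
theorem op_resolvent {a : ℝ} (ha : 0 < a) (f : C(X, ℝ)) {s : ℝ} (hs : 0 ≤ s) :
    S.op s.toNNReal (S.resolvent a f) = Real.exp (a * s) •
      (S.resolvent a f - ∫ t in (0 : ℝ)..s, Real.exp (-(a * t)) • S.op t.toNNReal f) := by
  have hint := S.integrableOn_exp_smul_op ha f 0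
  rw [← opL_apply, resolvent, ← ContinuousLinearMap.integral_comp_comm _ hint,
    intervalIntegral.integral_of_le hs]
  have h1 : ∫ t in Set.Ioi (0 : ℝ), Real.exp (-(a * t)) • S.op t.toNNReal f =
      (∫ t in Set.Ioc (0 : ℝ) s, Real.exp (-(a * t)) • S.op t.toNNReal f) +
      ∫ t in Set.Ioi s, Real.exp (-(a * t)) • S.op t.toNNReal f := by
    rw [← Set.Ioc_union_Ioi_eq_Ioi hs]
    exact setIntegral_union (Set.Ioc_disjoint_Ioi le_rfl) measurableSet_Ioi
      (hint.mono_set Set.Ioc_subset_Ioi_self) (S.integrableOn_exp_smul_op ha f s)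
  rw [h1, add_sub_cancel_left]
  have h2 := (measurePreserving_add_right volume s).setIntegral_preimage_emb
    (measurableEmbedding_addRight s) (fun t : ℝ => Real.exp (-(a * t)) • S.op t.toNNReal f)
    (Set.Ioi s)
  rw [Set.preimage_add_const_Ioi, sub_self] at h2
  rw [← h2, ← integral_smul]
  refine setIntegral_congr_fun measurableSet_Ioi fun t ht => ?_
  have ht' : 0 ≤ t := le_of_lt ht
  simp only [map_smul, opL_apply, op_op, smul_smul, ← Real.exp_add]
  rw [← Real.toNNReal_add hs ht', add_comm s t]
  congr 2
  ring

/-- `R_a f` is in the domain of the generator, which maps it to `a R_a f - f`. -/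
theorem generatorGraph_resolvent {a : ℝ} (ha : 0 < a) (f : C(X, ℝ)) :
    S.GeneratorGraph (S.resolvent a f) (a • S.resolvent a f - f) := by
  apply generatorGraph_of_tendsto
  set u := S.resolvent a f
  set F : ℝ → C(X, ℝ) := fun s => ∫ t in (0 : ℝ)..s, Real.exp (-(a * t)) • S.op t.toNNReal f
  have hc : Continuous fun t : ℝ => Real.exp (-(a * t)) • S.op t.toNNReal f :=
    (by fun_prop : Continuous fun t : ℝ => Real.exp (-(a * t))).smul (S.continuous_op_toNNReal f)
  have hF : HasDerivAt F (Real.exp (-(a * 0)) • S.op (0 : ℝ).toNNReal f) 0 :=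
    intervalIntegral.integral_hasDerivAt_right (by simp)
      (hc.stronglyMeasurableAtFilter _ _) hc.continuousAt
  simp only [mul_zero, neg_zero, Real.exp_zero, Real.toNNReal_zero, op_zero, one_smul] at hF
  have hE : HasDerivAt (fun s : ℝ => Real.exp (a * s)) a 0 := by
    simpa using ((hasDerivAt_id (0 : ℝ)).const_mul a).exp
  have hG : HasDerivAt (fun s : ℝ => Real.exp (a * s) • (u - F s)) (a • u - f) 0 := by
    have := hE.smul (hF.const_sub u)
    simp only [mul_zero, Real.exp_zero, one_smul, smul_neg] at this
    have e : a • u - f = -f + a • (u - F 0) := by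
      simp [F, sub_eq_add_neg, add_comm]
    rw [e]
    exact this
  have h3 := (hG.hasDerivWithinAt (s := Set.Ioi 0))
  rw [hasDerivWithinAt_iff_tendsto_slope' (by simp)] at h3
  refine h3.congr' ?_
  filter_upwards [self_mem_nhdsWithin] with s hs
  rw [slope_def_module, S.op_resolvent ha f (le_of_lt hs)]
  simp [F, u]

/-- Rescaling time by a turns the left side into ∫ e^{-s} S_{s/a} f ds, to which dominated
convergence applies. -/
theorem tendsto_smul_resolvent (f : C(X, ℝ)) :
    Tendsto (fun a : ℝ => a • S.resolvent a f) atTop (𝓝 f) := by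
  have h0 : f = ∫ s in Set.Ioi (0 : ℝ), Real.exp (-s) • f := by
    rw [integral_smul_const]
    have := integral_exp_neg_mul_Ioi one_pos
    simp only [one_mul, inv_one] at this
    rw [this, one_smul]
  have h1 : Tendsto (fun a : ℝ => ∫ s in Set.Ioi (0 : ℝ), Real.exp (-s) •
      S.op (a⁻¹ * s).toNNReal f) atTop (𝓝 (∫ s in Set.Ioi (0 : ℝ), Real.exp (-s) • f)) := by
    refine tendsto_integral_filter_of_dominated_convergence (fun s => Real.exp (-s) * ‖f‖)
      (Eventually.of_forall fun a => ?_) (Eventually.of_forall fun a => ?_) ?_ ?_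
    · refine Continuous.aestronglyMeasurable 
        ((by fun_prop : Continuous fun t : ℝ => Real.exp (-t)).smul ?_)
      exact (S.continuous_op_toNNReal f).comp (by fun_prop : Continuous fun s : ℝ => a⁻¹ * s)
    · refine Eventually.of_forall fun s => ?_
      rw [norm_smul, Real.norm_eq_abs, Real.abs_exp]
      exact mul_le_mul_of_nonneg_left (S.norm_op_le _ _) (Real.exp_pos _).le
    · have := (exp_neg_integrableOn_Ioi 0 one_pos).mul_const ‖f‖
      simpa [IntegrableOn] using this
    · refine Eventually.of_forall fun s => Tendsto.const_smul ?_ _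
      have h2 : Tendsto (fun a : ℝ => a⁻¹ * s) atTop (𝓝 (0 * s)) :=
        tendsto_inv_atTop_zero.mul_const s
      have h3 := ((S.continuous_op_toNNReal f).tendsto (0 * s)).comp h2
      simpa [op_zero, Function.comp_def] using h3
  rw [← h0] at h1
  refine h1.congr' ?_
  filter_upwards [eventually_gt_atTop 0] with a ha
  have h4 := integral_comp_mul_left_Ioi
    (fun s : ℝ => Real.exp (-s) • S.op (a⁻¹ * s).toNNReal f) 0 ha
  rw [mul_zero] at h4
  rw [resolvent]
  simp only [inv_mul_cancel_left₀ ha.ne'] at h4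
  rw [h4, smul_inv_smul₀ ha.ne']

theorem dense_domain : Dense {f : C(X, ℝ) | ∃ g, S.GeneratorGraph f g} := by
  intro f
  refine mem_closure_of_tendsto (S.tendsto_smul_resolvent f) ?_
  filter_upwards [eventually_gt_atTop 0] with a ha
  exact ⟨_, (S.generatorGraph_resolvent ha f).smul a⟩

variable {S}

theorem eq_of_op_eq [HasOuterApproxClosed X] {T : FellerSemigroup X}
    (h : ∀ t f, S.op t f = T.op t f) : S = T := by
  ext1
  funext t
  ext1 x
  refine ext_of_forall_integral_eq_of_IsFiniteMeasure fun f => ?_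
  exact congrArg (fun g : C(X, ℝ) => g x) (h t f.toContinuousMap)

/-- A Feller semigroup is determined by its generator. -/
theorem eq_of_generatorGraph [HasOuterApproxClosed X] {T : FellerSemigroup X}
    (h : ∀ f g, S.GeneratorGraph f g → T.GeneratorGraph f g) : S = T := by
  refine eq_of_op_eq fun t f => ?_
  have h1 := Continuous.ext_on S.dense_domain (S.opL t).continuous (T.opL t).continuous
    (fun f ⟨g, hf⟩ => op_eq_of_generatorGraph h hf t)
  exact congrFun h1 f

end FellerSemigroup

end RWDRE

namespace RWDRE

/-! ### Feller semigroups from operators on `C(X)` -/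

section Riesz

variable {X : Type*} [TopologicalSpace X] [CompactSpace X] [T2Space X] [MeasurableSpace X]
  [BorelSpace X]

/-- The Riesz representation of positive unital functionals on `C(X)`. -/
theorem exists_probabilityMeasure_integral_eq (L : C(X, ℝ) →ₗ[ℝ] ℝ)
    (hL : ∀ f : C(X, ℝ), (∀ x, 0 ≤ f x) → 0 ≤ L f) (h1 : L (ContinuousMap.const X 1) = 1) :
    ∃ μ : Measure X, IsProbabilityMeasure μ ∧ ∀ f : C(X, ℝ), ∫ x, f x ∂μ = L f := by
  let Λ : CompactlySupportedContinuousMap X ℝ →ₚ[ℝ] ℝ := PositiveLinearMap.mk₀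
    { toFun := fun f => L f.toContinuousMap
      map_add' := fun f g => L.map_add f.toContinuousMap g.toContinuousMap
      map_smul' := fun c f => L.map_smul c f.toContinuousMap }
    (fun f hf => hL _ fun x => hf x)
  have key : ∀ f : C(X, ℝ), ∫ x, f x ∂(RealRMK.rieszMeasure Λ) = L f := fun f =>
    RealRMK.integral_rieszMeasure Λ (CompactlySupportedContinuousMap.continuousMapEquiv f)
  refine ⟨RealRMK.rieszMeasure Λ, ⟨?_⟩, key⟩
  have h2 := key (ContinuousMap.const X 1)
  rw [h1] at h2
  simp only [ContinuousMap.const_apply, integral_const, smul_eq_mul, mul_one, Measure.real] at h2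
  have h3 : RealRMK.rieszMeasure Λ Set.univ ≠ ∞ := fun h => by simp [h] at h2
  rw [← ENNReal.ofReal_toReal h3, h2, ENNReal.ofReal_one]

variable [HasOuterApproxClosed X]

/-- The mass of a closed set is a pointwise limit of integrals of continuous functions, and closed
sets form a π-system that generates the Borel σ-algebra. -/
theorem measurable_of_continuous_integral {μ : X → Measure X} [∀ x, IsProbabilityMeasure (μ x)]
    (h : ∀ f : C(X, ℝ), Continuous fun x => ∫ y, f y ∂(μ x)) : Measurable μ := by
  refine Measurable.measure_of_isPiSystem_of_isProbabilityMeasure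
    (by rw [BorelSpace.measurable_eq (α := X), borel_eq_generateFrom_isClosed])
    isPiSystem_isClosed fun F (hF : IsClosed F) => ?_
  refine measurable_of_tendsto_metrizable (f := fun n x => ∫⁻ y, (hF.apprSeq n y : ℝ≥0∞) ∂(μ x))
    (fun n => ?_) (tendsto_pi_nhds.2 fun x => HasOuterApproxClosed.tendsto_lintegral_apprSeq hF _)
  let g : C(X, ℝ) := ⟨fun y => (hF.apprSeq n y : ℝ), by fun_prop⟩
  have : (fun x => ∫⁻ y, (hF.apprSeq n y : ℝ≥0∞) ∂(μ x)) =
      fun x => ENNReal.ofReal (∫ y, g y ∂(μ x)) := by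
    funext x
    rw [ofReal_integral_eq_lintegral_ofReal (integrable_continuousMap _ g)
      (Eventually.of_forall fun y => NNReal.coe_nonneg _)]
    simp [g]
  rw [this]
  exact ((h g).measurable).ennreal_ofReal

/-- A positive unital strongly continuous semigroup on `C(X)` is a Feller semigroup. -/
theorem exists_fellerSemigroup (P : ℝ≥0 → C(X, ℝ) →ₗ[ℝ] C(X, ℝ))
    (hpos : ∀ t f, (∀ x, 0 ≤ f x) → ∀ x, 0 ≤ P t f x)
    (hone : ∀ t, P t (ContinuousMap.const X 1) = ContinuousMap.const X 1)
    (hzero : ∀ f, P 0 f = f) (hadd : ∀ s t f, P (s + t) f = P s (P t f))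
    (hcont : ∀ f, Tendsto (fun t => P t f) (𝓝 0) (𝓝 f)) :
    ∃ T : FellerSemigroup X, ∀ t f, T.op t f = P t f := by
  let L (t : ℝ≥0) (x : X) : C(X, ℝ) →ₗ[ℝ] ℝ :=
    { toFun := fun f => P t f x
      map_add' := fun f g => by rw [map_add]; rfl
      map_smul' := fun c f => by rw [map_smul]; rfl }
  have hex := fun t x => exists_probabilityMeasure_integral_eq (L t x)
    (fun f hf => hpos t f hf x) (by change P t _ x = 1; rw [hone]; rfl)
  choose μ hμp hμ using hex
  have hμ' : ∀ t x f, ∫ y, f y ∂(μ t x) = P t f x := hμ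
  let κ (t : ℝ≥0) : Kernel X X := ⟨μ t, measurable_of_continuous_integral fun f => by
    simp only [hμ']; exact (P t f).continuous⟩
  have hκ : ∀ t x (f : C(X, ℝ)), ∫ y, f y ∂(κ t x) = P t f x := hμ
  have hm : ∀ t, IsMarkovKernel (κ t) := fun t => ⟨hμp t⟩
  refine ⟨⟨κ, hm, ?_, ?_, ?_, ?_⟩, fun t f => ?_⟩
  · ext1 x
    refine ext_of_forall_integral_eq_of_IsFiniteMeasure fun f => ?_
    rw [Kernel.id_apply, integral_dirac' _ _ f.continuous.stronglyMeasurable]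
    exact (hκ 0 x f.toContinuousMap).trans (by rw [hzero]; rfl)
  · intro s t
    ext1 x
    refine ext_of_forall_integral_eq_of_IsFiniteMeasure fun f => ?_
    rw [Kernel.integral_comp]
    · refine (hκ (s + t) x f.toContinuousMap).trans ?_
      rw [hadd, ← hκ]
      exact integral_congr_ae (Eventually.of_forall fun y => (hκ t y f.toContinuousMap).symm)
    · exact integrable_continuousMap _ f.toContinuousMap
  · intro t f
    simp only [hκ]
    exact (P t f).continuous
  · intro f
    simp only [hκ]
    exact ContinuousMap.tendsto_iff_tendstoUniformly.1 (hcont f)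
  · ext x
    exact hκ t x f

end Riesz

/-! ### Bounded perturbations -/

section Perturbation

variable {X : Type*} [TopologicalSpace X] [CompactSpace X] [MeasurableSpace X]
  [BorelSpace X] (S : FellerSemigroup X) (K : C(X, ℝ) →L[ℝ] C(X, ℝ))

namespace FellerSemigroup

/-- The convolution `∫_0^t e^{-b s} S_s K w(t - s) ds`. -/
def conv (b : ℝ) (w : ℝ → C(X, ℝ)) (t : ℝ) : C(X, ℝ) :=
  ∫ s in (0 : ℝ)..t, Real.exp (-(b * s)) • S.op s.toNNReal (K (w (t - s)))

variable {S K}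

theorem continuous_conv_integrand (b : ℝ) {w : ℝ → C(X, ℝ)} (hw : Continuous w) :
    Continuous fun p : ℝ × ℝ => Real.exp (-(b * p.2)) • S.op p.2.toNNReal (K (w (p.1 - p.2))) := by
  refine (by fun_prop : Continuous fun p : ℝ × ℝ => Real.exp (-(b * p.2))).smul ?_
  refine S.continuous_op.comp (f := fun p : ℝ × ℝ => (p.2.toNNReal, K (w (p.1 - p.2)))) ?_
  exact (continuous_real_toNNReal.comp continuous_snd).prodMk
    (K.continuous.comp (hw.comp (by fun_prop)))

theorem continuous_conv_integrand_right (b : ℝ) {w : ℝ → C(X, ℝ)} (hw : Continuous w) (t : ℝ) :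
    Continuous fun s : ℝ => Real.exp (-(b * s)) • S.op s.toNNReal (K (w (t - s))) :=
  (continuous_conv_integrand b hw).comp (by fun_prop : Continuous fun s : ℝ => (t, s))

theorem continuous_conv (b : ℝ) {w : ℝ → C(X, ℝ)} (hw : Continuous w) :
    Continuous (S.conv K b w) :=
  intervalIntegral.continuous_parametric_intervalIntegral_of_continuous
    (f := fun t s : ℝ => Real.exp (-(b * s)) • S.op s.toNNReal (K (w (t - s))))
    (continuous_conv_integrand b hw) continuous_id

theorem conv_zero (b : ℝ) (w : ℝ → C(X, ℝ)) : S.conv K b w 0 = 0 := by simp [conv]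

theorem conv_add (b : ℝ) {w v : ℝ → C(X, ℝ)} (hw : Continuous w) (hv : Continuous v) (t : ℝ) :
    S.conv K b (fun s => w s + v s) t = S.conv K b w t + S.conv K b v t := by
  rw [conv, conv, conv, ← intervalIntegral.integral_add
    ((continuous_conv_integrand_right b hw t).intervalIntegrable _ _)
    ((continuous_conv_integrand_right b hv t).intervalIntegrable _ _)]
  simp only [map_add, op_add, smul_add]

theorem conv_smul (b c : ℝ) (w : ℝ → C(X, ℝ)) (t : ℝ) :
    S.conv K b (fun s => c • w s) t = c • S.conv K b w t := by
  rw [conv, conv, ← intervalIntegral.integral_smul]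
  simp only [map_smul, op_smul, smul_comm _ c]

/-- The bound comes from ∫ e^{-bs} ds ≤ 1/b and does not depend on t. For b > c it makes convolution
a strict contraction on the whole time axis. -/
theorem norm_conv_le {b c M : ℝ} (hb : 0 < b) (hc : 0 ≤ c) (hK : ∀ f, ‖K f‖ ≤ c * ‖f‖)
    {w : ℝ → C(X, ℝ)} {t : ℝ} (ht : 0 ≤ t) (hw : ∀ s, ‖w s‖ ≤ M) :
    ‖S.conv K b w t‖ ≤ c / b * M := by
  have hM : 0 ≤ M := (norm_nonneg _).trans (hw 0)
  have h1 : ‖S.conv K b w t‖ ≤ ∫ s in (0 : ℝ)..t, Real.exp (-(b * s)) * (c * M) := by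
    refine intervalIntegral.norm_integral_le_of_norm_le ht (Eventually.of_forall fun s _ => ?_)
      (Continuous.intervalIntegrable (by fun_prop) _ _)
    rw [norm_smul, Real.norm_eq_abs, Real.abs_exp]
    exact mul_le_mul_of_nonneg_left ((S.norm_op_le _ _).trans ((hK _).trans
      (mul_le_mul_of_nonneg_left (hw _) hc))) (Real.exp_pos _).le
  refine h1.trans ?_
  rw [intervalIntegral.integral_mul_const]
  have h2 : ∫ s in (0 : ℝ)..t, Real.exp (-(b * s)) ≤ b⁻¹ := by
    rw [← integral_exp_neg_mul_Ioi hb, intervalIntegral.integral_of_le ht]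
    refine setIntegral_mono_set ?_ (Eventually.of_forall fun s => (Real.exp_pos _).le)
      Set.Ioc_subset_Ioi_self.eventuallyLE
    simpa [IntegrableOn] using exp_neg_integrableOn_Ioi 0 hb
  calc _ ≤ b⁻¹ * (c * M) := mul_le_mul_of_nonneg_right h2 (mul_nonneg hc hM)
    _ = c / b * M := by ring

theorem conv_nonneg (hK : ∀ f, (∀ x, 0 ≤ f x) → ∀ x, 0 ≤ K f x) (b : ℝ) {w : ℝ → C(X, ℝ)}
    (hw : Continuous w) (hw0 : ∀ s x, 0 ≤ w s x) {t : ℝ} (ht : 0 ≤ t) (x : X) :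
    0 ≤ S.conv K b w t x := by
  have h1 : S.conv K b w t x =
      ∫ s in (0 : ℝ)..t, (Real.exp (-(b * s)) • S.op s.toNNReal (K (w (t - s)))) x := by
    rw [conv, intervalIntegral.integral_of_le ht, intervalIntegral.integral_of_le ht,
      ContinuousMap.integral_apply]
    exact ((continuous_conv_integrand_right b hw t).intervalIntegrable _ _).1
  rw [h1]
  exact intervalIntegral.integral_nonneg ht fun s _ =>
    mul_nonneg (Real.exp_pos _).le (S.le_op _ (hK _ (hw0 _)) x)

/-- Splitting the convolution at time `t`. -/
theorem conv_time_add (b : ℝ) {w : ℝ → C(X, ℝ)} (hw : Continuous w) {t s : ℝ} (ht : 0 ≤ t)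
    (hs : 0 ≤ s) : S.conv K b w (t + s) = S.conv K b (fun r => w (r + s)) t +
      Real.exp (-(b * t)) • S.op t.toNNReal (S.conv K b w s) := by
  have hi := continuous_conv_integrand_right (S := S) (K := K) b hw
  rw [conv, ← intervalIntegral.integral_add_adjacent_intervals
    ((hi (t + s)).intervalIntegrable 0 t) ((hi (t + s)).intervalIntegrable t (t + s))]
  congr 1
  · rw [conv]
    congr 1
    funext r
    rw [show t + s - r = t - r + s by ring]
  · have h1 := intervalIntegral.integral_comp_add_left (a := 0) (b := s)
      (fun r => Real.exp (-(b * r)) • S.op r.toNNReal (K (w (t + s - r)))) t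
    rw [add_zero] at h1
    rw [← h1, ← opL_apply, conv, ← ContinuousLinearMap.intervalIntegral_comp_comm _
      ((hi s).intervalIntegrable 0 s), ← intervalIntegral.integral_smul]
    refine intervalIntegral.integral_congr fun r hr => ?_
    rw [Set.uIcc_of_le hs] at hr
    simp only [map_smul, opL_apply, op_op, smul_smul, ← Real.exp_add]
    rw [Real.toNNReal_add ht hr.1]
    rw [show t + s - (t + r) = s - r by ring]
    congr 2
    ring

/-- On constants the integrand is the derivative of 1 - e^{-cs}. This gives conservativity of the
perturbed semigroup. -/
theorem conv_exp_const {c : ℝ} (hK1 : K (ContinuousMap.const X 1) = ContinuousMap.const X c)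
    (t : ℝ) : S.conv K c (fun _ => ContinuousMap.const X 1) t =
      ContinuousMap.const X (1 - Real.exp (-(c * t))) := by
  have h0 : ∀ s : ℝ, HasDerivAt (fun s => ContinuousMap.const X (1 - Real.exp (-(c * s))))
      (Real.exp (-(c * s)) • S.op s.toNNReal (K (ContinuousMap.const X 1))) s := by
    intro s
    have h1 : HasDerivAt (fun s : ℝ => 1 - Real.exp (-(c * s))) (Real.exp (-(c * s)) * c) s := by
      have := (((hasDerivAt_id s).const_mul c).neg.exp).const_sub 1
      simpa using this
    have h2 := h1.smul_const (ContinuousMap.const X (1 : ℝ))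
    rw [hK1, op_const]
    have e1 : ∀ r : ℝ, r • ContinuousMap.const X (1 : ℝ) = ContinuousMap.const X r := fun r => by
      ext; simp
    have e2 : ∀ r : ℝ, r • ContinuousMap.const X c = ContinuousMap.const X (r * c) := fun r => by
      ext; simp
    simpa only [e1, e2] using h2
  rw [conv, intervalIntegral.integral_eq_sub_of_hasDerivAt (fun s _ => h0 s)]
  · ext x; simp
  · exact (continuous_conv_integrand_right c (continuous_const (y := ContinuousMap.const X 1))
      t).intervalIntegrable _ _

/-- Damping by e^{-s} trades the discount rate b for b - 1. The contraction needs rate c + 1, the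
Duhamel formula rate c. -/
theorem conv_exp_smul (b : ℝ) (w : ℝ → C(X, ℝ)) (t : ℝ) :
    S.conv K b (fun s => Real.exp (-s) • w s) t = Real.exp (-t) • S.conv K (b - 1) w t := by
  rw [conv, conv, ← intervalIntegral.integral_smul]
  congr 1
  funext s
  simp only [map_smul, op_smul, smul_smul, ← Real.exp_add]
  congr 2
  ring

theorem conv_congr (b : ℝ) {w v : ℝ → C(X, ℝ)} {t : ℝ} (ht : 0 ≤ t)
    (h : ∀ s, 0 ≤ s → w s = v s) : S.conv K b w t = S.conv K b v t := by
  refine intervalIntegral.integral_congr fun s hs => ?_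
  rw [Set.uIcc_of_le ht] at hs
  simp only [h _ (sub_nonneg.2 hs.2)]

end FellerSemigroup

end Perturbation

end RWDRE

namespace RWDRE

/-! ### The perturbed semigroup as a fixed point of a Volterra map -/

open scoped BoundedContinuousFunction

section Perturbation

variable {X : Type*} [TopologicalSpace X] [CompactSpace X] [MeasurableSpace X]
  [BorelSpace X] (S : FellerSemigroup X) (K : C(X, ℝ) →L[ℝ] C(X, ℝ))

namespace FellerSemigroup

/-- The map whose fixed point is `t ↦ e^{-t} T_t f`, for the semigroup `T` with generator
`L + K - c`. -/
def volterra {c : ℝ} (hc : 0 ≤ c) (hK : ∀ f, ‖K f‖ ≤ c * ‖f‖) (f : C(X, ℝ))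
    (w : ℝ →ᵇ C(X, ℝ)) : ℝ →ᵇ C(X, ℝ) :=
  BoundedContinuousFunction.ofNormedAddCommGroup
    -- The solution is extended to negative times by its value at 0, so that the fixed point lives
    -- in the complete space of bounded continuous functions on ℝ.
    (fun t => Real.exp (-((c + 1) * max t 0)) • S.op (max t 0).toNNReal f +
      S.conv K (c + 1) w (max t 0))
    (by
      have h : Continuous fun t : ℝ => max t 0 := by fun_prop
      exact ((by fun_prop : Continuous fun t : ℝ => Real.exp (-((c + 1) * max t 0))).smul
        ((S.continuous_op_toNNReal f).comp h)).add ((continuous_conv _ w.continuous).comp h))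
    (‖f‖ + c / (c + 1) * ‖w‖)
    (fun t => by
      refine (norm_add_le _ _).trans (add_le_add ?_ (norm_conv_le (by linarith) hc hK
        (le_max_right _ _) w.norm_coe_le_norm))
      rw [norm_smul, Real.norm_eq_abs, Real.abs_exp]
      refine (mul_le_mul_of_nonneg_left (S.norm_op_le _ _) (Real.exp_pos _).le).trans
        (mul_le_of_le_one_left (norm_nonneg f) ?_)
      rw [Real.exp_le_one_iff, neg_nonpos]
      have := le_max_right t 0
      positivity)

variable {S K} {c : ℝ} (hc : 0 ≤ c) (hK : ∀ f, ‖K f‖ ≤ c * ‖f‖)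

theorem volterra_apply (f : C(X, ℝ)) (w : ℝ →ᵇ C(X, ℝ)) {t : ℝ} (ht : 0 ≤ t) :
    S.volterra K hc hK f w t =
      Real.exp (-((c + 1) * t)) • S.op t.toNNReal f + S.conv K (c + 1) w t := by
  simp [volterra, max_eq_left ht]

theorem volterra_apply_max (f : C(X, ℝ)) (w : ℝ →ᵇ C(X, ℝ)) (t : ℝ) :
    S.volterra K hc hK f w t = S.volterra K hc hK f w (max t 0) := by
  simp [volterra]

theorem contractingWith_volterra (f : C(X, ℝ)) :
    ContractingWith (c / (c + 1)).toNNReal (S.volterra K hc hK f) := by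
  have hc1 : 0 < c + 1 := by linarith
  have hq : 0 ≤ c / (c + 1) := by positivity
  refine ⟨?_, LipschitzWith.of_dist_le_mul fun w v => ?_⟩
  · rw [← NNReal.coe_lt_coe, Real.coe_toNNReal _ hq, NNReal.coe_one, div_lt_one hc1]
    linarith
  · rw [Real.coe_toNNReal _ hq, BoundedContinuousFunction.dist_le (by positivity)]
    intro t
    have h1 : S.volterra K hc hK f w t - S.volterra K hc hK f v t =
        S.conv K (c + 1) (w - v) (max t 0) := by
      have := conv_add (S := S) (K := K) (c + 1) (w - v).continuous v.continuous (max t 0)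
      simp only [BoundedContinuousFunction.coe_sub, Pi.sub_apply, sub_add_cancel] at this
      simp only [volterra, BoundedContinuousFunction.coe_ofNormedAddCommGroup]
      rw [add_sub_add_left_eq_sub, sub_eq_iff_eq_add]
      exact this
    rw [dist_eq_norm, h1]
    exact (norm_conv_le hc1 hc hK (le_max_right _ _) (w - v).norm_coe_le_norm).trans_eq
      (congrArg _ (dist_eq_norm w v).symm)

/-- The fixed point of the Volterra map. -/
def volterraSol (f : C(X, ℝ)) : ℝ →ᵇ C(X, ℝ) :=
  ContractingWith.fixedPoint _ (contractingWith_volterra (S := S) hc hK f)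

theorem volterra_volterraSol (f : C(X, ℝ)) :
    S.volterra K hc hK f (volterraSol (S := S) hc hK f) = volterraSol (S := S) hc hK f :=
  (contractingWith_volterra (S := S) hc hK f).fixedPoint_isFixedPt

/-- Uniqueness of the fixed point. Linearity, conservativity and the semigroup law all follow by
exhibiting a candidate solution; the second hypothesis pins down the values at negative times. -/
theorem volterraSol_eq {f : C(X, ℝ)} {w : ℝ →ᵇ C(X, ℝ)}
    (h : ∀ t, 0 ≤ t → Real.exp (-((c + 1) * t)) • S.op t.toNNReal f + S.conv K (c + 1) w t = w t)
    (h' : ∀ t, w t = w (max t 0)) : volterraSol (S := S) hc hK f = w := by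
  symm
  refine (contractingWith_volterra (S := S) hc hK f).fixedPoint_unique ?_
  ext1 t
  rw [volterra_apply_max, h' t, volterra_apply hc hK f w (le_max_right t 0), h _ (le_max_right t 0)]

theorem volterraSol_apply (f : C(X, ℝ)) {t : ℝ} (ht : 0 ≤ t) :
    volterraSol (S := S) hc hK f t = Real.exp (-((c + 1) * t)) • S.op t.toNNReal f +
      S.conv K (c + 1) (volterraSol (S := S) hc hK f) t := by
  conv_lhs => rw [← volterra_volterraSol]
  exact volterra_apply hc hK f _ ht

theorem volterraSol_apply_max (f : C(X, ℝ)) (t : ℝ) :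
    volterraSol (S := S) hc hK f t = volterraSol (S := S) hc hK f (max t 0) := by
  rw [← volterra_volterraSol, ← volterra_apply_max]

theorem volterraSol_zero (f : C(X, ℝ)) : volterraSol (S := S) hc hK f 0 = f := by
  rw [volterraSol_apply hc hK f le_rfl]
  simp [op_zero, conv_zero]

theorem volterraSol_add (f g : C(X, ℝ)) : volterraSol (S := S) hc hK (f + g) =
    volterraSol (S := S) hc hK f + volterraSol (S := S) hc hK g := by
  refine volterraSol_eq hc hK (fun t ht => ?_) (fun t => ?_)
  · simp only [BoundedContinuousFunction.coe_add, Pi.add_apply]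
    have := conv_add (S := S) (K := K) (c + 1) (volterraSol (S := S) hc hK f).continuous
      (volterraSol (S := S) hc hK g).continuous t
    rw [volterraSol_apply hc hK f ht, volterraSol_apply hc hK g ht, op_add, smul_add]
    erw [this]
    abel
  · simp only [BoundedContinuousFunction.coe_add, Pi.add_apply]
    rw [← volterraSol_apply_max, ← volterraSol_apply_max]

theorem volterraSol_smul (a : ℝ) (f : C(X, ℝ)) : volterraSol (S := S) hc hK (a • f) =
    a • volterraSol (S := S) hc hK f := by
  refine volterraSol_eq hc hK (fun t ht => ?_) (fun t => ?_)
  · have := conv_smul (S := S) (K := K) (c + 1) a (volterraSol (S := S) hc hK f) t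
    simp only [BoundedContinuousFunction.coe_smul]
    erw [this]
    rw [volterraSol_apply hc hK f ht, op_smul, smul_add, smul_comm]
  · simp only [BoundedContinuousFunction.coe_smul]
    rw [← volterraSol_apply_max]

/-- The Volterra map preserves nonnegative functions, and its iterates from 0 converge to the fixed
point. -/
theorem volterraSol_nonneg (hpos : ∀ f, (∀ x, 0 ≤ f x) → ∀ x, 0 ≤ K f x) {f : C(X, ℝ)}
    (hf : ∀ x, 0 ≤ f x) (t : ℝ) (x : X) : 0 ≤ volterraSol (S := S) hc hK f t x := by
  have h1 := (contractingWith_volterra (S := S) hc hK f).tendsto_iterate_fixedPoint 0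
  have h2 : Continuous fun w : ℝ →ᵇ C(X, ℝ) => w t x :=
    (continuous_eval_const x).comp (continuous_eval_const t)
  refine ge_of_tendsto' ((h2.tendsto _).comp h1) fun n => ?_
  have h3 : ∀ n s y, 0 ≤ ((S.volterra K hc hK f)^[n] 0) s y := by
    intro n
    induction n with
    | zero => intro s y; simp
    | succ n ih =>
      intro s y
      rw [Function.iterate_succ_apply', volterra_apply_max,
        volterra_apply hc hK f _ (le_max_right s 0)]
      exact add_nonneg (mul_nonneg (Real.exp_pos _).le (S.le_op _ hf y))
        (conv_nonneg hpos _ (BoundedContinuousFunction.continuous _) ih (le_max_right s 0) y)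
  exact h3 n t x

theorem volterraSol_one (hK1 : K (ContinuousMap.const X 1) = ContinuousMap.const X c) :
    ∀ t : ℝ, 0 ≤ t → volterraSol (S := S) hc hK (ContinuousMap.const X 1) t =
      Real.exp (-t) • ContinuousMap.const X 1 := by
  let w : ℝ →ᵇ C(X, ℝ) := BoundedContinuousFunction.ofNormedAddCommGroup
    (fun t => Real.exp (-(max t 0)) • ContinuousMap.const X (1 : ℝ)) (by fun_prop) 
    (‖ContinuousMap.const X (1 : ℝ)‖) (fun t => by
      rw [norm_smul, Real.norm_eq_abs, Real.abs_exp]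
      refine mul_le_of_le_one_left (norm_nonneg _) ?_
      rw [Real.exp_le_one_iff, neg_nonpos]
      exact le_max_right t 0)
  have hw : ∀ t, 0 ≤ t → w t = Real.exp (-t) • ContinuousMap.const X (1 : ℝ) := fun t ht => by
    simp [w, max_eq_left ht]
  have h : volterraSol (S := S) hc hK (ContinuousMap.const X 1) = w := by
    refine volterraSol_eq hc hK (fun t ht => ?_) (fun t => by simp [w])
    rw [conv_congr (c + 1) ht hw, conv_exp_smul, add_sub_cancel_right, conv_exp_const hK1, hw t ht,
      op_const]
    ext x
    simp only [ContinuousMap.add_apply, ContinuousMap.smul_apply, ContinuousMap.const_apply,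
      smul_eq_mul, mul_one, mul_sub, ← Real.exp_add]
    rw [show -t + -(c * t) = -((c + 1) * t) by ring]
    ring
  intro t ht
  rw [h, hw t ht]

/-- This is the semigroup law: the time translate of a solution solves the equation started from its
value at s, because the convolution splits at time t (`conv_time_add`). -/
theorem volterraSol_time_add (f : C(X, ℝ)) {s : ℝ} (hs : 0 ≤ s) {t : ℝ} (ht : 0 ≤ t) :
    volterraSol (S := S) hc hK (Real.exp s • volterraSol (S := S) hc hK f s) t =
      Real.exp s • volterraSol (S := S) hc hK f (t + s) := by
  set v := volterraSol (S := S) hc hK f with hv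
  let w : ℝ →ᵇ C(X, ℝ) := BoundedContinuousFunction.ofNormedAddCommGroup
    (fun t => Real.exp s • v (max t 0 + s))
    (by
      have : Continuous fun t : ℝ => v (max t 0 + s) := v.continuous.comp (by fun_prop)
      exact this.const_smul (Real.exp s))
    (Real.exp s * ‖v‖) (fun t => by
      rw [norm_smul, Real.norm_eq_abs, Real.abs_exp]
      exact mul_le_mul_of_nonneg_left (v.norm_coe_le_norm _) (Real.exp_pos _).le)
  have hw : ∀ t, 0 ≤ t → w t = Real.exp s • v (t + s) := fun t ht => by
    simp [w, max_eq_left ht]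
  have h : volterraSol (S := S) hc hK (Real.exp s • v s) = w := by
    refine volterraSol_eq hc hK (fun t ht => ?_) (fun t => by simp [w])
    rw [conv_congr (c + 1) ht hw, conv_smul, hw t ht, op_smul, smul_comm _ (Real.exp s), ← smul_add]
    congr 1
    have e1 : v s = Real.exp (-((c + 1) * s)) • S.op s.toNNReal f + S.conv K (c + 1) v s :=
      volterraSol_apply hc hK f hs
    have e2 : v (t + s) = Real.exp (-((c + 1) * (t + s))) • S.op (t + s).toNNReal f +
      S.conv K (c + 1) v (t + s) := volterraSol_apply hc hK f (add_nonneg ht hs)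
    rw [e2, conv_time_add (c + 1) v.continuous ht hs, e1, op_add, op_smul, op_op, smul_add,
      smul_smul, ← Real.exp_add, ← Real.toNNReal_add ht hs]
    rw [show -((c + 1) * t) + -((c + 1) * s) = -((c + 1) * (t + s)) by ring]
    abel
  rw [h, hw t ht]

/-- Removing the damping leaves the Duhamel formula T_t f = e^{-ct} S_t f + ∫_0^t e^{-cs} S_s K
T_{t-s} f ds. -/
theorem exp_smul_volterraSol (f : C(X, ℝ)) {t : ℝ} (ht : 0 ≤ t) :
    Real.exp t • volterraSol (S := S) hc hK f t = Real.exp (-(c * t)) • S.op t.toNNReal f +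
      S.conv K c (fun s => Real.exp s • volterraSol (S := S) hc hK f s) t := by
  have h1 := conv_exp_smul (S := S) (K := K) (c + 1)
    (fun s => Real.exp s • volterraSol (S := S) hc hK f s) t
  simp only [smul_smul, ← Real.exp_add, neg_add_cancel, Real.exp_zero, one_smul,
    add_sub_cancel_right] at h1
  rw [volterraSol_apply hc hK f ht, smul_add, smul_smul, ← Real.exp_add]
  erw [h1]
  rw [smul_smul, ← Real.exp_add, add_neg_cancel, Real.exp_zero, one_smul]
  congr 3
  ring

/-- By joint continuity of the integrand at (0,0), one δ controls it for all 0 < s ≤ t < δ. -/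
theorem tendsto_inv_smul_conv (c : ℝ) {w : ℝ → C(X, ℝ)} (hw : Continuous w) :
    Tendsto (fun t : ℝ => t⁻¹ • S.conv K c w t) (𝓝[>] 0) (𝓝 (K (w 0))) := by
  have hc0 := (continuous_conv_integrand (S := S) (K := K) c hw).tendsto (0, 0)
  simp only [mul_zero, neg_zero, Real.exp_zero, Real.toNNReal_zero, op_zero, one_smul,
    sub_zero] at hc0
  rw [Metric.tendsto_nhds] at hc0 ⊢
  intro ε hε
  have h1 := hc0 (ε / 2) (half_pos hε)
  rw [nhds_prod_eq, Metric.nhds_basis_ball.prod_self.eventually_iff] at h1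
  obtain ⟨δ, hδ, h2⟩ := h1
  filter_upwards [Ioo_mem_nhdsGT hδ] with t ht
  have h3 : ‖S.conv K c w t - t • K (w 0)‖ ≤ ε / 2 * |t - 0| := by
    have e : t • K (w 0) = ∫ _ in (0 : ℝ)..t, K (w 0) := by simp
    rw [e, conv, ← intervalIntegral.integral_sub
      ((continuous_conv_integrand_right c hw t).intervalIntegrable _ _) (by simp)]
    refine intervalIntegral.norm_integral_le_of_norm_le_const fun s hs => ?_
    rw [Set.uIoc_of_le ht.1.le] at hs
    have := @h2 (t, s) ⟨by simpa [abs_of_pos ht.1] using ht.2, by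
      simpa [abs_of_pos hs.1] using hs.2.trans_lt ht.2⟩
    rw [← dist_eq_norm]
    exact this.le
  have e : t⁻¹ • S.conv K c w t - K (w 0) = t⁻¹ • (S.conv K c w t - t • K (w 0)) := by
    rw [smul_sub, inv_smul_smul₀ ht.1.ne']
  rw [dist_eq_norm, e, norm_smul, Real.norm_eq_abs, abs_of_pos (inv_pos.2 ht.1)]
  rw [sub_zero, abs_of_pos ht.1] at h3
  have ht1 := ht.1
  calc t⁻¹ * ‖S.conv K c w t - t • K (w 0)‖ ≤ t⁻¹ * (ε / 2 * t) :=
        mul_le_mul_of_nonneg_left h3 (inv_pos.2 ht.1).le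
    _ = ε / 2 := by field_simp
    _ < ε := half_lt_self hε

/-- Bounded perturbation of a Feller semigroup: if `K` is positive and `K 1 = c`, then `L + K - c`
generates a Feller semigroup. -/
theorem exists_perturbation [T2Space X] [HasOuterApproxClosed X] (hc : 0 ≤ c)
    (hK : ∀ f, ‖K f‖ ≤ c * ‖f‖) (hpos : ∀ f, (∀ x, 0 ≤ f x) → ∀ x, 0 ≤ K f x)
    (hK1 : K (ContinuousMap.const X 1) = ContinuousMap.const X c) :
    ∃ T : FellerSemigroup X, ∀ f g,
      T.GeneratorGraph f g ↔ S.GeneratorGraph f (g - (K f - c • f)) := by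
  let V := volterraSol (S := S) hc hK
  let P (t : ℝ≥0) : C(X, ℝ) →ₗ[ℝ] C(X, ℝ) :=
    { toFun := fun f => Real.exp t • V f t
      map_add' := fun f g => by
        simp only [V, volterraSol_add, BoundedContinuousFunction.coe_add, Pi.add_apply, smul_add]
      map_smul' := fun a f => by
        simp only [V, volterraSol_smul, BoundedContinuousFunction.coe_smul, RingHom.id_apply]
        rw [smul_comm] }
  have hP : ∀ t f, P t f = Real.exp t • V f t := fun _ _ => rfl
  have hPc : ∀ f, Continuous fun t : ℝ => Real.exp t • V f t := fun f =>
    Real.continuous_exp.smul (V f).continuous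
  obtain ⟨T, hT⟩ := exists_fellerSemigroup P
    (fun t f hf x => mul_nonneg (Real.exp_pos _).le (volterraSol_nonneg hc hK hpos hf _ x))
    (fun t => by
      rw [hP, show V _ t = _ from volterraSol_one hc hK hK1 _ t.2, smul_smul, ← Real.exp_add, add_neg_cancel,
        Real.exp_zero, one_smul])
    (fun f => by simp [hP, V, volterraSol_zero])
    (fun s t f => by
      rw [hP, hP, hP, show V (Real.exp t • V f t) s = _ from volterraSol_time_add hc hK f t.2 s.2, smul_smul, ← Real.exp_add,
        NNReal.coe_add]
      rfl)
    (fun f => by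
      have := ((hPc f).comp NNReal.continuous_coe).tendsto 0
      simpa [hP, V, volterraSol_zero, Function.comp_def] using this)
  refine ⟨T, fun f g => ?_⟩
  rw [generatorGraph_iff, generatorGraph_iff]
  -- The difference of the two difference quotients converges for every f, in the domain or not.
  -- Hence the two domains coincide.
  have h1 : Tendsto (fun t : ℝ => t⁻¹ • (T.op t.toNNReal f - f) - t⁻¹ • (S.op t.toNNReal f - f))
      (𝓝[>] 0) (𝓝 (K f - c • f)) := by
    have h2 := tendsto_inv_smul_conv (S := S) (K := K) c (hPc f)
    rw [show V f (0 : ℝ) = f from volterraSol_zero hc hK f, Real.exp_zero, one_smul] at h2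
    have h3 : HasDerivAt (fun t : ℝ => Real.exp (-(c * t))) (-c) 0 := by
      simpa using ((hasDerivAt_id (0 : ℝ)).const_mul c).neg.exp
    have h4 := (h3.hasDerivWithinAt (s := Set.Ioi 0))
    rw [hasDerivWithinAt_iff_tendsto_slope' (by simp)] at h4
    have h5 : Tendsto (fun t : ℝ => S.op t.toNNReal f) (𝓝[>] 0) (𝓝 f) := by
      have := (S.continuous_op_toNNReal f).tendsto 0
      rw [Real.toNNReal_zero, op_zero] at this
      exact tendsto_nhdsWithin_of_tendsto_nhds this
    have h6 := h2.add (h4.smul h5)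
    rw [neg_smul, ← sub_eq_add_neg] at h6
    refine h6.congr' ?_
    filter_upwards [self_mem_nhdsWithin] with t ht
    have ht0 : (0 : ℝ) ≤ t := le_of_lt ht
    rw [hT, hP, Real.coe_toNNReal t ht0, exp_smul_volterraSol hc hK f ht0, slope_def_field]
    simp only [mul_zero, neg_zero, Real.exp_zero, sub_zero]
    rw [← smul_sub, sub_sub_sub_cancel_right, add_sub_right_comm, smul_add, add_comm]
    congr 1
    rw [div_eq_inv_mul, mul_smul, sub_smul, one_smul]
  constructor
  · intro h
    simpa using h.sub h1
  · intro h
    simpa using h.add h1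

end FellerSemigroup

end Perturbation

end RWDRE

namespace RWDRE

/-! ### Invariant measures -/

namespace FellerSemigroup

variable {X : Type*} [TopologicalSpace X] [CompactSpace X] [MeasurableSpace X]
  [BorelSpace X] {S : FellerSemigroup X} {μ ν : Measure X}

theorem continuous_integral_continuousMap (μ : Measure X) [IsProbabilityMeasure μ] :
    Continuous fun f : C(X, ℝ) => ∫ x, f x ∂μ := by
  refine (LipschitzWith.of_dist_le_mul (K := 1) fun f g => ?_).continuous
  rw [Real.dist_eq, ← integral_sub (integrable_continuousMap _ f) (integrable_continuousMap _ g),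
    NNReal.coe_one, one_mul, dist_eq_norm]
  have := norm_integral_le_of_norm_le_const (μ := μ) (f := fun x => f x - g x) (C := ‖f - g‖)
    (Eventually.of_forall fun x => (f - g).norm_coe_le_norm x)
  simpa using this

theorem integral_op_eq_integral_bind [IsProbabilityMeasure μ] (t : ℝ≥0) (f : C(X, ℝ)) :
    ∫ x, f x ∂(μ.bind (S.kernel t)) = ∫ x, S.op t f x ∂μ :=
  by
  have h := Kernel.integral_comp (η := S.kernel t) (κ := Kernel.const Unit μ) (a := ())
    (f := f) (integrable_continuousMap _ f)
  rw [← Measure.comp_eq_comp_const_apply] at h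
  exact h

theorem IsInvariant.integral_op [IsProbabilityMeasure μ] (h : S.IsInvariant μ) (t : ℝ≥0)
    (f : C(X, ℝ)) : ∫ x, S.op t f x ∂μ = ∫ x, f x ∂μ := by
  rw [← integral_op_eq_integral_bind, (h t).def]

theorem isInvariant_of_integral_op [HasOuterApproxClosed X] [IsProbabilityMeasure μ]
    (h : ∀ t f, ∫ x, S.op t f x ∂μ = ∫ x, f x ∂μ) : S.IsInvariant μ := by
  intro t
  refine ext_of_forall_integral_eq_of_IsFiniteMeasure fun f => ?_
  exact (integral_op_eq_integral_bind t f.toContinuousMap).trans (h t f.toContinuousMap)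

theorem IsInvariant.integral_generator [IsProbabilityMeasure μ] (h : S.IsInvariant μ)
    {f g : C(X, ℝ)} (hf : S.GeneratorGraph f g) : ∫ x, g x ∂μ = 0 := by
  have h1 := ((continuous_integral_continuousMap μ).tendsto g).comp hf
  refine tendsto_nhds_unique h1 (tendsto_const_nhds.congr fun t => ?_)
  simp only [Function.comp, ContinuousMap.smul_apply, ContinuousMap.sub_apply, smul_eq_mul]
  rw [integral_const_mul, integral_sub (integrable_continuousMap _ _)
    (integrable_continuousMap _ _), h.integral_op, sub_self, mul_zero]

/-- Invariant probability measures are unique if the oscillations of the resolvents `R_a f`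
stay bounded as `a ↓ 0`, for a dense set of functions `f`. -/
theorem IsInvariant.eq_of_resolvent_bounded [HasOuterApproxClosed X] [IsProbabilityMeasure μ]
    [IsProbabilityMeasure ν] (hμ : S.IsInvariant μ) (hν : S.IsInvariant ν) {D : Set C(X, ℝ)}
    (hD : Dense D) (h : ∀ f ∈ D, ∃ C, ∀ a : ℝ, 0 < a → a ≤ 1 → ∀ x y,
      S.resolvent a f x - S.resolvent a f y ≤ C) : μ = ν := by
  have key : ∀ (μ ν : Measure X) [IsProbabilityMeasure μ] [IsProbabilityMeasure ν],
      S.IsInvariant μ → S.IsInvariant ν → ∀ f ∈ D, ∫ x, f x ∂μ ≤ ∫ x, f x ∂ν := by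
    intro μ ν _ _ hμ hν f hf
    obtain ⟨C, hC⟩ := h f hf
    have e : ∀ (μ : Measure X) [IsProbabilityMeasure μ], S.IsInvariant μ → ∀ a : ℝ, 0 < a →
        a * ∫ x, S.resolvent a f x ∂μ = ∫ x, f x ∂μ := by
      intro μ _ hμ a ha
      have := hμ.integral_generator (S.generatorGraph_resolvent ha f)
      simp only [ContinuousMap.smul_apply, ContinuousMap.sub_apply, smul_eq_mul] at this
      rw [integral_sub ((integrable_continuousMap _ _).const_mul a) (integrable_continuousMap _ _),
        integral_const_mul] at this
      linarith
    -- By `e` the integrals of f are those of a R_a f, a function of oscillation at most aC, so they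
    -- differ by at most aC.
    have h1 : ∀ a : ℝ, 0 < a → a ≤ 1 → ∫ x, f x ∂μ ≤ ∫ x, f x ∂ν + a * C := by
      intro a ha ha1
      rw [← e μ hμ a ha, ← e ν hν a ha, ← mul_add]
      refine mul_le_mul_of_nonneg_left ?_ ha.le
      have h2 : ∀ y, ∫ x, S.resolvent a f x ∂μ ≤ S.resolvent a f y + C := fun y => by
        have := integral_mono (μ := μ) (integrable_continuousMap _ (S.resolvent a f))
          (integrable_const (S.resolvent a f y + C)) (fun x => by
            have := hC a ha ha1 x y
            simp only
            linarith)
        simpa using this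
      have := integral_mono (μ := ν) (integrable_const _)
        ((integrable_continuousMap _ (S.resolvent a f)).add (integrable_const C)) h2
      simp only [Pi.add_apply] at this
      rw [integral_add (integrable_continuousMap _ _) (integrable_const C)] at this
      simpa using this
    have h3 : Tendsto (fun a : ℝ => ∫ x, f x ∂ν + a * C) (𝓝[>] 0) (𝓝 (∫ x, f x ∂ν + 0 * C)) :=
      tendsto_nhdsWithin_of_tendsto_nhds (Continuous.tendsto (by fun_prop) 0)
    rw [zero_mul, add_zero] at h3
    refine ge_of_tendsto h3 ?_
    filter_upwards [Ioc_mem_nhdsGT zero_lt_one] with a ha using h1 a ha.1 ha.2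
  refine ext_of_forall_integral_eq_of_IsFiniteMeasure fun f => ?_
  have := Continuous.ext_on hD (continuous_integral_continuousMap μ)
    (continuous_integral_continuousMap ν)
    fun f hf => le_antisymm (key μ ν hμ hν f hf) (key ν μ hν hμ f hf)
  exact congrFun this f.toContinuousMap

theorem resolvent_op {a : ℝ} (ha : 0 < a) (t : ℝ≥0) (f : C(X, ℝ)) :
    S.resolvent a (S.op t f) = S.op t (S.resolvent a f) := by
  rw [← opL_apply S t (S.resolvent a f), resolvent, resolvent,
    ← ContinuousLinearMap.integral_comp_comm _ (S.integrableOn_exp_smul_op ha f 0)]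
  simp only [map_smul, opL_apply, op_op, add_comm]

/-- The right side vanishes as a → 0, which makes every limit point of the functionals f ↦ a R_a
f(x) invariant. -/
theorem norm_smul_resolvent_op_sub_le {a : ℝ} (ha : 0 < a) (t : ℝ≥0) (f : C(X, ℝ)) :
    ‖a • (S.resolvent a (S.op t f) - S.resolvent a f)‖ ≤
      (Real.exp (a * t) - 1) * ‖f‖ + a * (Real.exp (a * t) * (‖f‖ * t)) := by
  have h1 := S.op_resolvent ha f t.coe_nonneg
  rw [Real.toNNReal_coe] at h1
  have h2 : ‖∫ r in (0 : ℝ)..t, Real.exp (-(a * r)) • S.op r.toNNReal f‖ ≤ ‖f‖ * |(t : ℝ) - 0| := by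
    refine intervalIntegral.norm_integral_le_of_norm_le_const fun r hr => ?_
    rw [Set.uIoc_of_le t.coe_nonneg] at hr
    rw [norm_smul, Real.norm_eq_abs, Real.abs_exp]
    refine (mul_le_of_le_one_left (norm_nonneg _) ?_).trans (S.norm_op_le _ _)
    rw [Real.exp_le_one_iff, neg_nonpos]
    exact mul_nonneg ha.le hr.1.le
  rw [sub_zero, abs_of_nonneg t.coe_nonneg] at h2
  have h3 : ‖a • S.resolvent a f‖ ≤ ‖f‖ := by
    rw [ContinuousMap.norm_le _ (norm_nonneg f)]
    exact fun x => S.abs_smul_resolvent_le ha f x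
  have h4 : 1 ≤ Real.exp (a * t) := Real.one_le_exp (mul_nonneg ha.le t.2)
  set I := ∫ r in (0 : ℝ)..t, Real.exp (-(a * r)) • S.op r.toNNReal f
  have e : a • (S.resolvent a (S.op t f) - S.resolvent a f) =
      (Real.exp (a * t) - 1) • (a • S.resolvent a f) - a • (Real.exp (a * t) • I) := by
    rw [resolvent_op ha, h1]
    module
  rw [e]
  refine (norm_sub_le _ _).trans (add_le_add ?_ ?_)
  · rw [norm_smul, Real.norm_eq_abs, abs_of_nonneg (sub_nonneg.2 h4)]
    exact mul_le_mul_of_nonneg_left h3 (sub_nonneg.2 h4)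
  · rw [norm_smul, norm_smul, Real.norm_eq_abs, Real.norm_eq_abs, abs_of_pos ha, Real.abs_exp]
    gcongr

/-- A Feller semigroup on a nonempty compact space has an invariant probability measure. -/
theorem exists_isInvariant [T2Space X] [HasOuterApproxClosed X] [Nonempty X]
    (S : FellerSemigroup X) : ∃ μ : Measure X, IsProbabilityMeasure μ ∧ S.IsInvariant μ := by
  obtain ⟨x⟩ := ‹Nonempty X›
  -- Along an ultrafilter the bounded numbers a R_a f(x) converge for all f at once, and the limit
  -- is automatically linear in f.
  let U : Ultrafilter ℝ := Ultrafilter.of (𝓝[>] 0)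
  have hU : (U : Filter ℝ) ≤ 𝓝[>] 0 := Ultrafilter.of_le _
  have hpos : ∀ᶠ a in (U : Filter ℝ), 0 < a := hU self_mem_nhdsWithin
  have hex : ∀ f : C(X, ℝ), ∃ l, Tendsto (fun a => a * S.resolvent a f x) U (𝓝 l) := by
    intro f
    obtain ⟨l, -, hl⟩ := (isCompact_Icc (a := -‖f‖) (b := ‖f‖)).ultrafilter_le_nhds
      (U.map fun a => a * S.resolvent a f x) (by
        rw [le_principal_iff]
        change ∀ᶠ a in (U : Filter ℝ), _
        filter_upwards [hpos] with a ha using abs_le.1 (S.abs_smul_resolvent_le ha f x))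
    exact ⟨l, hl⟩
  choose l hl using hex
  let L : C(X, ℝ) →ₗ[ℝ] ℝ :=
    { toFun := l
      map_add' := fun f g => tendsto_nhds_unique (hl (f + g)) (((hl f).add (hl g)).congr' (by
        filter_upwards [hpos] with a ha
        rw [S.resolvent_add ha, ContinuousMap.add_apply, mul_add]))
      map_smul' := fun c f => tendsto_nhds_unique (hl (c • f)) (((hl f).const_mul c).congr' (by
        filter_upwards with a
        rw [S.resolvent_smul, ContinuousMap.smul_apply, smul_eq_mul, mul_left_comm])) }
  obtain ⟨μ, hμ, hμL⟩ := exists_probabilityMeasure_integral_eq L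
    (fun f hf => ge_of_tendsto (hl f) (by
      filter_upwards [hpos] with a ha using mul_nonneg ha.le (S.resolvent_nonneg ha hf x)))
    (tendsto_nhds_unique (hl _) (tendsto_const_nhds.congr' (by
      filter_upwards [hpos] with a ha using (S.resolvent_const ha 1 x).symm)))
  refine ⟨μ, hμ, isInvariant_of_integral_op fun t f => ?_⟩
  rw [hμL, hμL, ← sub_eq_zero]
  change l _ - l _ = 0
  refine tendsto_nhds_unique ((hl _).sub (hl _)) ?_
  have h1 : Tendsto (fun a : ℝ => (Real.exp (a * t) - 1) * ‖f‖ +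
      a * (Real.exp (a * t) * (‖f‖ * t))) U (𝓝 0) := by
    have : Continuous fun a : ℝ => (Real.exp (a * t) - 1) * ‖f‖ +
      a * (Real.exp (a * t) * (‖f‖ * t)) := by fun_prop
    have := this.tendsto 0
    simp only [zero_mul, Real.exp_zero, sub_self, add_zero] at this
    exact this.mono_left (hU.trans nhdsWithin_le_nhds)
  refine squeeze_zero_norm' ?_ h1
  filter_upwards [hpos] with a ha
  refine le_trans ?_ (norm_smul_resolvent_op_sub_le (S := S) ha t f)
  have := (a • (S.resolvent a (S.op t f) - S.resolvent a f)).norm_coe_le_norm x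
  simpa [mul_sub] using this

/-- The restriction of an invariant measure to an invariant set is invariant. -/
theorem IsInvariant.cond [IsProbabilityMeasure μ] (h : S.IsInvariant μ) {A : Set X}
    (hA : MeasurableSet A)
    (hA' : ∀ t, ∀ᵐ x ∂μ, S.kernel t x A = A.indicator (fun _ => (1 : ℝ≥0∞)) x) :
    S.IsInvariant (μ[|A]) := by
  intro t
  have hk : Measurable (S.kernel t) := (S.kernel t).measurable
  ext B hB
  rw [Measure.bind_apply hB hk.aemeasurable, ProbabilityTheory.cond, lintegral_smul_measure,
    Measure.smul_apply, Measure.restrict_apply hB]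
  congr 1
  -- Up to μ-null sets the kernel neither leaves A from A nor enters A from its complement. The
  -- integral over A can thus be extended to the whole space with B ∩ A in place of B.
  have h1 : ∫⁻ x in A, S.kernel t x B ∂μ = ∫⁻ x in A, S.kernel t x (B ∩ A) ∂μ := by
    refine lintegral_congr_ae ?_
    filter_upwards [ae_restrict_mem hA, ae_restrict_of_ae (hA' t)] with x hx hxA
    rw [Set.indicator_of_mem hx] at hxA
    exact (measure_inter_conull ((prob_compl_eq_zero_iff hA).2 hxA)).symm
  have h2 : ∫⁻ x in Aᶜ, S.kernel t x (B ∩ A) ∂μ = 0 := by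
    rw [← lintegral_zero (μ := μ.restrict Aᶜ)]
    refine lintegral_congr_ae ?_
    filter_upwards [ae_restrict_mem hA.compl, ae_restrict_of_ae (hA' t)] with x hx hxA
    rw [Set.indicator_of_notMem hx] at hxA
    exact measure_mono_null Set.inter_subset_right hxA
  rw [h1, ← add_zero (∫⁻ x in A, S.kernel t x (B ∩ A) ∂μ), ← h2, lintegral_add_compl _ hA,
    ← Measure.bind_apply (hB.inter hA) hk.aemeasurable, (h t).def]

/-- A unique invariant probability measure is ergodic. -/
theorem IsInvariant.isErgodic [IsProbabilityMeasure μ] (h : S.IsInvariant μ)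
    (hu : ∀ ν : Measure X, IsProbabilityMeasure ν → S.IsInvariant ν → ν = μ) :
    S.IsErgodic μ := by
  refine ⟨h, fun A hA hA' => or_iff_not_imp_left.2 fun h0 => ?_⟩
  -- Uniqueness identifies μ with its conditioning on A, which gives the complement of A no mass.
  rw [← hu _ (cond_isProbabilityMeasure h0) (h.cond hA hA'), ProbabilityTheory.cond_apply hA]
  simp

end FellerSemigroup

end RWDRE

namespace RWDRE

variable {d : ℕ} {E : Type*} [MetricSpace E]

/-! ### Coordinatewise Lipschitz functions -/

theorem ofReal_abs_sub_le_lipAt (f : Config d E → ℝ) {x : Fin d → ℤ} {η ξ : Config d E}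
    (h : ∀ y, y ≠ x → η y = ξ y) :
    ENNReal.ofReal |f η - f ξ| ≤ lipAt f x * edist (η x) (ξ x) := by
  by_cases hx : η x = ξ x
  · have : η = ξ := funext fun y => by
      by_cases hy : y = x
      · rw [hy, hx]
      · exact h y hy
    simp [this]
  · have key : ∀ η ξ : Config d E, η x ≠ ξ x → (∀ y, y ≠ x → η y = ξ y) →
        ENNReal.ofReal (f η - f ξ) ≤ lipAt f x * edist (η x) (ξ x) := by
      intro η ξ hx h
      have hd : 0 < dist (η x) (ξ x) := dist_pos.2 hx
      have h1 : ENNReal.ofReal ((f η - f ξ) / dist (η x) (ξ x)) ≤ lipAt f x :=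
        le_iSup_of_le η (le_iSup_of_le ξ (le_iSup_of_le ⟨hx, h⟩ le_rfl))
      calc ENNReal.ofReal (f η - f ξ)
          = ENNReal.ofReal ((f η - f ξ) / dist (η x) (ξ x) * dist (η x) (ξ x)) := by
            rw [div_mul_cancel₀ _ hd.ne']
        _ = ENNReal.ofReal ((f η - f ξ) / dist (η x) (ξ x)) * edist (η x) (ξ x) := by
            rw [ENNReal.ofReal_mul' hd.le, edist_dist]
        _ ≤ _ := by gcongr
    rcases abs_cases (f η - f ξ) with h1 | h1
    · rw [h1.1]; exact key η ξ hx h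
    · rw [h1.1, neg_sub, edist_comm]
      exact key ξ η (Ne.symm hx) fun y hy => (h y hy).symm

/-- A continuous function is Lipschitz in the sense given by its coordinatewise Lipschitz
constants. -/
theorem ofReal_abs_sub_le_tsum_lipAt {f : Config d E → ℝ} (hf : Continuous f) (η ξ : Config d E) :
    ENNReal.ofReal |f η - f ξ| ≤ ∑' x, lipAt f x * edist (η x) (ξ x) := by
  classical
  -- η is turned into ξ one site at a time on the finite set F; as F exhausts the lattice, the
  -- product topology and continuity of f give the limit.
  let c (F : Finset (Fin d → ℤ)) : Config d E := fun y => if y ∈ F then ξ y else η y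
  have h1 : ∀ F, ENNReal.ofReal |f η - f (c F)| ≤ ∑ x ∈ F, lipAt f x * edist (η x) (ξ x) := by
    intro F
    induction F using Finset.induction_on with
    | empty => simp [c]
    | insert a F ha ih =>
      rw [Finset.sum_insert ha]
      have h2 := ofReal_abs_sub_le_lipAt f (x := a) (η := c F) (ξ := c (insert a F))
        fun y hy => by simp [c, hy]
      have h3 : c F a = η a := by simp [c, ha]
      have h4 : c (insert a F) a = ξ a := by simp [c]
      rw [h3, h4] at h2
      calc ENNReal.ofReal |f η - f (c (insert a F))|
          ≤ ENNReal.ofReal (|f (c F) - f (c (insert a F))| + |f η - f (c F)|) :=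
            ENNReal.ofReal_le_ofReal (by
              rw [add_comm]; exact abs_sub_le _ _ _)
        _ ≤ _ := ENNReal.ofReal_add_le.trans (add_le_add h2 ih)
  have h2 : Tendsto c atTop (𝓝 ξ) := by
    rw [tendsto_pi_nhds]
    intro y
    refine tendsto_const_nhds.congr' ?_
    filter_upwards [eventually_ge_atTop {y}] with F hF
    have : y ∈ F := hF (Finset.mem_singleton_self y)
    simp [c, this]
  have h3 : Tendsto (fun F => ENNReal.ofReal |f η - f (c F)|) atTop
      (𝓝 (ENNReal.ofReal |f η - f ξ|)) :=
    (ENNReal.continuous_ofReal.tendsto _).comp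
      ((continuous_abs.tendsto _).comp (tendsto_const_nhds.sub ((hf.tendsto ξ).comp h2)))
  exact le_of_tendsto' h3 fun F => (h1 F).trans (ENNReal.sum_le_tsum F)

/-- Functions on `Ω × Ω` bounded by `∑_x w_x ρ(η_x, ξ_x)`, with summable weights `w`. -/
def LipschitzBound (w : (Fin d → ℤ) → ℝ≥0) (F : Config d E → Config d E → ℝ) : Prop :=
  Summable w ∧ ∀ η ξ, F η ξ ≤ ∑' x, w x * dist (η x) (ξ x)

theorem summable_mul_dist (hρ : ∀ a b : E, dist a b ≤ 1) {w : (Fin d → ℤ) → ℝ≥0}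
    (hw : Summable w) (η ξ : Config d E) : Summable fun x => (w x : ℝ) * dist (η x) (ξ x) :=
  Summable.of_nonneg_of_le (fun x => mul_nonneg (w x).2 dist_nonneg)
    (fun x => mul_le_of_le_one_right (w x).2 (hρ _ _)) (NNReal.summable_coe.2 hw)

/-- The algebra of continuous functions with summable coordinatewise Lipschitz weights. -/
def lipschitzSubalgebra [CompactSpace E] (hρ : ∀ a b : E, dist a b ≤ 1) :
    Subalgebra ℝ C(Config d E, ℝ) where
  carrier := {f | ∃ w, LipschitzBound w fun η ξ => |f η - f ξ|}
  mul_mem' := by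
    rintro f g ⟨w, hw, hf⟩ ⟨v, hv, hg⟩
    refine ⟨fun x => ‖g‖₊ * w x + ‖f‖₊ * v x, (hw.mul_left _).add (hv.mul_left _), fun η ξ => ?_⟩
    have h1 := summable_mul_dist hρ hw η ξ
    have h2 := summable_mul_dist hρ hv η ξ
    have e : ∑' x, ((‖g‖₊ * w x + ‖f‖₊ * v x : ℝ≥0) : ℝ) * dist (η x) (ξ x) =
        ‖g‖ * ∑' x, w x * dist (η x) (ξ x) + ‖f‖ * ∑' x, v x * dist (η x) (ξ x) := by
      rw [← tsum_mul_left, ← tsum_mul_left, ← (h1.mul_left _).tsum_add (h2.mul_left _)]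
      congr 1
      funext x
      push_cast
      ring
    rw [e]
    have e2 : (f * g) η - (f * g) ξ = g η * (f η - f ξ) + f ξ * (g η - g ξ) := by
      simp only [ContinuousMap.mul_apply]; ring
    beta_reduce
    rw [e2]
    refine (abs_add_le _ _).trans ?_
    rw [abs_mul, abs_mul]
    exact add_le_add (mul_le_mul (g.norm_coe_le_norm η) (hf η ξ) (abs_nonneg _) (norm_nonneg _))
      (mul_le_mul (f.norm_coe_le_norm ξ) (hg η ξ) (abs_nonneg _) (norm_nonneg _))
  add_mem' := by
    rintro f g ⟨w, hw, hf⟩ ⟨v, hv, hg⟩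
    refine ⟨fun x => w x + v x, hw.add hv, fun η ξ => ?_⟩
    have h1 := summable_mul_dist hρ hw η ξ
    have h2 := summable_mul_dist hρ hv η ξ
    have e : ∑' x, ((w x + v x : ℝ≥0) : ℝ) * dist (η x) (ξ x) =
        ∑' x, w x * dist (η x) (ξ x) + ∑' x, v x * dist (η x) (ξ x) := by
      rw [← h1.tsum_add h2]
      congr 1
      funext x
      push_cast
      ring
    rw [e]
    have e2 : (f + g) η - (f + g) ξ = (f η - f ξ) + (g η - g ξ) := by
      simp only [ContinuousMap.add_apply]; ring
    beta_reduce
    rw [e2]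
    exact (abs_add_le _ _).trans (add_le_add (hf η ξ) (hg η ξ))
  algebraMap_mem' r := ⟨0, summable_zero, fun η ξ => by
    change |(algebraMap ℝ C(Config d E, ℝ) r) η - (algebraMap ℝ C(Config d E, ℝ) r) ξ| ≤ _
    simp⟩

/-- Stone–Weierstrass. The functions ζ ↦ ρ(ζ(x), η(x)) separate points and have their only Lipschitz
weight at x. -/
theorem dense_lipschitzSubalgebra [CompactSpace E] (hρ : ∀ a b : E, dist a b ≤ 1) :
    Dense (lipschitzSubalgebra (d := d) hρ : Set C(Config d E, ℝ)) := by
  classical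
  have h1 := ContinuousMap.subalgebra_topologicalClosure_eq_top_of_separatesPoints
    (lipschitzSubalgebra (d := d) hρ) (by
      intro η ξ h
      obtain ⟨x, hx⟩ := Function.ne_iff.1 h
      let f : C(Config d E, ℝ) := ⟨fun ζ => dist (ζ x) (η x), by fun_prop⟩
      refine ⟨f, ⟨f, ?_, rfl⟩, ?_⟩
      · refine ⟨Pi.single x 1, (hasSum_pi_single x 1).summable, fun ζ ζ' => ?_⟩
        rw [tsum_eq_single x (fun y hy => by simp [hy])]
        simpa [f] using abs_dist_sub_le (ζ x) (ζ' x) (η x)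
      · simpa [f] using (dist_pos.2 (Ne.symm hx)).ne)
  intro f
  have h2 : f ∈ (lipschitzSubalgebra (d := d) hρ).topologicalClosure := by rw [h1]; trivial
  exact h2

/-! ### Jump rates -/

namespace JumpRates

variable (α : JumpRates d E)

/-- Nonzero lattice points have norm at least 1, so the first moment controls the total rate outside
z = 0, where the supremum is finite by compactness. -/
theorem exists_bound [CompactSpace E] : ∃ l : (Fin d → ℤ) → ℝ≥0,
    (∀ η z, α.rate η z ≤ l z) ∧ Summable l ∧ Summable fun z => l z * ‖z‖₊ := by
  classical
  have hfin : ∀ z, ⨆ η, (α.rate η z : ℝ≥0∞) ≠ ∞ := by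
    intro z
    obtain ⟨C, hC⟩ := (isCompact_range (α.continuous_rate z)).bddAbove
    refine ne_top_of_le_ne_top (ENNReal.coe_ne_top (r := C)) (iSup_le fun η => ?_)
    exact ENNReal.coe_le_coe.2 (hC ⟨η, rfl⟩)
  have hl : ∀ z, ((⨆ η, (α.rate η z : ℝ≥0∞)).toNNReal : ℝ≥0∞) = ⨆ η, (α.rate η z : ℝ≥0∞) :=
    fun z => ENNReal.coe_toNNReal (hfin z)
  have h2 : Summable fun z => (⨆ η, (α.rate η z : ℝ≥0∞)).toNNReal * ‖z‖₊ := by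
    rw [← ENNReal.tsum_coe_ne_top_iff_summable]
    refine ne_of_eq_of_ne (tsum_congr fun z => ?_) α.first_moment.ne
    rw [ENNReal.coe_mul, hl, mul_comm]
    rfl
  refine ⟨fun z => (⨆ η, (α.rate η z : ℝ≥0∞)).toNNReal, fun η z => ?_, ?_, h2⟩
  · rw [← ENNReal.coe_le_coe, hl]
    exact le_iSup (fun η => (α.rate η z : ℝ≥0∞)) η
  · have h3 : Summable fun z => (⨆ η, (α.rate η z : ℝ≥0∞)).toNNReal * ‖z‖₊ +
        (Pi.single 0 (⨆ η, (α.rate η 0 : ℝ≥0∞)).toNNReal : (Fin d → ℤ) → ℝ≥0) z :=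
      h2.add (hasSum_pi_single _ _).summable
    refine NNReal.summable_of_le (fun z => ?_) h3
    by_cases hz : z = 0
    · subst hz; simp
    · refine le_add_right (le_mul_of_one_le_right' ?_)
      obtain ⟨i, hi⟩ := Function.ne_iff.1 hz
      have h4 : ‖z i‖₊ ≤ ‖z‖₊ := nnnorm_le_pi_nnnorm z i
      refine le_trans ?_ h4
      rw [← NNReal.coe_le_coe, coe_nnnorm, Int.norm_eq_abs, NNReal.coe_one]
      exact_mod_cast Int.one_le_abs hi

/-- The weight of site y is the sum over z of the Lipschitz constants at y; interchanging sums makes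
its summability the hypothesis on the triple norms. -/
theorem exists_lipschitzBound (hρ : ∀ a b : E, dist a b ≤ 1) [CompactSpace E] :
    ∃ w : (Fin d → ℤ) → ℝ≥0,
      LipschitzBound w fun η ξ => ∑' z, |(α.rate η z : ℝ) - α.rate ξ z| := by
  have h1 : ∑' y, ∑' z, lipAt (fun η => (α.rate η z : ℝ)) y ≠ ∞ := by
    rw [ENNReal.tsum_comm]
    exact α.tripleNorm_lt_top.ne
  have h2 : ∀ y, ∑' z, lipAt (fun η => (α.rate η z : ℝ)) y ≠ ∞ := ENNReal.ne_top_of_tsum_ne_top h1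
  set w : (Fin d → ℤ) → ℝ≥0 := fun y => (∑' z, lipAt (fun η => (α.rate η z : ℝ)) y).toNNReal
  have hw' : ∀ y, (w y : ℝ≥0∞) = ∑' z, lipAt (fun η => (α.rate η z : ℝ)) y :=
    fun y => ENNReal.coe_toNNReal (h2 y)
  have hw : Summable w := by
    rw [← ENNReal.tsum_coe_ne_top_iff_summable]
    simpa only [hw'] using h1
  refine ⟨w, hw, fun η ξ => ?_⟩
  have hs := summable_mul_dist hρ hw η ξ
  have hnn : ∀ x, 0 ≤ (w x : ℝ) * dist (η x) (ξ x) := fun x => mul_nonneg (w x).2 dist_nonneg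
  obtain ⟨l, hl, hls, -⟩ := α.exists_bound
  have hs2 : Summable fun z => |(α.rate η z : ℝ) - α.rate ξ z| := by
    refine Summable.of_nonneg_of_le (fun z => abs_nonneg _) (fun z => ?_)
      (NNReal.summable_coe.2 hls)
    have h3 : (α.rate η z : ℝ) ≤ l z := hl η z
    have h4 : (α.rate ξ z : ℝ) ≤ l z := hl ξ z
    exact abs_sub_le_of_nonneg_of_le (α.rate η z).2 h3 (α.rate ξ z).2 h4
  rw [← ENNReal.ofReal_le_ofReal_iff (tsum_nonneg hnn),
    ENNReal.ofReal_tsum_of_nonneg (fun _ => abs_nonneg _) hs2, ENNReal.ofReal_tsum_of_nonneg hnn hs]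
  calc ∑' z, ENNReal.ofReal |(α.rate η z : ℝ) - α.rate ξ z|
      ≤ ∑' z, ∑' x, lipAt (fun η => (α.rate η z : ℝ)) x * edist (η x) (ξ x) :=
        ENNReal.tsum_le_tsum fun z => ofReal_abs_sub_le_tsum_lipAt
          (NNReal.continuous_coe.comp (α.continuous_rate z)) η ξ
    _ = ∑' x, (∑' z, lipAt (fun η => (α.rate η z : ℝ)) x) * edist (η x) (ξ x) := by
        rw [ENNReal.tsum_comm]
        simp only [ENNReal.tsum_mul_right]
    _ = _ := tsum_congr fun x => by
        rw [ENNReal.ofReal_mul (w x).coe_nonneg, ← edist_dist, ENNReal.ofReal_coe_nnreal, hw']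

variable [CompactSpace E]

theorem summable_rate (η : Config d E) : Summable fun z => (α.rate η z : ℝ) := by
  obtain ⟨l, hl, hls, -⟩ := α.exists_bound
  exact NNReal.summable_coe.2 (NNReal.summable_of_le (hl η) hls)

theorem summable_rate_mul (η : Config d E) {b : (Fin d → ℤ) → ℝ} {M : ℝ} (hb : ∀ z, |b z| ≤ M) :
    Summable fun z => (α.rate η z : ℝ) * b z := by
  refine Summable.of_norm_bounded ((α.summable_rate η).mul_right M) fun z => ?_
  rw [norm_mul, Real.norm_of_nonneg (α.rate η z).coe_nonneg]
  exact mul_le_mul_of_nonneg_left (hb z) (α.rate η z).2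

/-- The jump part of the generator of the environment process. -/
def jump (f : C(Config d E, ℝ)) : C(Config d E, ℝ) where
  toFun η := ∑' z, (α.rate η z : ℝ) * (f (shift (-z) η) - f η)
  continuous_toFun := by
    obtain ⟨l, hl, hls, -⟩ := α.exists_bound
    refine continuous_tsum (fun z => ?_) ((NNReal.summable_coe.2 hls).mul_right (2 * ‖f‖))
      fun z η => ?_
    · exact (NNReal.continuous_coe.comp (α.continuous_rate z)).mul
        ((f.continuous.comp (shift (-z)).continuous).sub f.continuous)
    · rw [norm_mul, Real.norm_of_nonneg (α.rate η z).coe_nonneg]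
      refine mul_le_mul (hl η z) ?_ (norm_nonneg _) (l z).2
      rw [two_mul]
      exact (norm_sub_le _ _).trans (add_le_add (f.norm_coe_le_norm _) (f.norm_coe_le_norm _))

theorem jump_apply (f : C(Config d E, ℝ)) (η : Config d E) :
    α.jump f η = ∑' z, (α.rate η z : ℝ) * (f (shift (-z) η) - f η) := rfl

theorem jump_apply' (f : C(Config d E, ℝ)) (η : Config d E) :
    α.jump f η = ∑' z, (α.rate η z : ℝ) * f (shift (-z) η) - (∑' z, (α.rate η z : ℝ)) * f η := by
  rw [jump_apply, ← tsum_mul_right, ← Summable.tsum_sub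
    (α.summable_rate_mul η fun z => f.norm_coe_le_norm _) ((α.summable_rate η).mul_right _)]
  simp only [mul_sub]

theorem jump_add (f g : C(Config d E, ℝ)) : α.jump (f + g) = α.jump f + α.jump g := by
  ext η
  have h := α.summable_rate_mul η fun z => f.norm_coe_le_norm (shift (-z) η)
  have h' := α.summable_rate_mul η fun z => g.norm_coe_le_norm (shift (-z) η)
  rw [ContinuousMap.add_apply, jump_apply', jump_apply', jump_apply']
  simp only [ContinuousMap.add_apply, mul_add]
  rw [h.tsum_add h']
  ring

theorem jump_smul (c : ℝ) (f : C(Config d E, ℝ)) : α.jump (c • f) = c • α.jump f := by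
  ext η
  rw [ContinuousMap.smul_apply, jump_apply', jump_apply', smul_eq_mul, mul_sub, ← tsum_mul_left]
  simp only [ContinuousMap.smul_apply, smul_eq_mul, mul_left_comm c]

theorem jump_const (c : ℝ) : α.jump (ContinuousMap.const _ c) = 0 := by
  ext η
  simp [jump_apply]

variable {α} {c : ℝ} (hc : ∀ η, ∑' z, (α.rate η z : ℝ) ≤ c)

include hc in
-- Adding c fills up the negative diagonal: the value is Σ_z α(η,z) f(θ_{-z}η) + (c - Σ_z α(η,z))
-- f(η), with nonnegative weights.
theorem jump_add_smul_nonneg {f : C(Config d E, ℝ)} (hf : ∀ η, 0 ≤ f η) (η : Config d E) :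
    0 ≤ (α.jump f + c • f) η := by
  rw [ContinuousMap.add_apply, jump_apply', ContinuousMap.smul_apply, smul_eq_mul]
  have h1 : 0 ≤ ∑' z, (α.rate η z : ℝ) * f (shift (-z) η) :=
    tsum_nonneg fun z => mul_nonneg (α.rate η z).2 (hf _)
  have h2 := mul_le_mul_of_nonneg_right (hc η) (hf η)
  linarith

include hc in
theorem jump_add_smul_le {f : C(Config d E, ℝ)} {M : ℝ} (hf : ∀ η, f η ≤ M) (η : Config d E) :
    (α.jump f + c • f) η ≤ c * M := by
  have h1 := jump_add_smul_nonneg hc (f := ContinuousMap.const _ M + (-1 : ℝ) • f)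
    (fun η => by simpa using hf η) η
  rw [jump_add, jump_const, jump_smul] at h1
  simp only [ContinuousMap.add_apply, ContinuousMap.smul_apply, smul_eq_mul,
    ContinuousMap.const_apply, ContinuousMap.zero_apply] at h1 ⊢
  linarith

include hc in
theorem le_jump_add_smul {f : C(Config d E, ℝ)} {M : ℝ} (hf : ∀ η, M ≤ f η) (η : Config d E) :
    c * M ≤ (α.jump f + c • f) η := by
  have h1 := jump_add_smul_le hc (f := (-1 : ℝ) • f) (M := -M) (fun η => by simpa using hf η) η
  rw [jump_smul] at h1
  simp only [ContinuousMap.add_apply, ContinuousMap.smul_apply, smul_eq_mul] at h1 ⊢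
  linarith

include hc in
theorem norm_jump_add_smul_le [Nonempty E] (f : C(Config d E, ℝ)) :
    ‖α.jump f + c • f‖ ≤ c * ‖f‖ := by
  rw [ContinuousMap.norm_le_of_nonempty]
  intro η
  have h : ∀ y, |f y| ≤ ‖f‖ := fun y => by simpa using f.norm_coe_le_norm y
  rw [Real.norm_eq_abs, abs_le, ← mul_neg]
  exact ⟨le_jump_add_smul hc (fun y => (abs_le.1 (h y)).1) η,
    jump_add_smul_le hc (fun y => (abs_le.1 (h y)).2) η⟩

variable (α)

theorem exists_tsum_rate_le : ∃ c : ℝ, 0 ≤ c ∧ ∀ η, ∑' z, (α.rate η z : ℝ) ≤ c := by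
  obtain ⟨l, hl, hls, -⟩ := α.exists_bound
  refine ⟨∑' z, (l z : ℝ), tsum_nonneg fun z => (l z).2, fun η => ?_⟩
  exact (α.summable_rate η).tsum_le_tsum (fun z => hl η z) (NNReal.summable_coe.2 hls)

end JumpRates

theorem isEnvironmentProcess_iff [CompactSpace E] [MeasurableSpace E]
    {S T : FellerSemigroup (Config d E)} {α : JumpRates d E} : IsEnvironmentProcess S α T ↔
      ∀ f g, T.GeneratorGraph f g ↔ S.GeneratorGraph f (g - α.jump f) := by
  refine forall_congr' fun f => forall_congr' fun g => iff_congr Iff.rfl ?_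
  constructor
  · rintro ⟨h, hS, hg⟩
    have : g - α.jump f = h := by
      ext η
      rw [ContinuousMap.sub_apply, hg, JumpRates.jump_apply, add_sub_cancel_right]
    rwa [this]
  · intro h
    exact ⟨_, h, fun η => by rw [ContinuousMap.sub_apply, ← α.jump_apply, sub_add_cancel]⟩

/-- Existence and uniqueness of the semigroup of the environment process. -/
theorem existsUnique_isEnvironmentProcess [CompactSpace E] [Nonempty E] [MeasurableSpace E]
    [BorelSpace E] (S : FellerSemigroup (Config d E)) (α : JumpRates d E) :
    ∃! T : FellerSemigroup (Config d E), IsEnvironmentProcess S α T := by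
  obtain ⟨c, hc0, hc⟩ := α.exists_tsum_rate_le
  let K : C(Config d E, ℝ) →L[ℝ] C(Config d E, ℝ) := LinearMap.mkContinuous
    { toFun := fun f => α.jump f + c • f
      map_add' := fun f g => by rw [α.jump_add, smul_add]; abel
      map_smul' := fun a f => by rw [α.jump_smul, RingHom.id_apply, smul_add, smul_comm] } c
    (JumpRates.norm_jump_add_smul_le hc)
  have hK : ∀ f, K f = α.jump f + c • f := fun _ => rfl
  obtain ⟨T, hT⟩ := FellerSemigroup.exists_perturbation (S := S) (K := K) hc0
    (JumpRates.norm_jump_add_smul_le hc) (fun f hf => JumpRates.jump_add_smul_nonneg hc hf)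
    (by
      rw [hK, JumpRates.jump_const, zero_add]
      ext
      simp)
  simp only [hK, add_sub_cancel_right] at hT
  refine ⟨T, isEnvironmentProcess_iff.2 hT, fun T' hT' => ?_⟩
  replace hT' := isEnvironmentProcess_iff.1 hT'
  exact FellerSemigroup.eq_of_generatorGraph fun f g h => (hT f g).2 ((hT' f g).1 h)

end RWDRE

namespace RWDRE

/-! ### A survival function for random walks with a finite first moment -/

/-- A bound for the probability that a random walk with rates `l` ever leaves a ball whose radius
grows with speed `γ`, as a function of the initial distance `u` to the complement of the ball. -/
theorem exists_survival {Z : Type*} (l r : Z → ℝ) (hl : ∀ z, 0 ≤ l z) (hr : ∀ z, 0 ≤ r z)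
    (hls : Summable l) (hlr : Summable fun z => l z * r z) :
    ∃ (U : ℝ → ℝ) (γ : ℝ), 0 < γ ∧ Antitone U ∧ (∀ u, 0 ≤ U u) ∧ (∀ u, U u ≤ 1) ∧
      (∀ u, 0 ≤ u → U u ≤ 1 / 2) ∧ (∀ u, u < 0 → U u = 1) ∧
      ∀ y h, 0 ≤ h → γ * h ≤ y →
        U y + h * ∑' z, l z * (U (y - r z) - U y) ≤ U (y - γ * h) := by
  set κ := ∑' z, l z * r z with hκ
  -- `A` below is the normalization that gives U(0) ≤ 1/2.
  have hκ0 : 0 ≤ κ := tsum_nonneg fun z => mul_nonneg (hl z) (hr z)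
  set A : ℝ := 1 / (2 * (κ + 1)) with hA
  have hA0 : 0 < A := by positivity
  have hAκ : A * κ ≤ 1 / 2 := by
    rw [hA, div_mul_eq_mul_div, div_le_div_iff₀ (by positivity) (by norm_num)]
    linarith
  -- The function r²/(r+u) is convex in u, equals r at u = 0, hence is summable against l by the
  -- first moment alone, and has slope -r²/(r+u)², which is comparable to 1 for jumps r longer than
  -- u.
  set v : ℝ → Z → ℝ := fun u z => l z * (r z ^ 2 / (r z + u)) with hv
  have hv0 : ∀ u, 0 ≤ u → ∀ z, 0 ≤ v u z := fun u hu z =>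
    mul_nonneg (hl z) (div_nonneg (sq_nonneg _) (add_nonneg (hr z) hu))
  have hvle : ∀ u, 0 ≤ u → ∀ z, v u z ≤ l z * r z := fun u hu z => by
    refine mul_le_mul_of_nonneg_left ?_ (hl z)
    rcases (add_nonneg (hr z) hu).eq_or_lt with h | h
    · rw [← h, div_zero]; exact hr z
    · rw [div_le_iff₀ h]
      nlinarith [hr z, mul_nonneg (hr z) hu]
  have hvs : ∀ u, 0 ≤ u → Summable (v u) := fun u hu =>
    Summable.of_nonneg_of_le (hv0 u hu) (hvle u hu) hlr
  have hvanti : ∀ u u', 0 ≤ u → u ≤ u' → ∀ z, v u' z ≤ v u z := fun u u' hu huu' z => by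
    refine mul_le_mul_of_nonneg_left ?_ (hl z)
    rcases (hr z).eq_or_lt with h | h
    · simp [← h]
    · exact div_le_div_of_nonneg_left (sq_nonneg _) (by linarith) (by linarith)
  set U : ℝ → ℝ := fun u => if u < 0 then 1 else A * ∑' z, v u z with hU
  have hUpos : ∀ u, 0 ≤ u → U u = A * ∑' z, v u z := fun u hu => if_neg (not_lt.2 hu)
  have hUneg : ∀ u, u < 0 → U u = 1 := fun u hu => if_pos hu
  have hUhalf : ∀ u, 0 ≤ u → U u ≤ 1 / 2 := fun u hu => by
    rw [hUpos u hu]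
    refine le_trans (mul_le_mul_of_nonneg_left ?_ hA0.le) hAκ
    exact (hvs u hu).tsum_le_tsum (hvle u hu) hlr
  have hU1 : ∀ u, U u ≤ 1 := fun u => by
    rcases lt_or_ge u 0 with h | h
    · exact (hUneg u h).le
    · linarith [hUhalf u h]
  have hU0 : ∀ u, 0 ≤ U u := fun u => by
    rcases lt_or_ge u 0 with h | h
    · rw [hUneg u h]; exact zero_le_one
    · rw [hUpos u h]; exact mul_nonneg hA0.le (tsum_nonneg (hv0 u h))
  have hUanti : Antitone U := fun u u' huu' => by
    rcases lt_or_ge u 0 with h | h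
    · rw [hUneg u h]; exact hU1 u'
    · rw [hUpos u h, hUpos u' (h.trans huu')]
      exact mul_le_mul_of_nonneg_left
        ((hvs _ (h.trans huu')).tsum_le_tsum (hvanti u u' h huu') (hvs u h)) hA0.le
  -- The speed is chosen such that Aγ = 2Aκ + 9, the coefficient of `G` in the bound on the jump
  -- term.
  refine ⟨U, 2 * κ + 9 / A, by positivity, hUanti, hU0, hU1, hUhalf, hUneg, ?_⟩
  intro y h hh hy
  set γ := 2 * κ + 9 / A with hγ
  have hγ0 : 0 < γ := by positivity
  rcases hh.eq_or_lt with rfl | hh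
  · simp
  have hy0 : 0 < y := lt_of_lt_of_le (by positivity) hy
  set g : Z → ℝ := fun z => l z * (r z ^ 2 / (r z + y) ^ 2) with hg
  have hg0 : ∀ z, 0 ≤ g z := fun z => mul_nonneg (hl z) (by positivity)
  have hgs : Summable g := by
    refine Summable.of_nonneg_of_le hg0 (fun z => ?_) hls
    refine mul_le_of_le_one_right (hl z) ?_
    have := hr z
    rw [div_le_one (by positivity)]
    exact pow_le_pow_left₀ this (by linarith) 2
  set G := ∑' z, g z with hG
  have hG0 : 0 ≤ G := tsum_nonneg hg0
  -- Tangent line inequality: U is convex on [0,∞) and its slope at y is -A G.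
  have low : U y + A * (γ * h) * G ≤ U (y - γ * h) := by
    have hyγ : 0 ≤ y - γ * h := sub_nonneg.2 hy
    rw [hUpos y hy0.le, hUpos _ hyγ, mul_assoc, ← mul_add]
    refine mul_le_mul_of_nonneg_left ?_ hA0.le
    rw [hG, ← tsum_mul_left, ← (hvs y hy0.le).tsum_add (hgs.mul_left _)]
    refine ((hvs y hy0.le).add (hgs.mul_left _)).tsum_le_tsum (fun z => ?_) (hvs _ hyγ)
    simp only [hv, hg]
    rw [mul_left_comm, ← mul_add]
    refine mul_le_mul_of_nonneg_left ?_ (hl z)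
    rcases (hr z).eq_or_lt with h0 | h0
    · simp [← h0]
    · have h1 : 0 < r z + y := by linarith
      have h2 : 0 < r z + (y - γ * h) := by linarith
      have e : r z ^ 2 / (r z + (y - γ * h)) - (r z ^ 2 / (r z + y) +
          γ * h * (r z ^ 2 / (r z + y) ^ 2)) =
          r z ^ 2 * (γ * h) ^ 2 / ((r z + (y - γ * h)) * (r z + y) ^ 2) := by
        field_simp
        ring
      have h3 : 0 ≤ r z ^ 2 * (γ * h) ^ 2 / ((r z + (y - γ * h)) * (r z + y) ^ 2) := by positivity
      linarith
  -- Jumps of length at most y/2 raise U at no more than twice its slope at y. For longer jumps r +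
  -- y < 3r, and the trivial bound 1 is at most 9r²/(r+y)².
  have up : ∀ z, U (y - r z) - U y ≤ 2 * A * G * r z + 9 * (r z ^ 2 / (r z + y) ^ 2) := by
    intro z
    have hrz := hr z
    rcases le_or_gt (r z) (y / 2) with hz | hz
    · have hyz : 0 ≤ y - r z := by linarith
      have h1 : U (y - r z) ≤ U y + 2 * A * G * r z := by
        rw [hUpos y hy0.le, hUpos _ hyz, show 2 * A * G * r z = A * ((2 * r z) * G) by ring,
          ← mul_add]
        refine mul_le_mul_of_nonneg_left ?_ hA0.le
        rw [hG, ← tsum_mul_left, ← (hvs y hy0.le).tsum_add (hgs.mul_left _)]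
        refine (hvs _ hyz).tsum_le_tsum (fun w => ?_) ((hvs y hy0.le).add (hgs.mul_left _))
        simp only [hv, hg]
        rw [mul_left_comm (2 * r z), ← mul_add]
        refine mul_le_mul_of_nonneg_left ?_ (hl w)
        have hrw := hr w
        have h1 : 0 < r w + y := by linarith
        have h2 : 0 < r w + (y - r z) := by linarith
        have e : (r w ^ 2 / (r w + y) + 2 * r z * (r w ^ 2 / (r w + y) ^ 2)) -
            r w ^ 2 / (r w + (y - r z)) =
            r w ^ 2 * r z * (r w + y - 2 * r z) / ((r w + (y - r z)) * (r w + y) ^ 2) := by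
          field_simp
          ring
        have h3 : 0 ≤ r w ^ 2 * r z * (r w + y - 2 * r z) /
            ((r w + (y - r z)) * (r w + y) ^ 2) := by
          have : 0 ≤ r w + y - 2 * r z := by linarith
          positivity
        linarith
      have h2 : 0 ≤ 9 * (r z ^ 2 / (r z + y) ^ 2) := by positivity
      linarith
    · have h1 : 1 ≤ 9 * (r z ^ 2 / (r z + y) ^ 2) := by
        rw [← mul_div_assoc, le_div_iff₀ (by positivity), one_mul]
        nlinarith
      have h2 : 0 ≤ 2 * A * G * r z := by positivity
      linarith [hU1 (y - r z), hU0 y]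
  have hs1 : Summable fun z => l z * (U (y - r z) - U y) := by
    refine Summable.of_nonneg_of_le (fun z => mul_nonneg (hl z)
      (sub_nonneg.2 (hUanti (by linarith [hr z])))) (fun z => ?_) hls
    exact mul_le_of_le_one_right (hl z) (by linarith [hU1 (y - r z), hU0 y])
  have hsum : ∑' z, l z * (U (y - r z) - U y) ≤ 2 * A * G * κ + 9 * G := by
    have e1 : 2 * A * G * κ + 9 * G = ∑' z, (2 * A * G * (l z * r z) + 9 * g z) := by
      rw [(hlr.mul_left _).tsum_add (hgs.mul_left _), tsum_mul_left, tsum_mul_left]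
    rw [e1]
    refine hs1.tsum_le_tsum (fun z => ?_) ((hlr.mul_left _).add (hgs.mul_left _))
    refine (mul_le_mul_of_nonneg_left (up z) (hl z)).trans_eq ?_
    simp only [hg]
    ring
  have e : A * γ = 2 * A * κ + 9 := by rw [hγ]; field_simp
  calc U y + h * ∑' z, l z * (U (y - r z) - U y) ≤ U y + h * (2 * A * G * κ + 9 * G) := by gcongr
    _ = U y + h * G * (2 * A * κ + 9) := by ring
    _ = U y + A * (γ * h) * G := by rw [← e]; ring
    _ ≤ _ := low

/-! ### Measurability and sampling -/

/-- Each superlevel set is a countable union, over rational right endpoints, of order-connected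
sets. The hypothesis survives uncountable suprema of right-continuous functions, such as `maxDist`.
-/
theorem measurable_of_lt_eventually_nhdsGT {F : ℝ → ℝ≥0∞}
    (hF : ∀ t a, a < F t → ∀ᶠ s in 𝓝[>] t, a < F s) : Measurable F := by
  refine measurable_of_Ioi fun a => ?_
  have h1 : F ⁻¹' Set.Ioi a = ⋃ q : ℚ, {s : ℝ | ∃ t, t ≤ s ∧ s < q ∧ Set.Ico t q ⊆ F ⁻¹' Set.Ioi a} := by
    ext s
    simp only [Set.mem_iUnion, Set.mem_ofPred_eq]
    constructor
    · intro hs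
      obtain ⟨u, hu, hsu⟩ := (mem_nhdsGT_iff_exists_Ioo_subset).1 (hF s a hs)
      obtain ⟨q, hq1, hq2⟩ := exists_rat_btwn (Set.mem_Ioi.1 hu)
      refine ⟨q, s, le_rfl, hq1, fun r hr => ?_⟩
      rcases hr.1.eq_or_lt with rfl | h
      · exact hs
      · exact hsu ⟨h, hr.2.trans hq2⟩
    · rintro ⟨q, t, hts, hsq, h⟩
      exact h ⟨hts, hsq⟩
  rw [h1]
  refine MeasurableSet.iUnion fun q => Set.OrdConnected.measurableSet ⟨?_⟩
  rintro s ⟨t, hts, hsq, ht⟩ s' ⟨t', hts', hsq', ht'⟩ r ⟨hr1, hr2⟩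
  exact ⟨t, hts.trans hr1, hr2.trans_lt hsq', ht⟩

/-- Some translate of the lattice `h ℕ` has a Riemann sum bounded by the integral. -/
theorem exists_sum_le_lintegral {F : ℝ → ℝ≥0∞} (hF : Measurable F) (t₀ : ℝ) {h : ℝ} (hh : 0 < h) :
    ∃ s ∈ Set.Ico 0 h, ENNReal.ofReal h * ∑' k : ℕ, F (t₀ + s + k * h) ≤
      ∫⁻ t in Set.Ici t₀, F t := by
  have hm : ∀ k : ℕ, Measurable fun s : ℝ => F (t₀ + s + k * h) := fun k =>
    hF.comp (by fun_prop)
  -- Averaging the Riemann sum over its offset in [0,h) recovers the integral, and some offset does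
  -- at least as well as the average. No monotonicity of F is needed.
  have h1 : ∫⁻ s in Set.Ico 0 h, ∑' k : ℕ, F (t₀ + s + k * h) ≤ ∫⁻ t in Set.Ici t₀, F t := by
    rw [lintegral_tsum fun k => (hm k).aemeasurable]
    have h2 : ∀ k : ℕ, ∫⁻ s in Set.Ico 0 h, F (t₀ + s + k * h) =
        ∫⁻ t in Set.Ico (t₀ + k * h) (t₀ + (k + 1 : ℕ) * h), F t := by
      intro k
      have := (measurePreserving_add_right volume (t₀ + k * h)).setLIntegral_comp_preimage_emb
        (measurableEmbedding_addRight _) F (Set.Ico (t₀ + k * h) (t₀ + (k + 1 : ℕ) * h))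
      rw [← this, Set.preimage_add_const_Ico, sub_self]
      congr 1
      · congr 2
        push_cast
        ring
      · funext s
        congr 1
        ring
    simp only [h2]
    rw [← lintegral_iUnion (fun k => measurableSet_Ico)]
    · refine lintegral_mono_set (Set.iUnion_subset fun k t ht => ?_)
      exact le_trans (le_add_of_nonneg_right (by positivity)) ht.1
    · have hmono : Monotone fun k : ℕ => t₀ + k * h := fun a b hab => by
        have : (a : ℝ) ≤ b := by exact_mod_cast hab
        have := mul_le_mul_of_nonneg_right this hh.le
        simp only
        linarith
      exact hmono.pairwise_disjoint_on_Ico_succ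
  have hv : volume (Set.Ico (0 : ℝ) h) = ENNReal.ofReal h := by simp
  obtain ⟨s, hs, hsle⟩ := exists_le_setLAverage (μ := volume) (s := Set.Ico (0 : ℝ) h)
    (f := fun s => ∑' k : ℕ, F (t₀ + s + k * h)) (by simpa [hv] using hh) (by simp [hv])
    (Measurable.tsum hm).aemeasurable
  refine ⟨s, hs, le_trans ?_ h1⟩
  rw [setLAverage_eq, hv] at hsle
  calc _ ≤ ENNReal.ofReal h * ((∫⁻ s in Set.Ico 0 h, ∑' k : ℕ, F (t₀ + s + k * h)) /
        ENNReal.ofReal h) := by gcongr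
    _ = _ := ENNReal.mul_div_cancel (by simpa using hh) ENNReal.ofReal_ne_top

/-! ### The generator equation -/

theorem FellerSemigroup.op_sub_op_le {X : Type*} [TopologicalSpace X] [CompactSpace X]
    [MeasurableSpace X] [BorelSpace X] (S : FellerSemigroup X) (t : ℝ≥0) {f : C(X, ℝ)} {M : ℝ}
    (h : ∀ x y, f x - f y ≤ M) (x y : X) : S.op t f x - S.op t f y ≤ M := by
  have h1 : ∀ z, S.op t f x ≤ f z + M := fun z => S.op_le t (fun x => by linarith [h x z]) x
  have h2 := S.le_op t (c := S.op t f x - M) (fun z => by linarith [h1 z]) y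
  linarith

variable {d : ℕ} {E : Type*} [MetricSpace E] [CompactSpace E] [Nonempty E] [MeasurableSpace E]
  [BorelSpace E] {S : FellerSemigroup (Config d E)} {α : JumpRates d E} 

theorem JumpRates.continuous_jump (α : JumpRates d E) : Continuous α.jump := by
  obtain ⟨c, hc0, hc⟩ := α.exists_tsum_rate_le
  have h : Continuous fun f => α.jump f + c • f := by
    refine (LipschitzWith.of_dist_le_mul (K := c.toNNReal) fun f g => ?_).continuous
    rw [dist_eq_norm, dist_eq_norm, Real.coe_toNNReal c hc0]
    have h1 := norm_jump_add_smul_le hc (f + (-1 : ℝ) • g)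
    rw [α.jump_add, α.jump_smul] at h1
    have e1 : α.jump f + c • f - (α.jump g + c • g) =
        α.jump f + (-1 : ℝ) • α.jump g + c • (f + (-1 : ℝ) • g) := by module
    have e2 : f - g = f + (-1 : ℝ) • g := by module
    rw [e1, e2]
    exact h1
  have h2 : α.jump = fun f => (α.jump f + c • f) - c • f := by
    funext f
    rw [add_sub_cancel_right]
  rw [h2]
  exact h.sub (continuous_const_smul c)

/-- The error in the discretization of the generator equation. -/
def stepError (S : FellerSemigroup (Config d E)) (α : JumpRates d E) (a : ℝ)
    (u f : C(Config d E, ℝ)) (h : ℝ) : C(Config d E, ℝ) :=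
  h⁻¹ • (u - (1 - a * h) • (S.op h.toNNReal u + h • α.jump (S.op h.toNNReal u))) - f

/-- The resolvent equation a u - f = L u + J u read as one step of length h: discount, environment
step, jump, plus running reward f. The error term makes it exact. -/
theorem eq_add_stepError (a : ℝ) (u f : C(Config d E, ℝ)) {h : ℝ} (hh : h ≠ 0) :
    u = (1 - a * h) • (S.op h.toNNReal u + h • α.jump (S.op h.toNNReal u)) +
      h • (f + stepError S α a u f h) := by
  rw [stepError, add_sub_cancel, smul_inv_smul₀ hh, add_sub_cancel]

/-- The terms converge to -g + a u - J u - f, which is zero by the resolvent equation. -/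
theorem tendsto_stepError {a : ℝ} {u f g : C(Config d E, ℝ)} (hu : S.GeneratorGraph u g)
    (hg : g + α.jump u = a • u - f) : Tendsto (stepError S α a u f) (𝓝[>] 0) (𝓝 0) := by
  have h1 : Tendsto (fun h : ℝ => S.op h.toNNReal u) (𝓝[>] 0) (𝓝 u) := by
    have := (S.continuous_op_toNNReal u).tendsto 0
    rw [Real.toNNReal_zero, S.op_zero] at this
    exact tendsto_nhdsWithin_of_tendsto_nhds this
  have h2 := (α.continuous_jump.tendsto u).comp h1
  have h3 : Tendsto (fun h : ℝ => 1 - a * h) (𝓝[>] 0) (𝓝 1) := by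
    have : Continuous fun h : ℝ => 1 - a * h := by fun_prop
    simpa using tendsto_nhdsWithin_of_tendsto_nhds (s := Set.Ioi 0) (this.tendsto 0)
  have h4 := (((hu.tendsto.neg.add (h1.const_smul a)).sub (h3.smul h2))).sub_const f
  have e : -g + a • u - (1 : ℝ) • α.jump u - f = 0 := by
    rw [one_smul, eq_sub_of_add_eq hg]
    abel
  rw [e] at h4
  refine h4.congr' ?_
  filter_upwards [self_mem_nhdsWithin] with h hh
  have hh' : h ≠ 0 := ne_of_gt hh
  simp only [stepError, Function.comp]
  congr 1
  set v := S.op h.toNNReal u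
  set j := α.jump v
  have e1 : a • v = h⁻¹ • ((a * h) • v) := by rw [smul_smul]; congr 1; field_simp
  have e2 : (1 - a * h) • j = h⁻¹ • ((1 - a * h) • h • j) := by
    rw [smul_smul, smul_smul]; congr 1; field_simp
  rw [e1, e2]
  module

/-- Variation of constants: a window in which the walker does not jump. -/
theorem sub_le_exp_mul_op_sub {a c F O r : ℝ} {u f g : C(Config d E, ℝ)} (ha : 0 < a)
    (hc0 : 0 ≤ c) (hc : ∀ η, ∑' z, (α.rate η z : ℝ) ≤ c) (hu : S.GeneratorGraph u g)
    (hg : g + α.jump u = a • u - f) (hF : ∀ η ξ, f η - f ξ ≤ F) {lo : ℝ} (hlo : ∀ η, lo ≤ u η)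
    (hhi : ∀ η, u η ≤ lo + O) (hr : 0 ≤ r) (η ξ : Config d E) :
    u η - u ξ ≤ Real.exp (-((a + c) * r)) * (S.op r.toNNReal u η - S.op r.toNNReal u ξ) +
      (1 - Real.exp (-((a + c) * r))) / (a + c) * (F + c * O) := by
  set b := a + c with hb
  have hb0 : 0 < b := by linarith
  set M := F + c * O
  set w := f + (α.jump u + c • u) with hw
  -- The operator J + c is positive with total weight c, so it maps an oscillation O to at most cO.
  have hwM : ∀ η ξ, w η - w ξ ≤ M := fun η ξ => by
    have h1 := JumpRates.jump_add_smul_le hc hhi η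
    have h2 := JumpRates.le_jump_add_smul hc hlo ξ
    have h3 := hF η ξ
    have e : ∀ ζ, w ζ = f ζ + (α.jump u + c • u) ζ := fun ζ => rfl
    rw [e, e]
    simp only [M]
    linarith
  -- For the environment alone u solves a resolvent equation at rate a + c with right side `w`;
  -- hence e^{-bs} S_s u has derivative -e^{-bs} S_s w.
  have hgw : g = b • u - w := by
    rw [eq_sub_of_add_eq hg, hb, hw]
    module
  have hφ : ∀ s : ℝ, 0 ≤ s → HasDerivWithinAt
      (fun s : ℝ => -(Real.exp (-(b * s)) * (S.op s.toNNReal u η - S.op s.toNNReal u ξ)))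
      (Real.exp (-(b * s)) * (S.op s.toNNReal w η - S.op s.toNNReal w ξ)) (Set.Ici s) s := by
    intro s hs
    have h1 := hu.hasDerivWithinAt hs
    have h2 : ∀ ζ : Config d E, HasDerivWithinAt (fun s : ℝ => S.op s.toNNReal u ζ)
        (S.op s.toNNReal g ζ) (Set.Ici s) s := fun ζ =>
      (ContinuousMap.evalCLM ℝ ζ : C(Config d E, ℝ) →L[ℝ] ℝ).hasFDerivAt.comp_hasDerivWithinAt s h1
    have h3 : HasDerivAt (fun s : ℝ => Real.exp (-(b * s))) (Real.exp (-(b * s)) * (-b)) s := by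
      simpa using ((hasDerivAt_id s).const_mul b).neg.exp
    have h4 := (h3.hasDerivWithinAt.mul ((h2 η).sub (h2 ξ))).neg
    refine h4.congr_deriv ?_
    rw [hgw, S.op_sub, S.op_smul]
    simp only [Pi.sub_apply, ContinuousMap.sub_apply, ContinuousMap.smul_apply, smul_eq_mul]
    ring
  have hB : ∀ s : ℝ, HasDerivAt (fun s : ℝ => -(u η - u ξ) + (1 - Real.exp (-(b * s))) / b * M)
      (Real.exp (-(b * s)) * M) s := by
    intro s
    have h3 : HasDerivAt (fun s : ℝ => Real.exp (-(b * s))) (Real.exp (-(b * s)) * (-b)) s := by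
      simpa using ((hasDerivAt_id s).const_mul b).neg.exp
    have h4 := (((h3.const_sub 1).div_const b).mul_const M).const_add (-(u η - u ξ))
    refine h4.congr_deriv ?_
    field_simp
  have hcont : ∀ ζ : Config d E, Continuous fun s : ℝ => S.op s.toNNReal u ζ := fun ζ =>
    (continuous_eval_const ζ).comp (S.continuous_op_toNNReal u)
  have key := image_le_of_deriv_right_le_deriv_boundary (a := 0) (b := r)
    (Continuous.continuousOn (by
      have := hcont η
      have := hcont ξ
      fun_prop)) (fun s hs => hφ s hs.1) (B := fun s : ℝ => -(u η - u ξ) +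
        (1 - Real.exp (-(b * s))) / b * M) (by simp [S.op_zero])
    (Continuous.continuousOn (by fun_prop)) (fun s _ => (hB s).hasDerivWithinAt)
    (fun s _ => mul_le_mul_of_nonneg_left (S.op_sub_op_le _ hwM η ξ) (Real.exp_pos _).le)
    (Set.right_mem_Icc.2 hr)
  linarith

end RWDRE

namespace RWDRE

/-! ### Path space -/

namespace CadlagPath

variable {X Y : Type*} [TopologicalSpace X] [MeasurableSpace X] [TopologicalSpace Y]
  [MeasurableSpace Y]

theorem measurable_eval (t : ℝ≥0) : Measurable fun ω : CadlagPath X => ω t :=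
  Measurable.of_comap_le (le_iSup (fun s : ℝ≥0 =>
    MeasurableSpace.comap (fun ω : CadlagPath X => ω s) inferInstance) t)

theorem measurable_eval_canonicalFiltration {s t : ℝ≥0} (h : s ≤ t) :
    Measurable[canonicalFiltration X t] fun ω : CadlagPath X => ω s :=
  Measurable.of_comap_le (le_iSup (fun u : Set.Iic t =>
    MeasurableSpace.comap (fun ω : CadlagPath X => ω u) inferInstance) ⟨s, h⟩)

theorem measurable_map {g : C(X, Y)} (hg : Measurable g) :
    Measurable (CadlagPath.map g) := by
  rw [measurable_iff_comap_le]
  change MeasurableSpace.comap _ (⨆ s : ℝ≥0, _) ≤ _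
  rw [MeasurableSpace.comap_iSup]
  refine iSup_le fun s => ?_
  rw [MeasurableSpace.comap_comp]
  exact (hg.comp (measurable_eval s)).comap_le

end CadlagPath

variable {d : ℕ} {E : Type*} [MetricSpace E] [CompactSpace E] [MeasurableSpace E] [BorelSpace E]

theorem FellerProcess.op_eq_integral (P : FellerProcess (Config d E)) (t : ℝ≥0)
    (f : C(Config d E, ℝ)) (η : Config d E) :
    P.op t f η = ∫ ω, f (ω t) ∂(P.law η) := by
  have := P.isProbabilityMeasure_law η
  have h1 := P.markov_property η f 0 t zero_le
  have hle : canonicalFiltration (Config d E) 0 ≤ CadlagPath.instMeasurableSpace :=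
    (canonicalFiltration (Config d E)).le 0
  have h2 := integral_condExp (μ := P.law η) hle (f := fun ω => f (ω t))
  rw [← h2, integral_congr_ae h1, tsub_zero]
  have h3 : (fun ω : CadlagPath (Config d E) => P.op t f (ω 0)) =ᵐ[P.law η]
      fun _ => P.op t f η := by
    filter_upwards [P.start η] with ω hω
    rw [hω]
  rw [integral_congr_ae h3]
  simp

/-- Moves a shift from the configuration into the test function, so that the marginal Markov
property applies to u seen from a walker. -/
theorem TranslationInvariant.op_shift {P : FellerProcess (Config d E)}
    (hP : TranslationInvariant P) (t : ℝ≥0) (f : C(Config d E, ℝ)) (x : Fin d → ℤ)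
    (η : Config d E) : P.op t f (shift x η) = P.op t (f.comp (shift x)) η := by
  rw [P.op_eq_integral, P.op_eq_integral, ← hP x η, integral_map
    (CadlagPath.measurable_map (shift x).continuous.measurable).aemeasurable]
  · rfl
  · exact (f.continuous.measurable.comp (CadlagPath.measurable_eval t)).aestronglyMeasurable

/-! ### Couplings -/

/-- Pairs of configurations. -/
abbrev ConfigPair (d : ℕ) (E : Type*) := Config d E × Config d E

theorem integrable_eval (Q : Measure (CadlagPath (ConfigPair d E))) [IsFiniteMeasure Q]
    (f : C(ConfigPair d E, ℝ)) (t : ℝ≥0) : Integrable (fun ω => f (ω t)) Q := by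
  refine Integrable.of_bound
    (f.continuous.measurable.comp (CadlagPath.measurable_eval t)).aestronglyMeasurable ‖f‖
    (Eventually.of_forall fun ω => f.norm_coe_le_norm _)

/-- The marginal Markov property, tested against functionals of the past. -/
theorem StrongMarginalMarkov.integral_mul {S : FellerSemigroup (Config d E)}
    {π : C(ConfigPair d E, Config d E)} {Q : Measure (CadlagPath (ConfigPair d E))}
    [IsProbabilityMeasure Q] (h : StrongMarginalMarkov S π Q) {s t : ℝ≥0} (hst : s ≤ t)
    (f : C(Config d E, ℝ)) {c : CadlagPath (ConfigPair d E) → ℝ}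
    (hc : Measurable[canonicalFiltration (ConfigPair d E) s] c) {M : ℝ} (hM : ∀ ω, |c ω| ≤ M) :
    ∫ ω, c ω * f (π (ω t)) ∂Q = ∫ ω, c ω * S.op (t - s) f (π (ω s)) ∂Q := by
  have hle : canonicalFiltration (ConfigPair d E) s ≤ CadlagPath.instMeasurableSpace :=
    (canonicalFiltration (ConfigPair d E)).le s
  -- Of the strong property only constant stopping times are needed.
  have h1 := h f (fun _ => (s : WithTop ℝ≥0)) (isStoppingTime_const _ s) t
  rw [IsStoppingTime.measurableSpace_const] at h1
  have hset : {ω : CadlagPath (ConfigPair d E) | (s : WithTop ℝ≥0) ≤ t} = Set.univ :=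
    Set.eq_univ_of_forall fun ω => WithTop.coe_le_coe.2 hst
  rw [hset, Set.indicator_univ, Set.indicator_univ] at h1
  have hf : Integrable (fun ω => f (π (ω t))) Q := integrable_eval Q (f.comp π) t
  have hcm : Measurable c := hc.mono hle le_rfl
  have hcf : Integrable (fun ω => c ω * f (π (ω t))) Q :=
    hf.bdd_mul hcm.aestronglyMeasurable (Eventually.of_forall hM)
  have h2 := condExp_mul_of_stronglyMeasurable_left hc.stronglyMeasurable hcf hf
  have h3 := integral_condExp (μ := Q) hle (f := fun ω => c ω * f (π (ω t)))
  rw [← h3]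
  refine integral_congr_ae (h2.trans ?_)
  filter_upwards [h1] with ω hω
  rw [Pi.mul_apply, hω, show WithTop.untopA (s : WithTop ℝ≥0) = s from rfl]

namespace EnvironmentCoupling

variable {P : FellerProcess (Config d E)} (Q : EnvironmentCoupling P)

instance (η ξ : Config d E) : IsProbabilityMeasure (Q.law η ξ) := Q.isProbabilityMeasure_law η ξ

theorem integral_fst (f : C(Config d E, ℝ)) (t : ℝ≥0) (η ξ : Config d E) :
    ∫ ω, f (ω t).1 ∂(Q.law η ξ) = P.op t f η := by
  rw [P.op_eq_integral, ← Q.marginal_fst η ξ, integral_map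
    (CadlagPath.measurable_map measurable_fst).aemeasurable]
  · rfl
  · exact (f.continuous.measurable.comp (CadlagPath.measurable_eval t)).aestronglyMeasurable

theorem integral_snd (f : C(Config d E, ℝ)) (t : ℝ≥0) (η ξ : Config d E) :
    ∫ ω, f (ω t).2 ∂(Q.law η ξ) = P.op t f ξ := by
  rw [P.op_eq_integral, ← Q.marginal_snd η ξ, integral_map
    (CadlagPath.measurable_map measurable_snd).aemeasurable]
  · rfl
  · exact (f.continuous.measurable.comp (CadlagPath.measurable_eval t)).aestronglyMeasurable

/-- The expected distance at the origin, for the worst initial configurations. -/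
def maxDist (t : ℝ≥0) : ℝ≥0∞ :=
  ⨆ (η : Config d E) (ξ : Config d E), ∫⁻ ω, edist ((ω t).1 0) ((ω t).2 0) ∂(Q.law η ξ)

theorem measurable_edist_eval (t : ℝ≥0) (x : Fin d → ℤ) :
    Measurable fun ω : CadlagPath (ConfigPair d E) => edist ((ω t).1 x) ((ω t).2 x) := by
  have h : Continuous fun p : ConfigPair d E => edist (p.1 x) (p.2 x) := by fun_prop
  exact h.measurable.comp (CadlagPath.measurable_eval t)

/-- A shift by -x moves site x to the origin; the shifted initial pair is absorbed by the supremum.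
-/
theorem lintegral_edist_le (t : ℝ≥0) (x : Fin d → ℤ) (η ξ : Config d E) :
    ∫⁻ ω, edist ((ω t).1 x) ((ω t).2 x) ∂(Q.law η ξ) ≤ Q.maxDist t := by
  refine le_trans (le_of_eq ?_) (le_iSup_of_le (shift (-x) η) (le_iSup_of_le (shift (-x) ξ) le_rfl))
  rw [← Q.translation_invariant, lintegral_map (measurable_edist_eval t 0)
    (CadlagPath.measurable_map (ContinuousMap.continuous _).measurable)]
  refine lintegral_congr fun ω => ?_
  change _ = edist ((ω t).1 (0 - -x)) ((ω t).2 (0 - -x))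
  simp

theorem maxDist_le_one (hρ : ∀ a b : E, dist a b ≤ 1) (t : ℝ≥0) : Q.maxDist t ≤ 1 := by
  refine iSup_le fun η => iSup_le fun ξ => ?_
  have h : ∀ a b : E, edist a b ≤ 1 := fun a b => by
    rw [edist_dist]
    exact ENNReal.ofReal_le_one.2 (hρ a b)
  calc _ ≤ ∫⁻ _, 1 ∂(Q.law η ξ) := lintegral_mono fun ω => h _ _
    _ = 1 := by simp

/-- For a fixed initial pair the expected distance is right-continuous in t, by right-continuity of
the paths and dominated convergence; the criterion for suprema then applies. -/
theorem measurable_maxDist (hρ : ∀ a b : E, dist a b ≤ 1) :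
    Measurable fun t : ℝ => Q.maxDist t.toNNReal := by
  refine measurable_of_lt_eventually_nhdsGT fun t a ha => ?_
  simp only [maxDist, lt_iSup_iff] at ha
  obtain ⟨η, ξ, ha⟩ := ha
  have h1 : Tendsto (fun s : ℝ => ∫⁻ ω, edist ((ω s.toNNReal).1 0) ((ω s.toNNReal).2 0)
      ∂(Q.law η ξ)) (𝓝[>] t) (𝓝 (∫⁻ ω, edist ((ω t.toNNReal).1 0) ((ω t.toNNReal).2 0)
      ∂(Q.law η ξ))) := by
    refine tendsto_lintegral_filter_of_dominated_convergence (fun _ => 1)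
      (Eventually.of_forall fun s => measurable_edist_eval _ 0)
      (Eventually.of_forall fun s => Eventually.of_forall fun ω => ?_) (by simp)
      (Eventually.of_forall fun ω => ?_)
    · rw [edist_dist]
      exact ENNReal.ofReal_le_one.2 (hρ _ _)
    · have h2 : Continuous fun p : ConfigPair d E => edist (p.1 0) (p.2 0) := by fun_prop
      refine (h2.tendsto _).comp ?_
      rcases lt_or_ge t 0 with ht | ht
      · refine tendsto_const_nhds.congr' ?_
        filter_upwards [Ioo_mem_nhdsGT ht] with s hs
        rw [Real.toNNReal_of_nonpos ht.le, Real.toNNReal_of_nonpos hs.2.le]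
      · refine (ω.right_continuous t.toNNReal).tendsto.comp ?_
        refine tendsto_nhdsWithin_of_tendsto_nhds_of_eventually_within _ ?_ ?_
        · exact tendsto_nhdsWithin_of_tendsto_nhds (continuous_real_toNNReal.tendsto t)
        · filter_upwards [self_mem_nhdsWithin] with s hs
          exact (Real.toNNReal_lt_toNNReal_iff_of_nonneg ht).2 hs
  filter_upwards [h1.eventually_const_lt ha] with s hs
  exact hs.trans_le (le_iSup_of_le η (le_iSup_of_le ξ le_rfl))

/-- The expectation of a functional with a Lipschitz bound, at time `t` and seen from `y`. -/
theorem integral_le_of_lipschitzBound (hρ : ∀ a b : E, dist a b ≤ 1) {w : (Fin d → ℤ) → ℝ≥0}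
    {F : Config d E → Config d E → ℝ} (hF : LipschitzBound w F) (t : ℝ≥0) (y : Fin d → ℤ)
    (η ξ : Config d E) {H : CadlagPath (ConfigPair d E) → ℝ} (hH0 : ∀ ω, 0 ≤ H ω)
    (hH : ∀ ω, H ω ≤ F (shift (-y) (ω t).1) (shift (-y) (ω t).2)) :
    ∫ ω, H ω ∂(Q.law η ξ) ≤ (∑' x, (w x : ℝ)) * (Q.maxDist t).toReal := by
  set G : CadlagPath (ConfigPair d E) → ℝ≥0∞ := fun ω =>
    ∑' x, (w x : ℝ≥0∞) * edist ((ω t).1 (x + y)) ((ω t).2 (x + y)) with hG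
  have hsum : ∑' x, (w x : ℝ≥0∞) ≠ ∞ := ENNReal.tsum_coe_ne_top_iff_summable.2 hF.1
  have h1 : ∫⁻ ω, G ω ∂(Q.law η ξ) ≤ (∑' x, (w x : ℝ≥0∞)) * Q.maxDist t := by
    rw [hG, lintegral_tsum fun x => ((measurable_edist_eval t _).const_mul _).aemeasurable,
      ← ENNReal.tsum_mul_right]
    refine ENNReal.tsum_le_tsum fun x => ?_
    rw [lintegral_const_mul _ (measurable_edist_eval t _)]
    exact mul_le_mul_right (Q.lintegral_edist_le t _ η ξ) _
  have hfin : (∑' x, (w x : ℝ≥0∞)) * Q.maxDist t ≠ ∞ :=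
    ENNReal.mul_ne_top hsum (ne_top_of_le_ne_top ENNReal.one_ne_top (Q.maxDist_le_one hρ t))
  have h2 : ∀ ω, ENNReal.ofReal (H ω) ≤ G ω := by
    intro ω
    refine (ENNReal.ofReal_le_ofReal ((hH ω).trans (hF.2 _ _))).trans ?_
    rw [ENNReal.ofReal_tsum_of_nonneg (fun x => mul_nonneg (w x).coe_nonneg dist_nonneg)
      (summable_mul_dist hρ hF.1 _ _)]
    refine ENNReal.tsum_le_tsum fun x => ?_
    rw [ENNReal.ofReal_mul (w x).coe_nonneg, ← edist_dist, ENNReal.ofReal_coe_nnreal]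
    simp [shift]
  have h3 : ∫ ω, H ω ∂(Q.law η ξ) ≤ (∫⁻ ω, ENNReal.ofReal (H ω) ∂(Q.law η ξ)).toReal := by
    -- H need not be measurable: otherwise its Bochner integral is 0 and the bound is trivial.
    by_cases hi : AEStronglyMeasurable H (Q.law η ξ)
    · exact (integral_eq_lintegral_of_nonneg_ae (Eventually.of_forall hH0) hi).le
    · rw [integral_non_aestronglyMeasurable hi]
      exact ENNReal.toReal_nonneg
  refine h3.trans ((ENNReal.toReal_mono hfin ((lintegral_mono h2).trans h1)).trans_eq ?_)
  rw [ENNReal.toReal_mul, ENNReal.tsum_toReal_eq (fun x => ENNReal.coe_ne_top)]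
  simp

end EnvironmentCoupling

end RWDRE

namespace RWDRE

/-! ### Balls in the lattice -/

/-- The ball of radius `R` in `ℤ^d`, for the supremum norm. -/
def box (d : ℕ) (R : ℝ) : Finset (Fin d → ℤ) := Finset.Icc (fun _ => -⌊R⌋) (fun _ => ⌊R⌋)

theorem mem_box {d : ℕ} {R : ℝ} (hR : 0 ≤ R) {x : Fin d → ℤ} : x ∈ box d R ↔ ‖x‖ ≤ R := by
  rw [box, Finset.mem_Icc, pi_norm_le_iff_of_nonneg hR, Pi.le_def, Pi.le_def, ← forall_and]
  refine forall_congr' fun i => ?_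
  rw [Int.norm_eq_abs, abs_le, neg_le, Int.le_floor, Int.le_floor, Int.cast_neg, neg_le]

theorem card_box_le {d : ℕ} {R : ℝ} (hR : 0 ≤ R) : ((box d R).card : ℝ) ≤ (2 * R + 1) ^ d := by
  have h0 : 0 ≤ ⌊R⌋ := Int.floor_nonneg.2 hR
  rw [box, Pi.card_Icc]
  simp only [Int.card_Icc, Finset.prod_const, Finset.card_univ, Fintype.card_fin]
  push_cast
  refine pow_le_pow_left₀ (by positivity) ?_ d
  have h1 : (((⌊R⌋ + 1 - -⌊R⌋).toNat : ℤ) : ℝ) = 2 * ⌊R⌋ + 1 := by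
    rw [Int.toNat_of_nonneg (by omega)]
    push_cast
    ring
  have h2 := Int.floor_le R
  have h3 : (((⌊R⌋ + 1 - -⌊R⌋).toNat : ℕ) : ℝ) = 2 * ⌊R⌋ + 1 := by exact_mod_cast h1
  rw [h3]
  linarith

/-! ### One step of a coupled random walk -/

section Step

variable {Z : Type*}

/-- x + hΣ a(v - x) is an average with weight 1 - hΣ a at x and h a_z at v_z. Removing the smaller
weights s and h m_z leaves nonnegative weights of total mass 1 - s - hΣ m, on values at most hi. The
bound lo only serves summability. -/
theorem residual_le {a m v : Z → ℝ} {x lo hi s h : ℝ} (ha : Summable a) (hm0 : ∀ z, 0 ≤ m z)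
    (hma : ∀ z, m z ≤ a z) (hh : 0 ≤ h) (hs : s ≤ 1 - h * ∑' z, a z) (hx : x ≤ hi)
    (hv : ∀ z, v z ≤ hi) (hv' : ∀ z, lo ≤ v z) :
    x + h * ∑' z, a z * (v z - x) - s * x - h * ∑' z, m z * v z ≤
      (1 - s - h * ∑' z, m z) * hi := by
  have ha0 : ∀ z, 0 ≤ a z := fun z => (hm0 z).trans (hma z)
  have hms : Summable m := Summable.of_nonneg_of_le hm0 hma ha
  have hbd : ∀ z, |v z| ≤ max |lo| |hi| := fun z => abs_le_max_abs_abs (hv' z) (hv z)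
  have hav : ∀ b : Z → ℝ, (∀ z, 0 ≤ b z) → Summable b → Summable fun z => b z * v z := by
    intro b hb0 hb
    refine Summable.of_norm_bounded (hb.mul_right (max |lo| |hi|)) fun z => ?_
    rw [norm_mul, Real.norm_of_nonneg (hb0 z)]
    exact mul_le_mul_of_nonneg_left (hbd z) (hb0 z)
  have h1 : ∑' z, a z * (v z - x) = ∑' z, a z * v z - (∑' z, a z) * x := by
    rw [← tsum_mul_right, ← (hav a ha0 ha).tsum_sub (ha.mul_right x)]
    simp only [mul_sub]
  have h2 : ∑' z, a z * v z - ∑' z, m z * v z ≤ (∑' z, a z - ∑' z, m z) * hi := by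
    rw [← (hav a ha0 ha).tsum_sub (hav m hm0 hms), ← ha.tsum_sub hms, ← tsum_mul_right]
    refine ((hav a ha0 ha).sub (hav m hm0 hms)).tsum_le_tsum (fun z => ?_)
      ((ha.sub hms).mul_right hi)
    rw [← sub_mul]
    exact mul_le_mul_of_nonneg_left (hv z) (sub_nonneg.2 (hma z))
  have h3 := mul_le_mul_of_nonneg_left h2 hh
  have h4 := mul_le_mul_of_nonneg_left hx (by linarith : 0 ≤ 1 - h * ∑' z, a z - s)
  rw [h1]
  linarith

theorem le_residual {a m v : Z → ℝ} {x lo hi s h : ℝ} (ha : Summable a) (hm0 : ∀ z, 0 ≤ m z)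
    (hma : ∀ z, m z ≤ a z) (hh : 0 ≤ h) (hs : s ≤ 1 - h * ∑' z, a z) (hx : lo ≤ x)
    (hv : ∀ z, v z ≤ hi) (hv' : ∀ z, lo ≤ v z) :
    (1 - s - h * ∑' z, m z) * lo ≤
      x + h * ∑' z, a z * (v z - x) - s * x - h * ∑' z, m z * v z := by
  have h1 := residual_le (x := -x) (v := fun z => -v z) (lo := -hi) (hi := -lo) ha hm0 hma hh hs
    (neg_le_neg hx) (fun z => neg_le_neg (hv' z)) (fun z => neg_le_neg (hv z))
  have e1 : ∑' z, a z * (-v z - -x) = -∑' z, a z * (v z - x) := by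
    rw [← tsum_neg]
    congr 1
    funext z
    ring
  have e2 : ∑' z, m z * -v z = -∑' z, m z * v z := by
    rw [← tsum_neg]
    congr 1
    funext z
    ring
  rw [e1, e2] at h1
  linarith

variable [AddCommGroup Z] [DecidableEq Z]

theorem sum_mul_step {B B' : Finset Z} (hB : B ⊆ B') {q s G : Z → ℝ} (m : Z → Z → ℝ) (h : ℝ)
    (hq : ∀ x, x ∉ B → q x = 0) :
    ∑ y ∈ B', (q y * s y + h * ∑ x ∈ B, q x * m x (y - x)) * G y =
      ∑ x ∈ B, q x * (s x * G x + h * ∑' z, (if x + z ∈ B' then m x z else 0) * G (x + z)) := by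
  have h1 : ∀ x, ∑' z, (if x + z ∈ B' then m x z else 0) * G (x + z) =
      ∑ y ∈ B', m x (y - x) * G y := by
    intro x
    have e := (Equiv.addLeft x).tsum_eq (fun y => (if y ∈ B' then m x (y - x) else 0) * G y)
    simp only [Equiv.coe_addLeft, add_sub_cancel_left] at e
    rw [e, tsum_eq_sum (s := B') (fun y hy => by simp [hy])]
    exact Finset.sum_congr rfl fun y hy => by simp [hy]
  have h2 : ∑ y ∈ B', q y * s y * G y = ∑ x ∈ B, q x * (s x * G x) := by
    rw [← Finset.sum_subset hB (fun y _ hy => by rw [hq y hy]; ring)]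
    exact Finset.sum_congr rfl fun y _ => by ring
  simp only [h1, mul_add, add_mul, Finset.sum_add_distrib]
  congr 1
  · simp only [Finset.mul_sum, Finset.sum_mul]
    rw [Finset.sum_comm]
    exact Finset.sum_congr rfl fun x _ => Finset.sum_congr rfl fun y _ => by ring

end Step

/-! ### The coupled walk -/

section Couple

variable {d : ℕ} {E : Type*} [MetricSpace E] [CompactSpace E] (α : JumpRates d E)

theorem shift_shift (x y : Fin d → ℤ) (η : Config d E) :
    shift (-x) (shift (-y) η) = shift (-(y + x)) η := by
  funext w
  change η (w - -x - -y) = η (w - -(y + x))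
  congr 1
  abel

/-- The rate at which both walkers at `x` jump by `z`. -/
def meet (p : ConfigPair d E) (x z : Fin d → ℤ) : ℝ :=
  min (α.rate (shift (-x) p.1) z : ℝ) (α.rate (shift (-x) p.2) z)

/-- The rate at which some walker at `x` jumps by `z`. -/
def join (p : ConfigPair d E) (x z : Fin d → ℤ) : ℝ :=
  max (α.rate (shift (-x) p.1) z : ℝ) (α.rate (shift (-x) p.2) z)

/-- The total rate at which exactly one of two walkers at `x` jumps. -/
def split (p : ConfigPair d E) (x : Fin d → ℤ) : ℝ :=
  ∑' z, |(α.rate (shift (-x) p.1) z : ℝ) - α.rate (shift (-x) p.2) z|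

/-- The sub-probability that two walkers are together at `y` at step `k`, and have stayed together
and in the balls `B` so far. -/
def couple (h : ℝ) (B : ℕ → Finset (Fin d → ℤ)) (ζ : ℕ → ConfigPair d E) :
    ℕ → (Fin d → ℤ) → ℝ
  | 0, y => if y = 0 then 1 else 0
  | k + 1, y => if y ∈ B (k + 1) then couple h B ζ k y * (1 - h * ∑' z, join α (ζ k) y z) +
      h * ∑ x ∈ B k, couple h B ζ k x * meet α (ζ k) x (y - x) else 0

variable {α}

theorem meet_nonneg (p : ConfigPair d E) (x z : Fin d → ℤ) : 0 ≤ meet α p x z :=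
  le_min (NNReal.coe_nonneg _) (NNReal.coe_nonneg _)

theorem meet_le_join (p : ConfigPair d E) (x z : Fin d → ℤ) : meet α p x z ≤ join α p x z :=
  min_le_max

theorem join_nonneg (p : ConfigPair d E) (x z : Fin d → ℤ) : 0 ≤ join α p x z :=
  (meet_nonneg p x z).trans (meet_le_join p x z)

theorem summable_join (p : ConfigPair d E) (x : Fin d → ℤ) : Summable (join α p x) :=
  Summable.of_nonneg_of_le (join_nonneg p x)
    (fun _ => max_le_add_of_nonneg (NNReal.coe_nonneg _) (NNReal.coe_nonneg _))
    ((α.summable_rate _).add (α.summable_rate _))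

theorem summable_meet (p : ConfigPair d E) (x : Fin d → ℤ) : Summable (meet α p x) :=
  Summable.of_nonneg_of_le (meet_nonneg p x) (meet_le_join p x) (summable_join p x)

theorem split_eq (p : ConfigPair d E) (x : Fin d → ℤ) :
    split α p x = ∑' z, join α p x z - ∑' z, meet α p x z := by
  rw [← (summable_join p x).tsum_sub (summable_meet p x), split]
  congr 1
  funext z
  exact (max_sub_min_eq_abs' _ _).symm

variable {h : ℝ} {B : ℕ → Finset (Fin d → ℤ)} {ζ : ℕ → ConfigPair d E}

theorem couple_eq_zero (h0 : 0 ∈ B 0) {k : ℕ} {y : Fin d → ℤ} (hy : y ∉ B k) :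
    couple α h B ζ k y = 0 := by
  cases k with
  | zero =>
    rw [couple, if_neg]
    rintro rfl
    exact hy h0
  | succ k => rw [couple, if_neg hy]

theorem sum_couple_zero (h0 : 0 ∈ B 0) (G : (Fin d → ℤ) → ℝ) :
    ∑ y ∈ B 0, couple α h B ζ 0 y * G y = G 0 := by
  simp [couple, h0]

/-- Dual form of the recursion: the mass transport is rewritten as an operator on the test function
G, after the substitution y = x + z. -/
theorem sum_couple_succ (h0 : 0 ∈ B 0) (hB : Monotone B) (k : ℕ) (G : (Fin d → ℤ) → ℝ) :
    ∑ y ∈ B (k + 1), couple α h B ζ (k + 1) y * G y =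
      ∑ x ∈ B k, couple α h B ζ k x * ((1 - h * ∑' z, join α (ζ k) x z) * G x +
        h * ∑' z, (if x + z ∈ B (k + 1) then meet α (ζ k) x z else 0) * G (x + z)) := by
  rw [← sum_mul_step (hB k.le_succ) (meet α (ζ k)) h fun x hx => couple_eq_zero h0 hx]
  exact Finset.sum_congr rfl fun y hy => by rw [couple, if_pos hy]

variable {c : ℝ} (hh : 0 ≤ h) (hc : ∀ p x, h * ∑' z, join α p x z ≤ 1)

include hh hc in
theorem couple_nonneg (k : ℕ) (y : Fin d → ℤ) : 0 ≤ couple α h B ζ k y := by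
  induction k generalizing y with
  | zero => rw [couple]; split_ifs <;> norm_num
  | succ k ih =>
    rw [couple]
    split_ifs
    · exact add_nonneg (mul_nonneg (ih y) (sub_nonneg.2 (hc _ _)))
        (mul_nonneg hh (Finset.sum_nonneg fun x _ => mul_nonneg (ih x) (meet_nonneg _ _ _)))
    · exact le_rfl

theorem restrict_meet_nonneg (p : ConfigPair d E) (x : Fin d → ℤ) (k : ℕ) (z : Fin d → ℤ) :
    0 ≤ (if x + z ∈ B k then meet α p x z else 0) := by
  split_ifs
  exacts [meet_nonneg _ _ _, le_rfl]

theorem restrict_meet_le (p : ConfigPair d E) (x : Fin d → ℤ) (k : ℕ) (z : Fin d → ℤ) :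
    (if x + z ∈ B k then meet α p x z else 0) ≤ meet α p x z := by
  split_ifs
  exacts [le_rfl, meet_nonneg _ _ _]

theorem summable_restrict_meet (p : ConfigPair d E) (x : Fin d → ℤ) (k : ℕ) :
    Summable fun z => if x + z ∈ B k then meet α p x z else 0 :=
  Summable.of_nonneg_of_le (restrict_meet_nonneg p x k) (restrict_meet_le p x k)
    (summable_meet p x)

variable (h0 : 0 ∈ B 0) (hB : Monotone B)

include hh hc h0 hB in
-- Mass leaves x at the rate `join` but arrives elsewhere only at the smaller rate `meet`,
-- restricted to the ball.
theorem sum_couple_succ_le (k : ℕ) :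
    ∑ y ∈ B (k + 1), couple α h B ζ (k + 1) y ≤ ∑ y ∈ B k, couple α h B ζ k y := by
  have e := sum_couple_succ (α := α) (h := h) (ζ := ζ) h0 hB k (fun _ => 1)
  simp only [mul_one] at e
  rw [e]
  refine Finset.sum_le_sum fun x _ => mul_le_of_le_one_right (couple_nonneg hh hc k x) ?_
  have h1 := (summable_restrict_meet (B := B) (ζ k) x (k + 1)).tsum_le_tsum
    (fun z => (restrict_meet_le (ζ k) x (k + 1) z).trans (meet_le_join (α := α) (ζ k) x z))
    (summable_join (ζ k) x)
  have h2 := mul_le_mul_of_nonneg_left h1 hh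
  linarith

include hh hc h0 hB in
theorem sum_couple_le_one (k : ℕ) : ∑ y ∈ B k, couple α h B ζ k y ≤ 1 := by
  induction k with
  | zero => simpa using (sum_couple_zero (α := α) (h := h) (ζ := ζ) h0 (fun _ => 1)).le
  | succ k ih => exact (sum_couple_succ_le hh hc h0 hB k).trans ih

include hh hc h0 hB in
theorem couple_le_one (k : ℕ) (y : Fin d → ℤ) : couple α h B ζ k y ≤ 1 := by
  by_cases hy : y ∈ B k
  · exact (Finset.single_le_sum (fun x _ => couple_nonneg hh hc k x) hy).trans
      (sum_couple_le_one (α := α) (ζ := ζ) hh hc h0 hB k)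
  · rw [couple_eq_zero h0 hy]; exact zero_le_one

include hh hc h0 hB in
/-- The difference of the evolutions of the two walkers is carried by the coupled walk, up to the
mass that is lost. -/
theorem sum_couple_mul_sub_le (k : ℕ) {v : C(Config d E, ℝ)} {lo O : ℝ} (hlo : ∀ η, lo ≤ v η)
    (hhi : ∀ η, v η ≤ lo + O) :
    ∑ x ∈ B k, couple α h B ζ k x * ((v + h • α.jump v) (shift (-x) (ζ k).1) -
        (v + h • α.jump v) (shift (-x) (ζ k).2)) ≤
      ∑ y ∈ B (k + 1), couple α h B ζ (k + 1) y *
        (v (shift (-y) (ζ k).1) - v (shift (-y) (ζ k).2)) +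
      (∑ x ∈ B k, couple α h B ζ k x - ∑ y ∈ B (k + 1), couple α h B ζ (k + 1) y) * O := by
  have e := sum_couple_succ (α := α) (h := h) (ζ := ζ) h0 hB k (fun _ => 1)
  simp only [mul_one] at e
  rw [e, sum_couple_succ h0 hB k, ← Finset.sum_sub_distrib, Finset.sum_mul,
    ← Finset.sum_add_distrib]
  refine Finset.sum_le_sum fun x _ => ?_
  set q := couple α h B ζ k x
  set p := ζ k
  set s := 1 - h * ∑' z, join α p x z with hs
  set m : (Fin d → ℤ) → ℝ := fun z => if x + z ∈ B (k + 1) then meet α p x z else 0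
  have hm0 : ∀ z, 0 ≤ m z := restrict_meet_nonneg p x (k + 1)
  have hmle : ∀ z, m z ≤ meet α p x z := restrict_meet_le p x (k + 1)
  have hms : Summable m := summable_restrict_meet p x (k + 1)
  have hs1 : s ≤ 1 - h * ∑' z, (α.rate (shift (-x) p.1) z : ℝ) := by
    have h1 : ∑' z, (α.rate (shift (-x) p.1) z : ℝ) ≤ ∑' z, join α p x z :=
      (α.summable_rate _).tsum_le_tsum (fun z => le_max_left _ _) (summable_join p x)
    linarith [mul_le_mul_of_nonneg_left h1 hh]
  have hs2 : s ≤ 1 - h * ∑' z, (α.rate (shift (-x) p.2) z : ℝ) := by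
    have h1 : ∑' z, (α.rate (shift (-x) p.2) z : ℝ) ≤ ∑' z, join α p x z :=
      (α.summable_rate _).tsum_le_tsum (fun z => le_max_right _ _) (summable_join p x)
    linarith [mul_le_mul_of_nonneg_left h1 hh]
  -- The part of each walker's step not matched by the coupled walk has the same mass in both
  -- environments. Its values are at most lo + O in the first and at least lo in the second, so the
  -- difference is at most the lost mass times O.
  have r1 := residual_le (v := fun z => v (shift (-(x + z)) p.1)) (α.summable_rate _) hm0
    (fun z => (hmle z).trans (min_le_left _ _)) hh hs1 (hhi (shift (-x) p.1))
    (fun z => hhi _) (fun z => hlo _)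
  have r2 := le_residual (v := fun z => v (shift (-(x + z)) p.2)) (α.summable_rate _) hm0
    (fun z => (hmle z).trans (min_le_right _ _)) hh hs2 (hlo (shift (-x) p.2))
    (fun z => hhi _) (fun z => hlo _)
  have hb : ∀ η : Config d E, Summable fun z => m z * v (shift (-(x + z)) η) := fun η => by
    refine Summable.of_norm_bounded (hms.mul_right ‖v‖) fun z => ?_
    rw [norm_mul, Real.norm_of_nonneg (hm0 z)]
    exact mul_le_mul_of_nonneg_left (v.norm_coe_le_norm _) (hm0 z)
  have e2 : ∑' z, m z * (v (shift (-(x + z)) p.1) - v (shift (-(x + z)) p.2)) =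
      ∑' z, m z * v (shift (-(x + z)) p.1) - ∑' z, m z * v (shift (-(x + z)) p.2) := by
    rw [← (hb p.1).tsum_sub (hb p.2)]
    simp only [mul_sub]
  rw [e2]
  have hq : 0 ≤ q := couple_nonneg hh hc k x
  simp only [ContinuousMap.add_apply, ContinuousMap.smul_apply, smul_eq_mul, α.jump_apply,
    shift_shift]
  have := mul_le_mul_of_nonneg_left (sub_le_sub r1 r2) hq
  linarith

variable {U : ℝ → ℝ} {γ : ℝ} {l : (Fin d → ℤ) → ℝ≥0}

include hh hc in
/-- The coupled walk loses mass at most at the rate at which the walkers split, up to the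
compensation by the survival function `U`. -/
theorem sum_couple_mul_survival_le (hl : ∀ η z, α.rate η z ≤ l z)
    (hls : Summable l) (hγ : 0 < γ) (hU : Antitone U) (hU0 : ∀ u, 0 ≤ U u)
    (hU1 : ∀ u, U u ≤ 1) (hneg : ∀ u, u < 0 → U u = 1)
    (hstep : ∀ y h, 0 ≤ h → γ * h ≤ y →
      U y + h * ∑' z, l z * (U (y - ‖z‖) - U y) ≤ U (y - γ * h))
    (hBk : ∀ k, B k = box d (γ * (1 + k * h))) (k : ℕ) :
    ∑ x ∈ B k, couple α h B ζ k x * (1 - U (γ * (1 + k * h) - ‖x‖) - h * split α (ζ k) x) ≤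
      ∑ y ∈ B (k + 1), couple α h B ζ (k + 1) y *
        (1 - U (γ * (1 + (k + 1 : ℕ) * h) - ‖y‖)) := by
  have hR : ∀ k : ℕ, 0 ≤ γ * (1 + k * h) := fun k => by positivity
  have h0 : 0 ∈ B 0 := by rw [hBk, mem_box (hR 0)]; simpa using hR 0
  have hRm : Monotone fun k : ℕ => γ * (1 + k * h) := fun a b hab => by
    have : (a : ℝ) ≤ b := by exact_mod_cast hab
    simp only
    gcongr
  have hB : Monotone B := fun a b hab x hx => by
    rw [hBk, mem_box (hR _)] at hx ⊢
    exact hx.trans (hRm hab)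
  rw [sum_couple_succ h0 hB k]
  refine Finset.sum_le_sum fun x hx => mul_le_mul_of_nonneg_left ?_ (couple_nonneg hh hc k x)
  rw [hBk, mem_box (hR k)] at hx
  set p := ζ k
  set y := γ * (1 + (k + 1 : ℕ) * h) - ‖x‖ with hy
  -- The ball grows by γh per step, so the old distance to its complement is y - γh, where `hstep`
  -- bounds U from below.
  have ey : γ * (1 + k * h) - ‖x‖ = y - γ * h := by
    rw [hy]; push_cast; ring
  have hy0 : γ * h ≤ y := by linarith
  have hst := hstep y h hh hy0
  rw [ey]
  -- Outside the ball U = 1 and the weight 1 - U vanishes: killing the walk there costs nothing.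
  have e1 : ∀ z, (if x + z ∈ B (k + 1) then meet α p x z else 0) *
      (1 - U (γ * (1 + (k + 1 : ℕ) * h) - ‖x + z‖)) =
      meet α p x z * (1 - U (γ * (1 + (k + 1 : ℕ) * h) - ‖x + z‖)) := by
    intro z
    split_ifs with hz
    · rfl
    · rw [hBk, mem_box (hR _), not_le] at hz
      rw [hneg _ (sub_neg.2 hz)]
      ring
  simp only [e1]
  have hsU : Summable fun z => meet α p x z * (1 - U (γ * (1 + (k + 1 : ℕ) * h) - ‖x + z‖)) := by
    refine Summable.of_nonneg_of_le (fun z => mul_nonneg (meet_nonneg _ _ _)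
      (sub_nonneg.2 (hU1 _))) (fun z => mul_le_of_le_one_right (meet_nonneg _ _ _) ?_)
      (summable_meet p x)
    linarith [hU0 (γ * (1 + (k + 1 : ℕ) * h) - ‖x + z‖)]
  have hsl : Summable fun z => (l z : ℝ) * (U (y - ‖z‖) - U y) := by
    refine Summable.of_nonneg_of_le (fun z => mul_nonneg (l z).coe_nonneg
      (sub_nonneg.2 (hU (by linarith [norm_nonneg z]))))
      (fun z => mul_le_of_le_one_right (l z).coe_nonneg ?_) (NNReal.summable_coe.2 hls)
    linarith [hU0 y, hU1 (y - ‖z‖)]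
  have h2 : (∑' z, meet α p x z) * (1 - U y) - ∑' z, (l z : ℝ) * (U (y - ‖z‖) - U y) ≤
      ∑' z, meet α p x z * (1 - U (γ * (1 + (k + 1 : ℕ) * h) - ‖x + z‖)) := by
    rw [← tsum_mul_right, ← ((summable_meet p x).mul_right _).tsum_sub hsl]
    refine (((summable_meet p x).mul_right _).sub hsl).tsum_le_tsum (fun z => ?_) hsU
    have h3 : U (γ * (1 + (k + 1 : ℕ) * h) - ‖x + z‖) ≤ U (y - ‖z‖) :=
      hU (by linarith [norm_add_le x z])
    have h4 : 0 ≤ U (y - ‖z‖) - U y := sub_nonneg.2 (hU (by linarith [norm_nonneg z]))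
    have h5 : meet α p x z ≤ l z := (min_le_left _ _).trans (hl _ z)
    have h6 := mul_le_mul_of_nonneg_right h5 h4
    have h7 := mul_le_mul_of_nonneg_left h3 (meet_nonneg (α := α) p x z)
    linarith
  have h3 := mul_le_mul_of_nonneg_left h2 hh
  rw [split_eq]
  have h4 : 0 ≤ ∑' z, join α p x z - ∑' z, meet α p x z := by
    rw [← split_eq]; exact tsum_nonneg fun z => abs_nonneg _
  have h5 := mul_nonneg (mul_nonneg hh h4) (hU0 y)
  linarith

end Couple

end RWDRE

namespace RWDRE

variable {d : ℕ} {E : Type*} [MetricSpace E] [CompactSpace E] [Nonempty E] [MeasurableSpace E]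
  [BorelSpace E]

/-! ### Expectations along the coupled walk -/

theorem continuous_meet (α : JumpRates d E) (x z : Fin d → ℤ) :
    Continuous fun p : ConfigPair d E => meet α p x z := by
  have h := NNReal.continuous_coe.comp ((α.continuous_rate z).comp (shift (-x)).continuous)
  exact (h.comp continuous_fst).min (h.comp continuous_snd)

theorem continuous_tsum_join (α : JumpRates d E) (x : Fin d → ℤ) :
    Continuous fun p : ConfigPair d E => ∑' z, join α p x z := by
  obtain ⟨l, hl, hls, -⟩ := α.exists_bound
  refine continuous_tsum (u := fun z => (l z : ℝ)) (fun z => ?_) (NNReal.summable_coe.2 hls)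
    fun z p => ?_
  · have h := NNReal.continuous_coe.comp ((α.continuous_rate z).comp (shift (-x)).continuous)
    exact (h.comp continuous_fst).max (h.comp continuous_snd)
  · rw [Real.norm_of_nonneg (join_nonneg p x z)]
    exact max_le (hl _ z) (hl _ z)

/-- Step k uses the environments only at the times T_0, …, T_{k-1}. This predictability allows the
Markov property from T_k to T_{k+1} to be tested against `couple` at step k + 1. -/
theorem measurable_couple (α : JumpRates d E) (h : ℝ) (B : ℕ → Finset (Fin d → ℤ)) {T : ℕ → ℝ≥0}
    {t : ℝ≥0} {k : ℕ} (ht : ∀ j < k, T j ≤ t) (y : Fin d → ℤ) :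
    Measurable[canonicalFiltration (ConfigPair d E) t]
      fun ω : CadlagPath (ConfigPair d E) => couple α h B (fun j => ω (T j)) k y := by
  induction k generalizing y with
  | zero => simp only [couple]; exact measurable_const
  | succ k ih =>
    simp only [couple]
    split_ifs
    · have hω := CadlagPath.measurable_eval_canonicalFiltration (X := ConfigPair d E)
        (ht k k.lt_succ_self)
      have ih' := ih fun j hj => ht j (hj.trans k.lt_succ_self)
      have h1 := (continuous_tsum_join α y).measurable.comp hω
      have h2 : Measurable[canonicalFiltration (ConfigPair d E) t] fun ω =>
          ∑ x ∈ B k, couple α h B (fun j => ω (T j)) k x * meet α (ω (T k)) x (y - x) :=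
        Finset.measurable_fun_sum _ fun x _ =>
          (ih' x).mul ((continuous_meet α x (y - x)).measurable.comp hω)
      exact ((ih' y).mul ((h1.const_mul h).const_sub 1)).add (h2.const_mul h)
    · exact measurable_const

section Expectation

variable {P : FellerProcess (Config d E)} (Q : EnvironmentCoupling P) (α : JumpRates d E) (h : ℝ)
  (B : ℕ → Finset (Fin d → ℤ)) (T : ℕ → ℝ≥0)

/-- The probability that the walkers are together at step `k`. -/
def mass (η ξ : Config d E) (k : ℕ) : ℝ :=
  ∫ ω, ∑ x ∈ B k, couple α h B (fun j => ω (T j)) k x ∂(Q.law η ξ)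

/-- The expected difference of `u` at the two environments, seen from the walkers at step `k`, on
the event that these are together. -/
def gap (u : C(Config d E, ℝ)) (η ξ : Config d E) (k : ℕ) : ℝ :=
  ∫ ω, ∑ x ∈ B k, couple α h B (fun j => ω (T j)) k x *
    (u (shift (-x) (ω (T k)).1) - u (shift (-x) (ω (T k)).2)) ∂(Q.law η ξ)

variable {α h B T} (hh : 0 ≤ h) (hc : ∀ p x, h * ∑' z, join α p x z ≤ 1) (h0 : 0 ∈ B 0)
  (hB : Monotone B)

include hh hc h0 hB in
theorem integrable_couple (η ξ : Config d E) (k : ℕ) (y : Fin d → ℤ) :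
    Integrable (fun ω => couple α h B (fun j => ω (T j)) k y) (Q.law η ξ) := by
  refine Integrable.of_bound (C := 1) ?_ (Eventually.of_forall fun ω => ?_)
  · have h1 := measurable_couple α h B (T := T) (t := (Finset.range k).sup T) (k := k)
      (fun j hj => Finset.le_sup (Finset.mem_range.2 hj)) y
    exact (h1.mono ((canonicalFiltration _).le _) le_rfl).aestronglyMeasurable
  · rw [Real.norm_of_nonneg (couple_nonneg hh hc k y)]
    exact couple_le_one hh hc h0 hB k y

include hh hc h0 hB in
theorem integrable_couple_mul (f : C(ConfigPair d E, ℝ)) (t : ℝ≥0) (η ξ : Config d E) (k : ℕ)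
    (y : Fin d → ℤ) :
    Integrable (fun ω => couple α h B (fun j => ω (T j)) k y * f (ω t)) (Q.law η ξ) :=
  (integrable_couple Q hh hc h0 hB η ξ k y).mul_bdd (c := ‖f‖)
    (integrable_eval (Q.law η ξ) f t).aestronglyMeasurable
    (Eventually.of_forall fun _ => f.norm_coe_le_norm _)

/-- The difference of `u` at the two configurations of a pair, seen from `y`. -/
def pairDiff (u : C(Config d E, ℝ)) (y : Fin d → ℤ) : C(ConfigPair d E, ℝ) :=
  (u.comp (shift (-y))).comp ContinuousMap.fst - (u.comp (shift (-y))).comp ContinuousMap.snd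

include hh hc h0 hB in
theorem integrable_couple_mul_sub (u : C(Config d E, ℝ)) (t : ℝ≥0) (η ξ : Config d E) (k : ℕ)
    (y : Fin d → ℤ) :
    Integrable (fun ω => couple α h B (fun j => ω (T j)) k y *
      (u (shift (-y) (ω t).1) - u (shift (-y) (ω t).2))) (Q.law η ξ) :=
  integrable_couple_mul Q hh hc h0 hB (pairDiff u y) t η ξ k y

include hh hc h0 hB in
theorem integrable_sum_couple_mul (u : C(Config d E, ℝ)) (t : ℝ≥0) (η ξ : Config d E) (k : ℕ) :
    Integrable (fun ω => ∑ x ∈ B k, couple α h B (fun j => ω (T j)) k x *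
      (u (shift (-x) (ω t).1) - u (shift (-x) (ω t).2))) (Q.law η ξ) :=
  integrable_finsetSum _ fun x _ => integrable_couple_mul_sub Q hh hc h0 hB u t η ξ k x

include hh hc h0 hB in
theorem integrable_sum_couple (η ξ : Config d E) (k : ℕ) :
    Integrable (fun ω => ∑ x ∈ B k, couple α h B (fun j => ω (T j)) k x) (Q.law η ξ) :=
  integrable_finsetSum _ fun x _ => integrable_couple Q hh hc h0 hB η ξ k x

include h0 in
theorem mass_zero (η ξ : Config d E) : mass Q α h B T η ξ 0 = 1 := by
  have e : ∀ ω : CadlagPath (ConfigPair d E),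
      ∑ x ∈ B 0, couple α h B (fun j => ω (T j)) 0 x = 1 := fun ω => by
    simpa using sum_couple_zero (α := α) (h := h) (ζ := fun j => ω (T j)) h0 fun _ => 1
  simp [mass, e]

include h0 in
-- The walk starts at the origin with mass one, so only the two marginals of the coupling at time
-- T_0 enter.
theorem gap_zero (u : C(Config d E, ℝ)) (η ξ : Config d E) :
    gap Q α h B T u η ξ 0 = P.op (T 0) u η - P.op (T 0) u ξ := by
  have e : ∀ ω : CadlagPath (ConfigPair d E),
      ∑ x ∈ B 0, couple α h B (fun j => ω (T j)) 0 x *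
        (u (shift (-x) (ω (T 0)).1) - u (shift (-x) (ω (T 0)).2)) =
      u (ω (T 0)).1 - u (ω (T 0)).2 := fun ω => by
    rw [sum_couple_zero h0 (ζ := fun j => ω (T j)) fun x =>
      u (shift (-x) (ω (T 0)).1) - u (shift (-x) (ω (T 0)).2)]
    have : ∀ ζ : Config d E, shift (-0) ζ = ζ := fun ζ => by
      funext y
      change ζ (y - -0) = ζ y
      simp
    simp only [this]
  simp only [gap, e]
  rw [← Q.integral_fst u (T 0) η ξ, ← Q.integral_snd u (T 0) η ξ]
  exact integral_sub (integrable_eval _ (u.comp ContinuousMap.fst) _)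
    (integrable_eval _ (u.comp ContinuousMap.snd) _)

include hh hc h0 hB in
theorem gap_le {u : C(Config d E, ℝ)} {lo O : ℝ} (hlo : ∀ η, lo ≤ u η) (hhi : ∀ η, u η ≤ lo + O)
    (η ξ : Config d E) (k : ℕ) : gap Q α h B T u η ξ k ≤ O := by
  have hO : 0 ≤ O := by linarith [hlo η, hhi η]
  calc gap Q α h B T u η ξ k ≤ ∫ _, O ∂(Q.law η ξ) := by
        refine integral_mono (integrable_sum_couple_mul Q hh hc h0 hB u _ η ξ k)
          (integrable_const _) fun ω => ?_
        calc _ ≤ ∑ x ∈ B k, couple α h B (fun j => ω (T j)) k x * O :=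
              Finset.sum_le_sum fun x _ => mul_le_mul_of_nonneg_left
                (by linarith [hlo (shift (-x) (ω (T k)).2), hhi (shift (-x) (ω (T k)).1)])
                (couple_nonneg hh hc k x)
          _ ≤ O := by
              rw [← Finset.sum_mul]
              exact mul_le_of_le_one_left hO (sum_couple_le_one hh hc h0 hB k)
    _ = O := by simp

include hh hc h0 hB in
-- Each coordinate is Markov with respect to the joint past, which determines `couple` at step k + 1
-- by time T_k. The two coordinates are treated separately; the pair itself need not be Markov.
theorem integral_couple_mul_op (hP : TranslationInvariant P) (u : C(Config d E, ℝ))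
    (η ξ : Config d E) (hT : Monotone T) (k : ℕ) :
    ∫ ω, ∑ y ∈ B (k + 1), couple α h B (fun j => ω (T j)) (k + 1) y *
      (P.op (T (k + 1) - T k) u (shift (-y) (ω (T k)).1) -
        P.op (T (k + 1) - T k) u (shift (-y) (ω (T k)).2)) ∂(Q.law η ξ) =
      gap Q α h B T u η ξ (k + 1) := by
  rw [gap, integral_finsetSum _ fun y _ => integrable_couple_mul_sub Q (T := T) hh hc h0 hB
      (P.op (T (k + 1) - T k) u) (T k) η ξ (k + 1) y,
    integral_finsetSum _ fun y _ => integrable_couple_mul_sub Q (T := T) hh hc h0 hB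
      u (T (k + 1)) η ξ (k + 1) y]
  refine Finset.sum_congr rfl fun y _ => ?_
  have hm := measurable_couple α h B (T := T) (t := T k) (k := k + 1)
    (fun j hj => hT (Nat.lt_succ_iff.1 hj)) y
  have hM : ∀ ω : CadlagPath (ConfigPair d E),
      |couple α h B (fun j => ω (T j)) (k + 1) y| ≤ 1 := fun ω => by
    rw [abs_of_nonneg (couple_nonneg hh hc _ y)]
    exact couple_le_one hh hc h0 hB _ y
  have e1 := (Q.strongMarkov_fst η ξ).integral_mul (hT k.le_succ) (u.comp (shift (-y))) hm hM
  have e2 := (Q.strongMarkov_snd η ξ).integral_mul (hT k.le_succ) (u.comp (shift (-y))) hm hM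
  have i : ∀ (f : C(ConfigPair d E, ℝ)) t, Integrable
      (fun ω => couple α h B (fun j => ω (T j)) (k + 1) y * f (ω t)) (Q.law η ξ) :=
    fun f t => integrable_couple_mul Q hh hc h0 hB f t η ξ (k + 1) y
  simp only [mul_sub, hP.op_shift]
  rw [integral_sub, integral_sub]
  · exact congrArg₂ _ e1.symm e2.symm
  · exact i ((u.comp (shift (-y))).comp ContinuousMap.fst) _
  · exact i ((u.comp (shift (-y))).comp ContinuousMap.snd) _
  · exact i ((P.op (T (k + 1) - T k) (u.comp (shift (-y)))).comp ContinuousMap.fst) _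
  · exact i ((P.op (T (k + 1) - T k) (u.comp (shift (-y)))).comp ContinuousMap.snd) _

include hh hc h0 hB in
/-- One step of the discrete resolvent equation along the coupled walk. -/
theorem gap_step_le (hρ : ∀ a b : E, dist a b ≤ 1) (hP : TranslationInvariant P)
    {u f : C(Config d E, ℝ)} {w : (Fin d → ℤ) → ℝ≥0} (hf : LipschitzBound w fun η ξ => |f η - f ξ|)
    {lo O a : ℝ} (hlo : ∀ η, lo ≤ u η) (hhi : ∀ η, u η ≤ lo + O) (hh' : h ≠ 0)
    (hah : a * h ≤ 1) (hT : ∀ k, T (k + 1) = T k + h.toNNReal) (η ξ : Config d E) (k : ℕ) :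
    gap Q α h B T u η ξ k ≤ (1 - a * h) * (gap Q α h B T u η ξ (k + 1) +
      (mass Q α h B T η ξ k - mass Q α h B T η ξ (k + 1)) * O) +
      h * ((B k).card * ((∑' x, (w x : ℝ)) * (Q.maxDist (T k)).toReal)) +
      h * (2 * ‖stepError P.toFellerSemigroup α a u f h‖) := by
  set v := P.op h.toNNReal u with hv
  set ε := stepError P.toFellerSemigroup α a u f h
  have hu : u = (1 - a * h) • (v + h • α.jump v) + h • (f + ε) := eq_add_stepError a u f hh'
  have hTk : T (k + 1) - T k = h.toNNReal := by rw [hT, add_tsub_cancel_left]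
  have hTm : Monotone T := monotone_nat_of_le_succ fun k => by rw [hT]; exact le_self_add
  have hg := integral_couple_mul_op Q hh hc h0 hB hP u η ξ hTm k
  rw [hTk, ← hv] at hg
  set q : ℕ → (Fin d → ℤ) → CadlagPath (ConfigPair d E) → ℝ :=
    fun k x ω => couple α h B (fun j => ω (T j)) k x with hq
  set Df : CadlagPath (ConfigPair d E) → ℝ := fun ω =>
    ∑ x ∈ B k, |f (shift (-x) (ω (T k)).1) - f (shift (-x) (ω (T k)).2)| with hDf
  have iDf' : ∀ x, Integrable (fun ω : CadlagPath (ConfigPair d E) =>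
      |f (shift (-x) (ω (T k)).1) - f (shift (-x) (ω (T k)).2)|) (Q.law η ξ) :=
    fun x => (integrable_eval _ (pairDiff f x) (T k)).abs
  have iDf : Integrable Df (Q.law η ξ) := integrable_finsetSum _ fun x _ => iDf' x
  have hDfle : ∫ ω, Df ω ∂(Q.law η ξ) ≤
      (B k).card * ((∑' x, (w x : ℝ)) * (Q.maxDist (T k)).toReal) := by
    rw [hDf, integral_finsetSum _ fun x _ => iDf' x, ← nsmul_eq_mul]
    exact Finset.sum_le_card_nsmul _ _ _ fun x _ => Q.integral_le_of_lipschitzBound hρ hf (T k) x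
      η ξ (fun ω => abs_nonneg _) fun ω => le_rfl
  have i1 := integrable_sum_couple_mul Q (T := T) hh hc h0 hB v (T k) η ξ (k + 1)
  have i2 := integrable_sum_couple Q (T := T) hh hc h0 hB η ξ k
  have i3 := integrable_sum_couple Q (T := T) hh hc h0 hB η ξ (k + 1)
  have i4 := ((i1.add ((i2.sub i3).mul_const O)).const_mul (1 - a * h)).add
    ((iDf.add (integrable_const (2 * ‖ε‖))).const_mul h)
  have hle := integral_mono (integrable_sum_couple_mul Q (T := T) hh hc h0 hB u (T k) η ξ k) i4
    fun ω => ?_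
  · refine hle.trans ?_
    simp only [Pi.add_apply, Pi.sub_apply]
    rw [integral_add, integral_const_mul, integral_const_mul, integral_add, integral_mul_const,
      integral_sub i2 i3, integral_add iDf (integrable_const _), hg]
    · simp only [integral_const, probReal_univ, one_smul]
      rw [mul_add h, ← add_assoc]
      simp only [mass]
      gcongr
    · exact i1
    · exact (i2.sub i3).mul_const O
    · exact (i1.add ((i2.sub i3).mul_const O)).const_mul _
    · exact (iDf.add (integrable_const _)).const_mul _
  · have h1 := sum_couple_mul_sub_le (α := α) (ζ := fun j => ω (T j)) hh hc h0 hB k (v := v)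
      (P.le_op _ hlo) (P.op_le _ hhi)
    have h2 : ∑ x ∈ B k, q k x ω * (u (shift (-x) (ω (T k)).1) - u (shift (-x) (ω (T k)).2)) =
        (1 - a * h) * ∑ x ∈ B k, q k x ω * ((v + h • α.jump v) (shift (-x) (ω (T k)).1) -
          (v + h • α.jump v) (shift (-x) (ω (T k)).2)) +
        h * ∑ x ∈ B k, q k x ω * ((f (shift (-x) (ω (T k)).1) - f (shift (-x) (ω (T k)).2)) +
          (ε (shift (-x) (ω (T k)).1) - ε (shift (-x) (ω (T k)).2))) := by
      rw [Finset.mul_sum, Finset.mul_sum, ← Finset.sum_add_distrib]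
      refine Finset.sum_congr rfl fun x _ => ?_
      have e : ∀ ζ, u ζ = (1 - a * h) * (v + h • α.jump v) ζ + h * (f ζ + ε ζ) := fun ζ => by
        conv_lhs => rw [hu]
        rfl
      rw [e, e (shift (-x) (ω (T k)).2)]
      ring
    have h3 : ∑ x ∈ B k, q k x ω * ((f (shift (-x) (ω (T k)).1) - f (shift (-x) (ω (T k)).2)) +
          (ε (shift (-x) (ω (T k)).1) - ε (shift (-x) (ω (T k)).2))) ≤ Df ω + 2 * ‖ε‖ := by
      -- For f the mass at each site is bounded by 1, which costs the cardinality of the ball. For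
      -- the discretization error the total mass, at most 1, is kept.
      have h4 : ∀ x ∈ B k, q k x ω * ((f (shift (-x) (ω (T k)).1) -
          f (shift (-x) (ω (T k)).2)) + (ε (shift (-x) (ω (T k)).1) -
          ε (shift (-x) (ω (T k)).2))) ≤
          |f (shift (-x) (ω (T k)).1) - f (shift (-x) (ω (T k)).2)| + q k x ω * (2 * ‖ε‖) := by
        intro x _
        have q0 : 0 ≤ q k x ω := couple_nonneg hh hc k x
        have q1 : q k x ω ≤ 1 := couple_le_one hh hc h0 hB k x
        have b1 := (abs_le.1 (ε.norm_coe_le_norm (shift (-x) (ω (T k)).1))).2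
        have b2 := (abs_le.1 (ε.norm_coe_le_norm (shift (-x) (ω (T k)).2))).1
        rw [mul_add]
        refine add_le_add ?_ (mul_le_mul_of_nonneg_left (by linarith) q0)
        exact (mul_le_mul_of_nonneg_left (le_abs_self _) q0).trans
          (mul_le_of_le_one_left (abs_nonneg _) q1)
      refine (Finset.sum_le_sum h4).trans ?_
      rw [Finset.sum_add_distrib, ← Finset.sum_mul]
      exact add_le_add_right (mul_le_of_le_one_left (by positivity)
        (sum_couple_le_one hh hc h0 hB k)) _
    refine h2.le.trans (add_le_add (mul_le_mul_of_nonneg_left h1 (by linarith))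
      (mul_le_mul_of_nonneg_left h3 hh))

end Expectation

end RWDRE

/-! ### Survival of the coupled walk and the oscillation bound -/

namespace RWDRE

/-- Iteration of an affine recursion with a coefficient below one. -/
theorem le_of_discounted_step {D M c : ℕ → ℝ} {b O e : ℝ} (hb0 : 0 ≤ b) (hb1 : b ≤ 1) (hO : 0 ≤ O)
    (hc : ∀ k, 0 ≤ c k) (hM : Antitone M)
    (hD : ∀ k, D k ≤ b * (D (k + 1) + (M k - M (k + 1)) * O) + c k + e) (n : ℕ) :
    D 0 ≤ b ^ n * D n + (M 0 - M n) * O + ∑ k ∈ Finset.range n, c k +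
      (∑ k ∈ Finset.range n, b ^ k) * e := by
  induction n with
  | zero => simp
  | succ n ih =>
    rw [Finset.sum_range_succ, Finset.sum_range_succ]
    have p1 : b ^ n ≤ 1 := pow_le_one₀ hb0 hb1
    have p0 : 0 ≤ b ^ n := pow_nonneg hb0 n
    have h1 := mul_le_mul_of_nonneg_left (hD n) p0
    have h2 : 0 ≤ (M n - M (n + 1)) * O := mul_nonneg (sub_nonneg.2 (hM n.le_succ)) hO
    -- Discounting is dropped on the mass loss, which telescopes, and on c; it is kept on e, whose
    -- sum would otherwise grow with n.
    have h3 := mul_le_of_le_one_left h2 (pow_le_one₀ (n := n + 1) hb0 hb1)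
    have h4 := mul_le_of_le_one_left (hc n) p1
    rw [pow_succ] at h3 ⊢
    linarith

variable {d : ℕ} {E : Type*} [MetricSpace E] [CompactSpace E] [Nonempty E] [MeasurableSpace E]
  [BorelSpace E] {P : FellerProcess (Config d E)} (Q : EnvironmentCoupling P) {α : JumpRates d E}
  {h : ℝ} {B : ℕ → Finset (Fin d → ℤ)} {T : ℕ → ℝ≥0}

section

variable (hh : 0 ≤ h) (hc : ∀ p x, h * ∑' z, join α p x z ≤ 1) (h0 : 0 ∈ B 0) (hB : Monotone B)

include hh hc h0 hB in
theorem antitone_mass (η ξ : Config d E) : Antitone (mass Q α h B T η ξ) :=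
  antitone_nat_of_succ_le fun k => integral_mono (integrable_sum_couple Q hh hc h0 hB η ξ (k + 1))
    (integrable_sum_couple Q hh hc h0 hB η ξ k) fun _ => sum_couple_succ_le hh hc h0 hB k

end

/-- The walkers stay together with a positive probability, up to the expected number of times at
which they split. -/
theorem le_mass (hρ : ∀ a b : E, dist a b ≤ 1) (hh : 0 ≤ h)
    (hc : ∀ p x, h * ∑' z, join α p x z ≤ 1) {w : (Fin d → ℤ) → ℝ≥0}
    (hw : LipschitzBound w fun η ξ : Config d E => ∑' z, |(α.rate η z : ℝ) - α.rate ξ z|)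
    {U : ℝ → ℝ} {γ : ℝ} {l : (Fin d → ℤ) → ℝ≥0} (hl : ∀ η z, α.rate η z ≤ l z)
    (hls : Summable l) (hγ : 0 < γ) (hU : Antitone U) (hU0 : ∀ u, 0 ≤ U u)
    (hU1 : ∀ u, U u ≤ 1) (hU2 : ∀ u, 0 ≤ u → U u ≤ 1 / 2) (hneg : ∀ u, u < 0 → U u = 1)
    (hstep : ∀ y h, 0 ≤ h → γ * h ≤ y →
      U y + h * ∑' z, l z * (U (y - ‖z‖) - U y) ≤ U (y - γ * h))
    (h0 : 0 ∈ B 0) (hB : Monotone B) (hBk : ∀ k, B k = box d (γ * (1 + k * h)))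
    (η ξ : Config d E) (n : ℕ) :
    1 / 2 - (∑' x, (w x : ℝ)) *
      ∑ k ∈ Finset.range n, h * ((B k).card * (Q.maxDist (T k)).toReal) ≤
      mass Q α h B T η ξ n := by
  set q : ℕ → (Fin d → ℤ) → CadlagPath (ConfigPair d E) → ℝ :=
    fun k x ω => couple α h B (fun j => ω (T j)) k x with hq
  have iq : ∀ k x, Integrable (q k x) (Q.law η ξ) := fun k x =>
    integrable_couple Q hh hc h0 hB η ξ k x
  -- The weight 1 - U is at least 1/2 at the start and compensates for exits from the ball, so that
  -- the weighted mass decreases only by splitting.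
  set V : ℕ → (Fin d → ℤ) → ℝ := fun k x => 1 - U (γ * (1 + k * h) - ‖x‖) with hV
  set A : ℕ → ℝ := fun k => ∫ ω, ∑ x ∈ B k, q k x ω * V k x ∂(Q.law η ξ) with hA
  have iA : ∀ k, Integrable (fun ω => ∑ x ∈ B k, q k x ω * V k x) (Q.law η ξ) := fun k =>
    integrable_finsetSum _ fun x _ => (iq k x).mul_const _
  have hA0 : 1 / 2 ≤ A 0 := by
    have e : ∀ ω, ∑ x ∈ B 0, q 0 x ω * V 0 x = V 0 0 := fun ω =>
      sum_couple_zero (α := α) (h := h) (ζ := fun j => ω (T j)) h0 (V 0)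
    have e' : A 0 = V 0 0 := by
      simp only [hA]
      rw [integral_congr_ae (Eventually.of_forall e)]
      simp
    rw [e']
    have := hU2 (γ * (1 + (0 : ℕ) * h) - ‖(0 : Fin d → ℤ)‖) (by simpa using hγ.le)
    simp only [hV]
    linarith
  set s : ℕ → (Fin d → ℤ) → CadlagPath (ConfigPair d E) → ℝ := fun k x ω =>
    q k x ω * split α (ω (T k)) x with hs
  have split_nonneg : ∀ p x, 0 ≤ split α p x := fun p x => tsum_nonneg fun z => abs_nonneg _
  have hs0 : ∀ k x ω, 0 ≤ s k x ω := fun k x ω =>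
    mul_nonneg (couple_nonneg hh hc k x) (split_nonneg _ _)
  have hsle : ∀ k x ω, s k x ω ≤ split α (ω (T k)) x := fun k x ω =>
    mul_le_of_le_one_left (split_nonneg _ _) (couple_le_one hh hc h0 hB k x)
  have hint : ∀ k x, ∫ ω, s k x ω ∂(Q.law η ξ) ≤ (∑' x, (w x : ℝ)) * (Q.maxDist (T k)).toReal :=
    fun k x => Q.integral_le_of_lipschitzBound hρ hw (T k) x η ξ (hs0 k x) (hsle k x)
  have is : ∀ k x, Integrable (s k x) (Q.law η ξ) := by
    intro k x
    have hb : ∀ p, split α p x ≤ ∑' y, (w y : ℝ) := fun p => by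
      refine (hw.2 _ _).trans ((summable_mul_dist hρ hw.1 _ _).tsum_le_tsum (fun y => ?_)
        (NNReal.summable_coe.2 hw.1))
      exact mul_le_of_le_one_right (w y).coe_nonneg (hρ _ _)
    have hm : Measurable fun p : ConfigPair d E => split α p x := by
      refine Measurable.tsum fun z => ?_
      have hz := NNReal.continuous_coe.comp ((α.continuous_rate z).comp (shift (-x)).continuous)
      exact ((hz.comp continuous_fst).sub (hz.comp continuous_snd)).abs.measurable
    refine (iq k x).mul_bdd (c := ∑' y, (w y : ℝ))
      (hm.comp (CadlagPath.measurable_eval (T k))).aestronglyMeasurable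
      (Eventually.of_forall fun ω => ?_)
    rw [Real.norm_of_nonneg (split_nonneg _ _)]
    exact hb _
  -- One step costs h times the expected splitting rate, which at each site of the ball is at most
  -- the total weight of `w` times `maxDist`.
  have hAs : ∀ k, A k - (∑' x, (w x : ℝ)) * (h * ((B k).card * (Q.maxDist (T k)).toReal)) ≤
      A (k + 1) := by
    intro k
    have i1 : Integrable (fun ω => ∑ x ∈ B k, s k x ω) (Q.law η ξ) :=
      integrable_finsetSum _ fun x _ => is k x
    have h1 := integral_mono ((iA k).sub (i1.const_mul h)) (iA (k + 1)) fun ω => by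
      refine le_trans (le_of_eq ?_) (sum_couple_mul_survival_le (α := α) (ζ := fun j => ω (T j)) hh
        hc hl hls hγ hU hU0 hU1 hneg hstep hBk k)
      rw [Pi.sub_apply, Finset.mul_sum, ← Finset.sum_sub_distrib]
      refine Finset.sum_congr rfl fun x _ => ?_
      simp only [hs, hV, hq]
      ring
    simp only [Pi.sub_apply] at h1
    rw [integral_sub (iA k) (i1.const_mul h), integral_const_mul,
      integral_finsetSum _ fun x _ => is k x] at h1
    refine le_trans ?_ h1
    have h2 := Finset.sum_le_card_nsmul (B k) _ _ fun x _ => hint k x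
    rw [nsmul_eq_mul] at h2
    have h3 := mul_le_mul_of_nonneg_left h2 hh
    simp only [hA] at h3 ⊢
    linarith
  have hAn : ∀ n, 1 / 2 - (∑' x, (w x : ℝ)) *
      ∑ k ∈ Finset.range n, h * ((B k).card * (Q.maxDist (T k)).toReal) ≤ A n := by
    intro n
    induction n with
    | zero => simpa using hA0
    | succ n ih =>
      rw [Finset.sum_range_succ, mul_add]
      linarith [hAs n]
  refine (hAn n).trans (integral_mono (iA n) (integrable_sum_couple Q hh hc h0 hB η ξ n) fun ω => ?_)
  refine Finset.sum_le_sum fun x _ => mul_le_of_le_one_right (couple_nonneg hh hc n x) ?_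
  simp only [hV]
  linarith [hU0 (γ * (1 + n * h) - ‖x‖)]

/-- The oscillation of the semigroup of the environment applied to a solution of the resolvent
equation is smaller than that of the solution, up to constants. -/
theorem op_sub_op_le (hρ : ∀ a b : E, dist a b ≤ 1) (hP : TranslationInvariant P) (hh : 0 < h)
    (hc : ∀ p x, h * ∑' z, join α p x z ≤ 1) {w : (Fin d → ℤ) → ℝ≥0}
    {U : ℝ → ℝ} {γ : ℝ} {l : (Fin d → ℤ) → ℝ≥0}
    (hw : LipschitzBound w fun η ξ : Config d E => ∑' z, |(α.rate η z : ℝ) - α.rate ξ z|)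
    (hl : ∀ η z, α.rate η z ≤ l z)
    (hls : Summable l) (hγ : 0 < γ) (hU : Antitone U) (hU0 : ∀ u, 0 ≤ U u)
    (hU1 : ∀ u, U u ≤ 1) (hU2 : ∀ u, 0 ≤ u → U u ≤ 1 / 2) (hneg : ∀ u, u < 0 → U u = 1)
    (hstep : ∀ y h, 0 ≤ h → γ * h ≤ y →
      U y + h * ∑' z, l z * (U (y - ‖z‖) - U y) ≤ U (y - γ * h)) {K : ℝ}
    {r : ℝ≥0} (hK : ∀ n, ∑ k ∈ Finset.range n, h * ((box d (γ * (1 + k * h))).card *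
      (Q.maxDist (r + k * h.toNNReal)).toReal) ≤ K)
    {u f : C(Config d E, ℝ)} {v : (Fin d → ℤ) → ℝ≥0} (hf : LipschitzBound v fun η ξ => |f η - f ξ|)
    {lo O a : ℝ} (hlo : ∀ η, lo ≤ u η) (hhi : ∀ η, u η ≤ lo + O) (ha : 0 < a) (hah : a * h ≤ 1)
    (η ξ : Config d E) :
    P.op r u η - P.op r u ξ ≤ (1 / 2 + (∑' x, (w x : ℝ)) * K) * O + (∑' x, (v x : ℝ)) * K +
      2 * ‖stepError P.toFellerSemigroup α a u f h‖ / a := by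
  set B : ℕ → Finset (Fin d → ℤ) := fun k => box d (γ * (1 + k * h)) with hBdef
  set T : ℕ → ℝ≥0 := fun k => r + k * h.toNNReal with hT
  have hR : ∀ k : ℕ, 0 ≤ γ * (1 + k * h) := fun k => by positivity
  have h0 : 0 ∈ B 0 := by rw [hBdef, mem_box (hR 0)]; simpa using hR 0
  have hRm : Monotone fun k : ℕ => γ * (1 + k * h) := fun a b hab => by
    have : (a : ℝ) ≤ b := by exact_mod_cast hab
    simp only
    gcongr
  have hB : Monotone B := fun a b hab x hx => by
    rw [hBdef, mem_box (hR _)] at hx ⊢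
    exact hx.trans (hRm hab)
  have hT0 : T 0 = r := by simp [hT]
  have hTs : ∀ k, T (k + 1) = T k + h.toNNReal := fun k => by
    simp only [hT]; push_cast; ring
  have hO : 0 ≤ O := by linarith [hlo η, hhi η]
  set ε := ‖stepError P.toFellerSemigroup α a u f h‖
  set W := ∑' x, (w x : ℝ)
  set V := ∑' x, (v x : ℝ)
  have hW : 0 ≤ W := tsum_nonneg fun x => (w x).coe_nonneg
  have hV : 0 ≤ V := tsum_nonneg fun x => (v x).coe_nonneg
  have hb0 : 0 ≤ 1 - a * h := by linarith
  have hb1 : 1 - a * h < 1 := by linarith [mul_pos ha hh]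
  -- The left side is the gap at step 0, since the walk is started only at environment time r.
  rw [← hT0, ← gap_zero Q (α := α) (h := h) (T := T) h0]
  have hD := le_of_discounted_step (D := gap Q α h B T u η ξ) (M := mass Q α h B T η ξ)
    (c := fun k => h * ((B k).card * (V * (Q.maxDist (T k)).toReal))) (b := 1 - a * h)
    (e := h * (2 * ε)) hb0 hb1.le hO
    (fun k => by positivity) (antitone_mass Q hh.le hc h0 hB η ξ)
    (gap_step_le Q hh.le hc h0 hB hρ hP hf hlo hhi hh.ne' hah hTs η ξ)
  have hn : ∀ n, gap Q α h B T u η ξ 0 ≤ (1 - a * h) ^ n * O +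
      ((1 / 2 + W * K) * O + V * K + 2 * ε / a) := by
    intro n
    have h1 := mul_le_mul_of_nonneg_left
      (gap_le Q (T := T) hh.le hc h0 hB hlo hhi η ξ n) (pow_nonneg hb0 n)
    have h2 := le_mass Q (T := T) hρ hh.le hc hw hl hls hγ hU hU0 hU1 hU2 hneg hstep h0 hB
      (fun _ => rfl) η ξ n
    have h3 := mul_le_mul_of_nonneg_left (hK n) hW
    have h4 : (mass Q α h B T η ξ 0 - mass Q α h B T η ξ n) * O ≤ (1 / 2 + W * K) * O := by
      refine mul_le_mul_of_nonneg_right ?_ hO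
      rw [mass_zero Q h0]
      linarith
    have h5 : ∑ k ∈ Finset.range n, h * ((B k).card * (V * (Q.maxDist (T k)).toReal)) ≤ V * K := by
      refine le_trans (le_of_eq ?_) (mul_le_mul_of_nonneg_left (hK n) hV)
      rw [Finset.mul_sum]
      exact Finset.sum_congr rfl fun k _ => by ring
    -- The geometric series is at most 1/(ah), so the factor h in the error per step cancels and
    -- 2ε/a remains.
    have h6 : (∑ k ∈ Finset.range n, (1 - a * h) ^ k) * (h * (2 * ε)) ≤ 2 * ε / a := by
      have h7 : ∑ k ∈ Finset.range n, (1 - a * h) ^ k ≤ (a * h)⁻¹ := by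
        have := (summable_geometric_of_lt_one hb0 hb1).sum_le_tsum (Finset.range n)
          fun k _ => pow_nonneg hb0 k
        rwa [tsum_geometric_of_lt_one hb0 hb1, sub_sub_cancel] at this
      refine (mul_le_mul_of_nonneg_right h7 (by positivity)).trans_eq ?_
      field_simp
    linarith [hD n]
  have hlim : Tendsto (fun n : ℕ => (1 - a * h) ^ n * O +
      ((1 / 2 + W * K) * O + V * K + 2 * ε / a)) atTop
      (𝓝 (0 * O + ((1 / 2 + W * K) * O + V * K + 2 * ε / a))) :=
    ((tendsto_pow_atTop_nhds_zero_of_lt_one hb0 hb1).mul_const O).add_const _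
  rw [zero_mul, zero_add] at hlim
  exact ge_of_tendsto' hlim hn

end RWDRE

/-! ### Late times: smallness of the summed discrepancies -/

namespace RWDRE

/-- The tail integrals of an integrable function vanish. -/
theorem exists_setLIntegral_Ici_le {F : ℝ → ℝ≥0∞} (hfin : ∫⁻ t in Set.Ioi (0 : ℝ), F t ≠ ∞) {ε : ℝ≥0∞} (hε : 0 < ε) :
    ∃ t₀ : ℝ, 0 ≤ t₀ ∧ ∫⁻ t in Set.Ici t₀, F t ≤ ε := by
  set ν := (volume.restrict (Set.Ioi (0 : ℝ))).withDensity F with hν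
  have hfν : IsFiniteMeasure ν := isFiniteMeasure_withDensity hfin
  have h1 := tendsto_measure_iInter_atTop (μ := ν) (s := fun n : ℕ => Set.Ici (n : ℝ))
    (fun n => measurableSet_Ici.nullMeasurableSet)
    (fun m n hmn => Set.Ici_subset_Ici.2 (by exact_mod_cast hmn)) ⟨0, measure_ne_top _ _⟩
  have h2 : ⋂ n : ℕ, Set.Ici (n : ℝ) = ∅ := by
    refine Set.eq_empty_of_forall_notMem fun x hx => ?_
    obtain ⟨n, hn⟩ := exists_nat_gt x
    exact absurd (Set.mem_iInter.1 hx n) (not_le.2 hn)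
  rw [h2, measure_empty] at h1
  -- n ≥ 1 places [n,∞) inside (0,∞), where the density lives.
  obtain ⟨n, hn, hn1⟩ := ((h1.eventually_le_const hε).and (eventually_ge_atTop 1)).exists
  refine ⟨n, Nat.cast_nonneg n, ?_⟩
  rw [Function.comp_apply, hν, withDensity_apply _ measurableSet_Ici, Measure.restrict_restrict measurableSet_Ici,
    Set.inter_eq_left.2 fun x hx => ?_] at hn
  · exact hn
  · have : (1 : ℝ) ≤ n := by exact_mod_cast hn1
    exact lt_of_lt_of_le (by linarith) (Set.mem_Ici.1 hx)

variable {d : ℕ} {E : Type*} [MetricSpace E] [CompactSpace E] [Nonempty E] [MeasurableSpace E]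
  [BorelSpace E] {P : FellerProcess (Config d E)} (Q : EnvironmentCoupling P)

variable {Q} in
-- On (0,1] the expected distance is at most 1, and for t > 1 one has 1 + t ≤ 2t. The weight (1+t)^d
-- fits balls that start with radius γ rather than 0.
theorem EnvironmentCoupling.IntegrableDecay.lintegral_one_add_pow_ne_top (hQ : Q.IntegrableDecay)
    (hρ : ∀ a b : E, dist a b ≤ 1) :
    ∫⁻ t in Set.Ioi (0 : ℝ), ENNReal.ofReal (1 + t) ^ d * Q.maxDist t.toNNReal ≠ ∞ := by
  have hm : Measurable fun t : ℝ => ENNReal.ofReal t ^ d * Q.maxDist t.toNNReal :=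
    (ENNReal.measurable_ofReal.pow_const d).mul (Q.measurable_maxDist hρ)
  have hle : ∀ t ∈ Set.Ioi (0 : ℝ), ENNReal.ofReal (1 + t) ^ d * Q.maxDist t.toNNReal ≤
      (Set.Ioc 0 1).indicator (fun _ => 2 ^ d) t +
        2 ^ d * (ENNReal.ofReal t ^ d * Q.maxDist t.toNNReal) := by
    intro t ht
    rcases le_or_gt t 1 with h1 | h1
    · rw [Set.indicator_of_mem (Set.mem_Ioc.2 ⟨ht, h1⟩)]
      refine le_trans ?_ le_self_add
      refine (mul_le_of_le_one_right' (Q.maxDist_le_one hρ _)).trans ?_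
      gcongr
      refine (ENNReal.ofReal_le_ofReal (by linarith : 1 + t ≤ 2)).trans (by simp)
    · refine le_trans ?_ le_add_self
      rw [← mul_assoc, ← mul_pow]
      gcongr
      rw [show (2 : ℝ≥0∞) = ENNReal.ofReal 2 by simp, ← ENNReal.ofReal_mul (by norm_num)]
      exact ENNReal.ofReal_le_ofReal (by linarith)
  refine ne_top_of_le_ne_top ?_ (setLIntegral_mono' measurableSet_Ioi hle)
  rw [lintegral_add_left (measurable_const.indicator measurableSet_Ioc),
    lintegral_const_mul _ hm]
  refine ENNReal.add_ne_top.2 ⟨?_, ENNReal.mul_ne_top (by simp) hQ.ne⟩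
  rw [lintegral_indicator measurableSet_Ioc, lintegral_const]
  refine ENNReal.mul_ne_top (ENNReal.pow_ne_top ENNReal.ofNat_ne_top) ?_
  rw [Measure.restrict_apply_univ]
  exact ((Measure.restrict_apply_le _ _).trans_lt (by simp)).ne

variable {Q} in
/-- After a late time, the environments seen at a growing ball are close at all times of a grid. -/
theorem EnvironmentCoupling.IntegrableDecay.exists_sum_card_box_le (hQ : Q.IntegrableDecay)
    (hρ : ∀ a b : E, dist a b ≤ 1) {γ K : ℝ} (hγ : 0 < γ) (hK : 0 < K) :
    ∃ t₀ : ℝ, 0 ≤ t₀ ∧ ∀ h, 0 < h → ∃ r : ℝ≥0, (r : ℝ) ≤ t₀ + h ∧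
      ∀ n, ∑ k ∈ Finset.range n, h * ((box d (γ * (1 + k * h))).card *
        (Q.maxDist (r + k * h.toNNReal)).toReal) ≤ K := by
  set F : ℝ → ℝ≥0∞ := fun t => ENNReal.ofReal (1 + t) ^ d * Q.maxDist t.toNNReal with hFdef
  have hF : Measurable F :=
    ((ENNReal.measurable_ofReal.comp (measurable_const_add 1)).pow_const d).mul
      (Q.measurable_maxDist hρ)
  set C : ℝ := (2 * γ + 1) ^ d with hC
  have hC0 : 0 < C := by positivity
  clear_value C
  obtain ⟨t₀, ht₀, htail⟩ := exists_setLIntegral_Ici_le (hQ.lintegral_one_add_pow_ne_top hρ)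
    (ε := ENNReal.ofReal (K / C)) (ENNReal.ofReal_pos.2 (by positivity))
  refine ⟨t₀, ht₀, fun h hh => ?_⟩
  -- The offset of the grid depends on h, but the starting time r = t₀ + s stays below t₀ + h.
  obtain ⟨s, ⟨hs0, hsh⟩, hs⟩ := exists_sum_le_lintegral hF t₀ hh
  have hr0 : 0 ≤ t₀ + s := by positivity
  refine ⟨(t₀ + s).toNNReal, by rw [Real.coe_toNNReal _ hr0]; linarith, fun n => ?_⟩
  have hpt : ∀ k : ℕ, ENNReal.ofReal (h * ((box d (γ * (1 + k * h))).card *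
        (Q.maxDist ((t₀ + s).toNNReal + k * h.toNNReal)).toReal)) ≤
      ENNReal.ofReal C * (ENNReal.ofReal h * F (t₀ + s + k * h)) := by
    intro k
    have ek : (t₀ + s + k * h).toNNReal = (t₀ + s).toNNReal + k * h.toNNReal := by
      rw [Real.toNNReal_add hr0 (by positivity), Real.toNNReal_mul (Nat.cast_nonneg k),
        Real.toNNReal_natCast]
    -- The ball at step k has radius γ(1+kh), and kh is at most the actual time t₀ + s + kh.
    have hcard : ((box d (γ * (1 + k * h))).card : ℝ) ≤ C * (1 + (t₀ + s + k * h)) ^ d := by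
      have hkh : 0 ≤ k * h := by positivity
      refine (card_box_le (by positivity)).trans ?_
      rw [hC, ← mul_pow]
      refine pow_le_pow_left₀ (by positivity) ?_ d
      nlinarith [mul_nonneg hγ.le hr0]
    have hfin : Q.maxDist ((t₀ + s).toNNReal + k * h.toNNReal) ≠ ∞ :=
      ne_top_of_le_ne_top ENNReal.one_ne_top (Q.maxDist_le_one hρ _)
    have hcard' := ENNReal.ofReal_le_ofReal hcard
    rw [ENNReal.ofReal_mul hC0.le, ENNReal.ofReal_pow (by positivity)] at hcard'
    rw [ENNReal.ofReal_mul hh.le, ENNReal.ofReal_mul (Nat.cast_nonneg _),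
      ENNReal.ofReal_toReal hfin, mul_left_comm (ENNReal.ofReal C)]
    simp only [hFdef]
    rw [ek, ← mul_assoc (ENNReal.ofReal C)]
    gcongr
  have h1 : ∑ k ∈ Finset.range n, ENNReal.ofReal (h * ((box d (γ * (1 + k * h))).card *
        (Q.maxDist ((t₀ + s).toNNReal + k * h.toNNReal)).toReal)) ≤ ENNReal.ofReal K := by
    refine (Finset.sum_le_sum fun k _ => hpt k).trans ?_
    rw [← Finset.mul_sum, ← Finset.mul_sum]
    calc _ ≤ ENNReal.ofReal C * ENNReal.ofReal (K / C) := by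
          gcongr
          exact (mul_le_mul_right (ENNReal.sum_le_tsum _) _).trans (hs.trans htail)
      _ = ENNReal.ofReal K := by
          rw [← ENNReal.ofReal_mul hC0.le, mul_div_cancel₀ _ hC0.ne']
  rw [← ENNReal.ofReal_sum_of_nonneg fun k _ => by positivity] at h1
  exact (ENNReal.ofReal_le_ofReal_iff hK.le).1 h1

end RWDRE

/-! ### Uniform bound on the oscillation of resolvents -/

namespace RWDRE

variable {d : ℕ} {E : Type*} [MetricSpace E] [CompactSpace E] [Nonempty E] [MeasurableSpace E]
  [BorelSpace E] {P : FellerProcess (Config d E)} {Q : EnvironmentCoupling P}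

/-- Let p be the exponential. Since c/(a+c) ≤ 1 and (1-p)/(a+c) ≤ t, the assumption gives O ≤
p((3/4)O + Y) + tF + (1-p)O, hence (p/4)O ≤ pY + tF. The final bound is free of a because a ≤ 1 and
r ≤ t. -/
theorem le_of_le_exp_mul_add {a c F O r t Y : ℝ} (ha : 0 < a) (ha1 : a ≤ 1) (hc : 0 ≤ c)
    (hF : 0 ≤ F) (hO : 0 ≤ O) (hr : 0 ≤ r) (hrt : r ≤ t)
    (h : O ≤ Real.exp (-((a + c) * r)) * (3 / 4 * O + Y) +
      (1 - Real.exp (-((a + c) * r))) / (a + c) * (F + c * O)) :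
    O ≤ 4 * Y + 4 * (t * F * Real.exp ((1 + c) * t)) := by
  set p := Real.exp (-((a + c) * r)) with hp
  have hb : 0 < a + c := by linarith
  have hp0 : 0 < p := Real.exp_pos _
  have hp1 : p ≤ 1 := Real.exp_le_one_iff.2 (neg_nonpos.2 (by positivity))
  have h1 : (1 - p) / (a + c) * F ≤ t * F := by
    refine mul_le_mul_of_nonneg_right ?_ hF
    rw [div_le_iff₀ hb]
    have := Real.add_one_le_exp (-((a + c) * r))
    nlinarith [mul_le_mul_of_nonneg_left hrt hb.le]
  have h2 : (1 - p) / (a + c) * (c * O) ≤ (1 - p) * O := by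
    rw [div_mul_eq_mul_div, div_le_iff₀ hb, mul_assoc]
    refine mul_le_mul_of_nonneg_left ?_ (by linarith)
    nlinarith [mul_nonneg ha.le hO]
  have h3 : p * O ≤ 4 * (p * Y) + 4 * (t * F) := by
    rw [mul_add _ F] at h
    linarith
  have h4 : O ≤ 4 * Y + 4 * (t * F) * p⁻¹ := by
    rw [← div_eq_mul_inv, ← sub_le_iff_le_add', le_div_iff₀ hp0]
    linarith
  refine h4.trans ?_
  rw [hp, ← Real.exp_neg, neg_neg, mul_assoc 4]
  have ht : 0 ≤ t := hr.trans hrt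
  have he : Real.exp ((a + c) * r) ≤ Real.exp ((1 + c) * t) :=
    Real.exp_le_exp.2 (mul_le_mul (by linarith) hrt hr (by linarith))
  gcongr

/-- Solutions of the resolvent equation with Lipschitz data have an oscillation that is bounded
uniformly in the resolvent parameter. -/
theorem EnvironmentCoupling.IntegrableDecay.exists_resolvent_sub_le (hQ : Q.IntegrableDecay)
    (hρ : ∀ a b : E, dist a b ≤ 1) (hP : TranslationInvariant P) (α : JumpRates d E)
    {f : C(Config d E, ℝ)} {v : (Fin d → ℤ) → ℝ≥0} (hf : LipschitzBound v fun η ξ => |f η - f ξ|) :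
    ∃ C : ℝ, ∀ a : ℝ, 0 < a → a ≤ 1 → ∀ u g : C(Config d E, ℝ), P.GeneratorGraph u g →
      g + α.jump u = a • u - f → ∀ η ξ, u η - u ξ ≤ C := by
  obtain ⟨l, hl, hls, hlm⟩ := α.exists_bound
  obtain ⟨w, hw⟩ := α.exists_lipschitzBound hρ
  obtain ⟨U, γ, hγ, hU, hU0, hU1, hU2, hneg, hstep⟩ := exists_survival (fun z => (l z : ℝ))
    (fun z : Fin d → ℤ => ‖z‖) (fun z => (l z).coe_nonneg) (fun z => norm_nonneg z)
    (NNReal.summable_coe.2 hls) (by simpa using NNReal.summable_coe.2 hlm)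
  set c := ∑' z, (l z : ℝ) with hcdef
  set W := ∑' x, (w x : ℝ)
  set V := ∑' x, (v x : ℝ)
  have hc0 : 0 ≤ c := tsum_nonneg fun z => (l z).coe_nonneg
  have hW : 0 ≤ W := tsum_nonneg fun x => (w x).coe_nonneg
  -- Late times are chosen so that splitting costs at most WK ≤ 1/4, on top of the 1/2 for leaving
  -- the balls; this is the 3/4 in `le_of_le_exp_mul_add`.
  set K := 1 / (4 * (W + 1)) with hK
  have hK0 : 0 < K := by positivity
  have hWK : W * K ≤ 1 / 4 := by
    rw [hK, mul_one_div, div_le_div_iff₀ (by positivity) (by norm_num)]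
    linarith
  obtain ⟨t₀, ht₀, hgrid⟩ := hQ.exists_sum_card_box_le hρ hγ hK0
  set F := 2 * ‖f‖ with hF
  have hfF : ∀ η ξ, f η - f ξ ≤ F := fun η ξ => by
    have b1 := (abs_le.1 (f.norm_coe_le_norm η)).2
    have b2 := (abs_le.1 (f.norm_coe_le_norm ξ)).1
    linarith
  set C' := 4 * ((t₀ + 1) * F * Real.exp ((1 + c) * (t₀ + 1))) with hC'
  refine ⟨4 * (V * K) + C', fun a ha ha1 u g hu hg η ξ => ?_⟩
  -- The extrema are attained, so the bounds at η₀ and ξ₀ become a self-consistent inequality for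
  -- the exact oscillation O.
  obtain ⟨ξ₀, hξ₀⟩ : ∃ ξ₀, ∀ η, u ξ₀ ≤ u η := by
    obtain ⟨ξ₀, -, h⟩ := isCompact_univ.exists_isMinOn Set.univ_nonempty u.continuous.continuousOn
    exact ⟨ξ₀, fun η => h (Set.mem_univ η)⟩
  obtain ⟨η₀, hη₀⟩ : ∃ η₀, ∀ η, u η ≤ u η₀ := by
    obtain ⟨η₀, -, h⟩ := isCompact_univ.exists_isMaxOn Set.univ_nonempty u.continuous.continuousOn
    exact ⟨η₀, fun η => h (Set.mem_univ η)⟩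
  set O := u η₀ - u ξ₀ with hO
  have hO0 : 0 ≤ O := sub_nonneg.2 (hξ₀ η₀)
  have hhi : ∀ η, u η ≤ u ξ₀ + O := fun η => by linarith [hη₀ η]
  have hrate : ∀ η, ∑' z, (α.rate η z : ℝ) ≤ c := fun η =>
    (α.summable_rate η).tsum_le_tsum (fun z => hl η z) (NNReal.summable_coe.2 hls)
  -- The restriction on h makes the weights of the discrete walk nonnegative and gives h ≤ 1, hence
  -- ah ≤ 1 and r ≤ t₀ + 1.
  have key : ∀ h, 0 < h → h ≤ 1 / (c + 1) →
      O ≤ 4 * (V * K + 2 * ‖stepError P.toFellerSemigroup α a u f h‖ / a) + C' := by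
    intro h hh hh1
    have hhc : h * (c + 1) ≤ 1 := (le_div_iff₀ (by positivity)).1 hh1
    have hh2 : h ≤ 1 := by nlinarith [mul_nonneg hh.le hc0]
    have hc : ∀ p x, h * ∑' z, join α p x z ≤ 1 := fun p x => by
      have h1 : ∑' z, join α p x z ≤ c := (summable_join p x).tsum_le_tsum
        (fun z => max_le (hl _ z) (hl _ z)) (NNReal.summable_coe.2 hls)
      nlinarith [mul_le_mul_of_nonneg_left h1 hh.le]
    obtain ⟨r, hr, hsum⟩ := hgrid h hh
    have h1 := op_sub_op_le Q hρ hP hh hc hw hl hls hγ hU hU0 hU1 hU2 hneg hstep hsum hf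
      hξ₀ hhi ha (by nlinarith) η₀ ξ₀
    have h2 := sub_le_exp_mul_op_sub ha hc0 hrate hu hg hfF hξ₀ hhi r.coe_nonneg η₀ ξ₀
    rw [Real.toNNReal_coe] at h2
    refine le_of_le_exp_mul_add ha ha1 hc0 (by positivity) hO0 r.coe_nonneg
      (by linarith : (r : ℝ) ≤ t₀ + 1) (h2.trans ?_)
    gcongr
    refine h1.trans ?_
    nlinarith [mul_le_mul_of_nonneg_right hWK hO0]
  -- Here a is fixed while h → 0: the error is divided by a, but the limiting constant no longer
  -- depends on a.
  have hlim : Tendsto (fun h => 4 * (V * K + 2 * ‖stepError P.toFellerSemigroup α a u f h‖ / a) +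
      C') (𝓝[>] 0) (𝓝 (4 * (V * K + 2 * ‖(0 : C(Config d E, ℝ))‖ / a) + C')) :=
    ((((tendsto_stepError hu hg).norm.const_mul 2).div_const a).const_add _ |>.const_mul 4).add_const
      _
  rw [norm_zero, mul_zero, zero_div, add_zero] at hlim
  have hOC := ge_of_tendsto hlim (by
    filter_upwards [Ioc_mem_nhdsGT (show (0 : ℝ) < 1 / (c + 1) by positivity)] with h hh
    exact key h hh.1 hh.2)
  linarith [hη₀ η, hξ₀ ξ]

/-- The environment process has at most one invariant probability measure. -/
theorem EnvironmentCoupling.IntegrableDecay.eq_of_isInvariant (hQ : Q.IntegrableDecay)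
    (hρ : ∀ a b : E, dist a b ≤ 1) (hP : TranslationInvariant P) {α : JumpRates d E}
    {T : FellerSemigroup (Config d E)} (hT : IsEnvironmentProcess P.toFellerSemigroup α T)
    {μ ν : Measure (Config d E)} [IsProbabilityMeasure μ] [IsProbabilityMeasure ν]
    (hμ : T.IsInvariant μ) (hν : T.IsInvariant ν) : μ = ν := by
  refine hμ.eq_of_resolvent_bounded hν (dense_lipschitzSubalgebra hρ) fun f hf => ?_
  obtain ⟨v, hv⟩ := hf
  obtain ⟨C, hC⟩ := hQ.exists_resolvent_sub_le hρ hP α hv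
  refine ⟨C, fun a ha ha1 => hC a ha ha1 _ _
    ((isEnvironmentProcess_iff.1 hT _ _).1 (T.generatorGraph_resolvent ha f)) ?_⟩
  rw [sub_add_cancel]

end RWDRE

end

theorem mainTheorem2 {d : ℕ} {E : Type*} [MetricSpace E] [CompactSpace E] [Nonempty E]
    [MeasurableSpace E] [BorelSpace E] (hρ : ∀ a b : E, dist a b ≤ 1)
    (P : RWDRE.FellerProcess (RWDRE.Config d E)) (hP : RWDRE.TranslationInvariant P)
    (α : RWDRE.JumpRates d E)
    (Q : RWDRE.EnvironmentCoupling P) (hQ : Q.IntegrableDecay) :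
    (∃! T : RWDRE.FellerSemigroup (RWDRE.Config d E),
      RWDRE.IsEnvironmentProcess P.toFellerSemigroup α T) ∧
    ∀ T : RWDRE.FellerSemigroup (RWDRE.Config d E),
      RWDRE.IsEnvironmentProcess P.toFellerSemigroup α T →
      ∃ μ : Measure (RWDRE.Config d E), IsProbabilityMeasure μ ∧ T.IsErgodic μ ∧
        ∀ ν : Measure (RWDRE.Config d E), IsProbabilityMeasure ν → T.IsInvariant ν → ν = μ := by
  refine ⟨RWDRE.existsUnique_isEnvironmentProcess P.toFellerSemigroup α, fun T hT => ?_⟩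
  obtain ⟨μ, hμp, hμ⟩ := T.exists_isInvariant
  have hu : ∀ ν : Measure (RWDRE.Config d E), IsProbabilityMeasure ν → T.IsInvariant ν → ν = μ :=
    fun ν _ hν => hQ.eq_of_isInvariant hρ hP hT hν hμ
  exact ⟨μ, hμp, hμ.isErgodic hu, hu⟩
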